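/- Let $D\subset\mathbb{R}^2$ be open, $x_0\in D$, $0<\varepsilon<R$ and $\alpha>0$, write $B_r$ for the open ball of centre $x_0$ and radius $r$, and assume $\overline{B_R}\subset D$. Let $h\in L^2(D)$ be real-valued. Put $V_\varepsilon=\{v\in H^1(D\setminus B_\varepsilon)\mid v=0\text{ on }\partial B_\varepsilon\}$, and consider: (P) the perforated problem: find $\widetilde v_\varepsilon\in V_\varepsilon$ with $-\alpha\Delta\widetilde v_\varepsilon+\widetilde v_\varepsilon=h$ in $D\setminus B_\varepsilon$, $\widetilde v_\varepsilon=0$ in $B_\varepsilon$ and $\partial_n\widetilde v_\varepsilon=0$ on $\partial D$, in the weak sense $$\alpha\int_{D\setminus B_\varepsilon}\nabla\widetilde v_\varepsilon\cdot\nabla\varphi\,dx+\int_{D\setminus B_\varepsilon}\widetilde v_\varepsilon\,\varphi\,dx=\int_{D\setminus B_\varepsilon}h\,\varphi\,dx\qquad\text{for all }\varphi\in V_\varepsilon ;$$ (T) the transmission problem: find $v_\varepsilon\in H^1(D\setminus B_R)$ and $v_{\varepsilon,R}\in H^1(B_R\setminus B_\varepsilon)$ such that $v_\varepsilon$ solves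 the exterior problem $$-\alpha\Delta v_\varepsilon+v_\varepsilon=h\ \text{ in }D\setminus B_R,\qquad \partial_n v_\varepsilon=\partial_n v_{\varepsilon,R}\ \text{ on }\partial B_R,\qquad \partial_n v_\varepsilon=0\ \text{ on }\partial D,$$ and $v_{\varepsilon,R}$ solves the interior problem $$-\alpha\Delta v_{\varepsilon,R}+v_{\varepsilon,R}=h\ \text{ in }B_R\setminus B_\varepsilon,\qquad v_{\varepsilon,R}=0\ \text{ on }\partial B_\varepsilon,\qquad v_{\varepsilon,R}=v_\varepsilon\ \text{ on }\partial B_R.$$ Here the equations hold in the sense of distributions, Dirichlet conditions are equalities of traces, the normal derivatives on $\partial B_R$ are elements of $H^{-1/2}(\partial B_R)$ defined by Green's formula (with the same normal, pointing out of $B_R$, on both sides), and the condition on $\partial D$ is also understood through Green's formula. Then (P) has a solution, (T) has a solution, and every solution $\widetilde v_\varepsilon$ of (P) and every solution $(v_\varepsilon,v_{\varepsilon,R})$ of (T) satisfy, almost everywhere, $$\widetilde v_\varepsilon=\begin{cases}v_\varepsilon&\text{in }D\setminus B_R,\\ v_{\varepsilon,R}&\text{in }B_R\setminus B_\varepsilon.\end{cases}$$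 In particular both solutions are unique. -/

import Mathlib

open MeasureTheory Metric
open scoped ContDiff

noncomputable section

/-- The Euclidean plane. -/
abbrev Plane : Type := EuclideanSpace ℝ (Fin 2)

/-- Test functions on the open set `Ω`, i.e. elements of `C_c^∞(Ω)`. -/
structure IsTestFun (Ω : Set Plane) (φ : Plane → ℝ) : Prop where
  smooth : ContDiff ℝ ∞ φ
  compact : HasCompactSupport φ
  supp : tsupport φ ⊆ Ω

/-- `G` is a weak gradient of `u` on `Ω`, and it is square integrable. -/
def IsWeakGrad (Ω : Set Plane) (u : Plane → ℝ) (G : Plane → Plane) : Prop :=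
  MemLp G 2 (volume.restrict Ω) ∧
    ∀ φ : Plane → ℝ, IsTestFun Ω φ → ∀ e : Plane,
      ∫ x in Ω, u x * fderiv ℝ φ x e = -∫ x in Ω, inner ℝ (G x) e * φ x

/-- `u` (restricted to the open set `Ω`) belongs to the Sobolev space `H¹(Ω)`.
Values of `u` outside `Ω` are irrelevant. -/
def MemH1 (Ω : Set Plane) (u : Plane → ℝ) : Prop :=
  MemLp u 2 (volume.restrict Ω) ∧ ∃ G : Plane → Plane, IsWeakGrad Ω u G

open Classical in
/-- The weak gradient on `Ω` of a function in `H¹(Ω)`; it is determined a.e. in `Ω`. -/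
def weakGrad (Ω : Set Plane) (u : Plane → ℝ) : Plane → Plane :=
  if H : ∃ G : Plane → Plane, IsWeakGrad Ω u G then H.choose else 0

/-- The norm of `H¹(Ω)`. -/
def h1Norm (Ω : Set Plane) (u : Plane → ℝ) : ℝ :=
  Real.sqrt ((∫ x in Ω, u x ^ 2) + ∫ x in Ω, ‖weakGrad Ω u x‖ ^ 2)

/-- `w ∈ L²(Ω)` is the distributional Laplacian on `Ω` of the `H¹(Ω)` function `u`. -/
def IsWeakLaplacian (Ω : Set Plane) (u w : Plane → ℝ) : Prop :=
  MemLp w 2 (volume.restrict Ω) ∧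
    ∀ φ : Plane → ℝ, IsTestFun Ω φ →
      ∫ x in Ω, inner ℝ (weakGrad Ω u x) (gradient φ x) = -∫ x in Ω, w x * φ x

open Classical in
/-- The distributional Laplacian on `Ω`, for `u ∈ H¹(Ω)` with `Δu ∈ L²(Ω)`; it is determined
a.e. in `Ω`. -/
def weakLaplacian (Ω : Set Plane) (u : Plane → ℝ) : Plane → ℝ :=
  if H : ∃ w : Plane → ℝ, IsWeakLaplacian Ω u w then H.choose else 0

/-- `-α Δu + u = h` in `Ω`, in the sense of distributions, the Laplacian being in `L²(Ω)`. -/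
def SolvesPDE (Ω : Set Plane) (α : ℝ) (h u : Plane → ℝ) : Prop :=
  (∃ w : Plane → ℝ, IsWeakLaplacian Ω u w) ∧
    ∀ᵐ x ∂(volume.restrict Ω), -α * weakLaplacian Ω u x + u x = h x

/-- The arc length measure on the circle `∂B(x₀, r)`, as a measure on the plane. -/
def circleMeasure (x₀ : Plane) (r : ℝ) : Measure Plane :=
  ENNReal.ofReal r •
    Measure.map (fun z : sphere (0 : Plane) 1 => x₀ + r • (z : Plane))
      (volume : Measure Plane).toSphere

/-- `g` is the trace on the circle `∂B(x₀, r)` of the function `u ∈ H¹(Ω)`, where `Ω` lies on one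
side of the circle near the circle: `(u, g)` is in the closure of the pairs `(φ, φ|_{∂B(x₀, r)})`
with `φ` smooth up to the circle, for the convergence in `H¹` on compact subsets of
`Ω ∪ ∂B(x₀, r)` and in `L²(∂B(x₀, r))`. (The localization makes the notion independent of the
regularity of the rest of `∂Ω`.) -/
def HasTrace (Ω : Set Plane) (x₀ : Plane) (r : ℝ) (u g : Plane → ℝ) : Prop :=
  MemLp g 2 (circleMeasure x₀ r) ∧
    ∀ K : Set Plane, IsCompact K → K ⊆ Ω ∪ sphere x₀ r → ∀ η : ENNReal, 0 < η →
      ∃ φ : Plane → ℝ, ContDiff ℝ ∞ φ ∧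
        eLpNorm (fun x => φ x - u x) 2 (volume.restrict (Ω ∩ K)) < η ∧
        eLpNorm (fun x => gradient φ x - weakGrad Ω u x) 2 (volume.restrict (Ω ∩ K)) < η ∧
        eLpNorm (fun x => φ x - g x) 2 (circleMeasure x₀ r) < η

/-- The part `B_R ∖ B_ε` (without the circles, which are null sets). -/
def annulus (x₀ : Plane) (ε R : ℝ) : Set Plane := ball x₀ R \ closedBall x₀ ε

/-- The open set `D ∖ B_r` (without the circle, which is a null set). -/
def outside (D : Set Plane) (x₀ : Plane) (r : ℝ) : Set Plane := D \ closedBall x₀ r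

/-- `g ∈ H^{1/2}(∂B_r)`: `g` is a trace of an `H¹(B_r ∖ B_{r/2})` function. -/
def MemHHalf (x₀ : Plane) (r : ℝ) (g : Plane → ℝ) : Prop :=
  ∃ u : Plane → ℝ, MemH1 (annulus x₀ (r / 2) r) u ∧ HasTrace (annulus x₀ (r / 2) r) x₀ r u g

/-- The quotient norm of `H^{1/2}(∂B_r)`. -/
def hHalfNorm (x₀ : Plane) (r : ℝ) (g : Plane → ℝ) : ℝ :=
  sInf {t : ℝ | ∃ u : Plane → ℝ, MemH1 (annulus x₀ (r / 2) r) u ∧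
    HasTrace (annulus x₀ (r / 2) r) x₀ r u g ∧ t = h1Norm (annulus x₀ (r / 2) r) u}

/-- `q ∈ H^{-1/2}(∂B_r)`, the dual of `H^{1/2}(∂B_r)`: `q` is linear and bounded on
`H^{1/2}(∂B_r)`. Values of `q` at other functions are irrelevant. -/
structure MemHMinusHalf (x₀ : Plane) (r : ℝ) (q : (Plane → ℝ) → ℝ) : Prop where
  add : ∀ g₁ g₂ : Plane → ℝ, MemHHalf x₀ r g₁ → MemHHalf x₀ r g₂ →
    q (fun x => g₁ x + g₂ x) = q g₁ + q g₂
  smul : ∀ (c : ℝ) (g : Plane → ℝ), MemHHalf x₀ r g → q (fun x => c * g x) = c * q g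
  bounded : ∃ C : ℝ, ∀ g : Plane → ℝ, MemHHalf x₀ r g → |q g| ≤ C * hHalfNorm x₀ r g

/-- The boundary term `∫_Ω ∇u·∇ψ + ∫_Ω (Δu) ψ` of Green's formula on `Ω`. -/
def greenForm (Ω : Set Plane) (u ψ : Plane → ℝ) : ℝ :=
  (∫ x in Ω, inner ℝ (weakGrad Ω u x) (weakGrad Ω ψ x)) + ∫ x in Ω, weakLaplacian Ω u x * ψ x

/-- The functional `q` on `H^{1/2}(∂B_r)` is the normal derivative on `∂B_r` (with the normal
pointing out of `Ω`) of `u ∈ H¹(Ω)` with `Δu ∈ L²(Ω)`, in the usual sense of Green's formula: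
`⟨q, ψ|_{∂B_r}⟩ = ∫_Ω ∇u·∇ψ + ∫_Ω (Δu) ψ` for all `ψ ∈ H¹(Ω)` that vanish near the rest of the
boundary of `Ω`. -/
def HasNormalDeriv (Ω : Set Plane) (x₀ : Plane) (r : ℝ) (u : Plane → ℝ)
    (q : (Plane → ℝ) → ℝ) : Prop :=
  ∀ ψ g : Plane → ℝ, MemH1 Ω ψ →
    (∃ K : Set Plane, IsCompact K ∧ K ⊆ Ω ∪ sphere x₀ r ∧
      ∀ᵐ x ∂(volume.restrict Ω), x ∉ K → ψ x = 0) →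
    HasTrace Ω x₀ r ψ g → greenForm Ω u ψ = q g

/-- The homogeneous Neumann condition `∂_n u = 0` on `∂D` for `u ∈ H¹(D ∖ B_r)` with
`Δu ∈ L²(D ∖ B_r)`, in the sense of Green's formula: the boundary term vanishes for all
`ψ ∈ H¹(D ∖ B_r)` that vanish near `∂B_r`. -/
def NeumannZeroOuter (D : Set Plane) (x₀ : Plane) (r : ℝ) (u : Plane → ℝ) : Prop :=
  ∀ ψ : Plane → ℝ, MemH1 (outside D x₀ r) ψ →
    (∃ ρ : ℝ, r < ρ ∧ ∀ᵐ x ∂(volume.restrict (outside D x₀ r)), x ∈ ball x₀ ρ → ψ x = 0) →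
    greenForm (outside D x₀ r) u ψ = 0

/-- The space `V_ε` of `H¹(D ∖ B_ε)` functions with zero trace on `∂B_ε`. -/
def MemV (D : Set Plane) (x₀ : Plane) (ε : ℝ) (u : Plane → ℝ) : Prop :=
  MemH1 (outside D x₀ ε) u ∧ HasTrace (outside D x₀ ε) x₀ ε u (fun _ => 0)

/-- Weak solutions of the perforated problem: `-αΔu + u = h` in `D ∖ B_ε`, `u = 0` in `B_ε`
(and on `∂B_ε`), `∂_n u = 0` on `∂D`. -/
structure IsPerforatedSolution (D : Set Plane) (x₀ : Plane) (α ε : ℝ) (h u : Plane → ℝ) :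
    Prop where
  mem : MemV D x₀ ε u
  zero_in_hole : ∀ᵐ x ∂(volume.restrict (ball x₀ ε)), u x = 0
  weak : ∀ φ : Plane → ℝ, MemV D x₀ ε φ →
    α * (∫ x in outside D x₀ ε,
        inner ℝ (weakGrad (outside D x₀ ε) u x) (weakGrad (outside D x₀ ε) φ x))
      + (∫ x in outside D x₀ ε, u x * φ x) = ∫ x in outside D x₀ ε, h x * φ x

/-- Solutions of the exterior problem on `D ∖ B_R` with Neumann datum `∂_n v = q` on `∂B_R`,
where `n` points out of `B_R`, that is, into `D ∖ B_R` (whence the sign), and with `∂_n v = 0`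
on `∂D`. -/
structure IsExteriorSolution (D : Set Plane) (x₀ : Plane) (α R : ℝ) (h : Plane → ℝ)
    (q : (Plane → ℝ) → ℝ) (v : Plane → ℝ) : Prop where
  mem : MemH1 (outside D x₀ R) v
  pde : SolvesPDE (outside D x₀ R) α h v
  neumann_inner : HasNormalDeriv (outside D x₀ R) x₀ R v (fun g => -q g)
  neumann_outer : NeumannZeroOuter D x₀ R v

/-- Solutions of the interior problem on `B_R ∖ B_ε` with Dirichlet datum `g` on `∂B_R` and `0` on
`∂B_ε`. -/
structure IsInteriorSolution (x₀ : Plane) (α ε R : ℝ) (h g v : Plane → ℝ) : Prop where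
  mem : MemH1 (annulus x₀ ε R) v
  pde : SolvesPDE (annulus x₀ ε R) α h v
  dirichlet_inner : HasTrace (annulus x₀ ε R) x₀ ε v (fun _ => 0)
  dirichlet_outer : HasTrace (annulus x₀ ε R) x₀ R v g

/-- The pair `(v, vR)` solves the coupled exterior and interior problems: the Neumann datum of the
exterior problem on `∂B_R` is `∂_n vR`, and the Dirichlet datum of the interior problem on `∂B_R` is
the trace of `v`. -/
def IsTransmissionSolution (D : Set Plane) (x₀ : Plane) (α ε R : ℝ) (h v vR : Plane → ℝ) : Prop :=
  ∃ (g : Plane → ℝ) (q : (Plane → ℝ) → ℝ),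
    MemHMinusHalf x₀ R q ∧
    HasNormalDeriv (annulus x₀ ε R) x₀ R vR q ∧ IsExteriorSolution D x₀ α R h q v ∧
    HasTrace (outside D x₀ R) x₀ R v g ∧ IsInteriorSolution x₀ α ε R h g vR

end

/-! Both problems are equivalent to one variational problem on `D ∖ B_ε`: find `u` with zero trace
on `∂B_ε` whose `weakResidual` vanishes against every `H¹` function with zero trace on `∂B_ε`. The
form `α∫∇u·∇φ + ∫uφ` is an inner product on that space, so the problem has exactly one solution.
Existence is an orthogonal projection in `L² × L²` (`exists_weakResidual_eq_zero`); uniqueness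
follows by testing with the difference of two solutions (`ae_eq_of_weakResidual_eq_zero`). This is
(P) up to unfolding.

From (T) to the variational problem (`IsTransmissionSolution.exists_glue`): two `H¹` functions with
equal traces on `∂B_R` glue to an `H¹` function, because the circle terms in Green's formula cancel
(`IsH1Pair.glue`). To see that the residual of the glued function vanishes, a test function is cut
into three pieces. The piece near `∂B_ε` has zero trace there, hence is a limit of test functions of
the annulus (`HasTrace.exists_testFun_approx`), against which the distributional equation gives
zero. The piece away from `B_R` is handled by the Neumann condition on `∂D`. The middle piece sees
only `∂B_R`, where the two normal derivatives are `q` and `-q`.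

From (P) to (T) (`IsPerforatedSolution.isTransmissionSolution`): the same function is used on both
sides of `∂B_R`. The trace inequality gives it one trace on that circle, valid from both sides
(`IsH1Pair.exists_trace`). Its normal derivative is the functional defined by Green's formula. It
depends on the boundary values only, and is the same from both sides, because test functions from
the two sides with equal traces glue to an admissible test function. Its bound on `H^{1/2}` comes
from Cauchy–Schwarz.

No regularity of `∂D` is available, so every trace argument is local near a circle. The analytic
input on circles is the divergence theorem on a disc, proved in polar coordinates. -/

open Filter Topology Set

/-! ### Convergence in `L²` of sequences of functions. -/

section SquareIntegrableLimits

variable {X E : Type*} [MeasurableSpace X] [NormedAddCommGroup E]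

/-- Convergence of a sequence of functions in `L²(μ)`. -/
structure L2Tendsto (μ : Measure X) (f : ℕ → X → E) (g : X → E) : Prop where
  mem_left : ∀ n, MemLp (f n) 2 μ
  mem_right : MemLp g 2 μ
  lim : Tendsto (fun n => eLpNorm (fun x => f n x - g x) 2 μ) atTop (𝓝 0)

namespace L2Tendsto

variable {μ ν : Measure X} {f f' : ℕ → X → E} {g g' : X → E}

theorem const (hg : MemLp g 2 μ) : L2Tendsto μ (fun _ => g) g :=
  ⟨fun _ => hg, hg, by simp⟩

theorem mono_measure (h : L2Tendsto ν f g) (hμ : μ ≤ ν) : L2Tendsto μ f g :=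
  ⟨fun n => (h.mem_left n).mono_measure hμ, h.mem_right.mono_measure hμ,
    tendsto_of_tendsto_of_tendsto_of_le_of_le tendsto_const_nhds h.lim (fun _ => zero_le)
      (fun _ => eLpNorm_mono_measure _ hμ)⟩

theorem mono_set {μ : Measure X} {S T : Set X} (h : L2Tendsto (μ.restrict T) f g) (hS : S ⊆ T) :
    L2Tendsto (μ.restrict S) f g :=
  h.mono_measure (Measure.restrict_mono hS le_rfl)

theorem congr (h : L2Tendsto μ f g) (hf : ∀ n, f n =ᵐ[μ] f' n) (hg : g =ᵐ[μ] g') :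
    L2Tendsto μ f' g' := by
  refine ⟨fun n => (memLp_congr_ae (hf n)).1 (h.mem_left n), (memLp_congr_ae hg).1 h.mem_right, ?_⟩
  refine h.lim.congr fun n => eLpNorm_congr_ae ?_
  filter_upwards [hf n, hg] with x h1 h2
  rw [h1, h2]

theorem congr_right (h : L2Tendsto μ f g) (hg : g =ᵐ[μ] g') : L2Tendsto μ f g' :=
  h.congr (fun _ => EventuallyEq.rfl) hg

theorem of_le (hf : ∀ n, MemLp (f n) 2 μ) (hg : MemLp g 2 μ) {b : ℕ → ENNReal}
    (hb : Tendsto b atTop (𝓝 0)) (h : ∀ n, eLpNorm (fun x => f n x - g x) 2 μ ≤ b n) :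
    L2Tendsto μ f g :=
  ⟨hf, hg, tendsto_of_tendsto_of_tendsto_of_le_of_le tendsto_const_nhds hb (fun _ => zero_le) h⟩

theorem add (h : L2Tendsto μ f g) (h' : L2Tendsto μ f' g') :
    L2Tendsto μ (fun n x => f n x + f' n x) (fun x => g x + g' x) := by
  refine of_le (fun n => (h.mem_left n).add (h'.mem_left n)) (h.mem_right.add h'.mem_right)
    (by simpa using h.lim.add h'.lim) fun n => ?_
  have := eLpNorm_add_le ((h.mem_left n).sub h.mem_right).1 ((h'.mem_left n).sub h'.mem_right).1
    (p := 2) (by norm_num)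
  refine le_trans (le_of_eq ?_) this
  congr 1; ext x; simp only [Pi.add_apply, Pi.sub_apply]; abel

theorem of_norm_le {F : Type*} [NormedAddCommGroup F] {k : ℕ → X → F} {l : X → F} {C : ℝ}
    (h : L2Tendsto μ f g) (hk : ∀ n, MemLp (k n) 2 μ) (hl : MemLp l 2 μ)
    (hC : ∀ n, ∀ᵐ x ∂μ, ‖k n x - l x‖ ≤ C * ‖f n x - g x‖) : L2Tendsto μ k l := by
  have := ENNReal.Tendsto.const_mul (a := ENNReal.ofReal C) h.lim (Or.inr ENNReal.ofReal_ne_top)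
  rw [mul_zero] at this
  exact of_le hk hl this fun n => eLpNorm_le_mul_eLpNorm_of_ae_le_mul (hC n) 2

section Smul
variable [NormedSpace ℝ E]

theorem smul_field {u : ℕ → X → ℝ} {v : X → ℝ} {a : X → E} {C : ℝ} (h : L2Tendsto μ u v)
    (ha : AEStronglyMeasurable a μ) (hC : ∀ᵐ x ∂μ, ‖a x‖ ≤ C) :
    L2Tendsto μ (fun n x => u n x • a x) (fun x => v x • a x) := by
  have key : ∀ w : X → ℝ, MemLp w 2 μ → MemLp (fun x => w x • a x) 2 μ := fun w hw =>
    hw.of_le_mul (hw.1.smul ha) (c := C) (by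
      filter_upwards [hC] with x hx
      rw [norm_smul, mul_comm]
      gcongr)
  refine h.of_norm_le (C := C) (fun n => key _ (h.mem_left n)) (key _ h.mem_right) fun n => ?_
  filter_upwards [hC] with x hx
  rw [← sub_smul, norm_smul, mul_comm]
  gcongr

theorem bdd_smul {a : X → ℝ} {C : ℝ} (h : L2Tendsto μ f g)
    (ha : AEStronglyMeasurable a μ) (hC : ∀ᵐ x ∂μ, ‖a x‖ ≤ C) :
    L2Tendsto μ (fun n x => a x • f n x) (fun x => a x • g x) := by
  have key : ∀ w : X → E, MemLp w 2 μ → MemLp (fun x => a x • w x) 2 μ := fun w hw =>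
    hw.of_le_mul (ha.smul hw.1) (c := C) (by
      filter_upwards [hC] with x hx
      rw [norm_smul]
      gcongr)
  refine h.of_norm_le (C := C) (fun n => key _ (h.mem_left n)) (key _ h.mem_right) fun n => ?_
  filter_upwards [hC] with x hx
  rw [← smul_sub, norm_smul]
  gcongr

theorem const_smul (c : ℝ) (h : L2Tendsto μ f g) :
    L2Tendsto μ (fun n x => c • f n x) (fun x => c • g x) :=
  h.bdd_smul (a := fun _ => c) (C := ‖c‖) aestronglyMeasurable_const (by simp)

end Smul

theorem tendsto_integral_inner {E : Type*} [NormedAddCommGroup E] [InnerProductSpace ℝ E]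
    {f f' : ℕ → X → E} {g g' : X → E} (h : L2Tendsto μ f g) (h' : L2Tendsto μ f' g') :
    Tendsto (fun n => ∫ x, inner ℝ (f n x) (f' n x) ∂μ) atTop
      (𝓝 (∫ x, inner ℝ (g x) (g' x) ∂μ)) := by
  have key : ∀ {a b : X → E} (ha : MemLp a 2 μ) (hb : MemLp b 2 μ),
      ∫ x, inner ℝ (a x) (b x) ∂μ = inner ℝ (ha.toLp a) (hb.toLp b) := by
    intro a b ha hb
    rw [L2.inner_def]
    refine integral_congr_ae ?_
    filter_upwards [ha.coeFn_toLp, hb.coeFn_toLp] with x h1 h2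
    rw [h1, h2]
  have lp : ∀ {f : ℕ → X → E} {g : X → E} (h : L2Tendsto μ f g),
      Tendsto (fun n => (h.mem_left n).toLp (f n)) atTop (𝓝 (h.mem_right.toLp g)) := fun h =>
    (Lp.tendsto_Lp_iff_tendsto_eLpNorm'' _ h.mem_left _ h.mem_right).2 h.lim
  rw [key h.mem_right h'.mem_right]
  simp_rw [fun n => key (h.mem_left n) (h'.mem_left n)]
  exact (lp h).inner (lp h')

theorem tendsto_integral_mul {u u' : ℕ → X → ℝ} {v v' : X → ℝ} (h : L2Tendsto μ u v)
    (h' : L2Tendsto μ u' v') :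
    Tendsto (fun n => ∫ x, u n x * u' n x ∂μ) atTop (𝓝 (∫ x, v x * v' x ∂μ)) := by
  simpa [mul_comm] using h.tendsto_integral_inner h'

/-- On `T` every function involved agrees almost everywhere with its indicator on `S`. This lets
approximations known only on the support of a cutoff be used on a larger set. -/
theorem of_vanish {μ : Measure X} {S T : Set X} (h : L2Tendsto (μ.restrict S) f g)
    (hS : MeasurableSet S) (hf : ∀ n, ∀ᵐ x ∂(μ.restrict T), x ∉ S → f n x = 0)
    (hg : ∀ᵐ x ∂(μ.restrict T), x ∉ S → g x = 0) : L2Tendsto (μ.restrict T) f g := by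
  have e : ∀ k : X → E, (∀ᵐ x ∂(μ.restrict T), x ∉ S → k x = 0) →
      k =ᵐ[μ.restrict T] S.indicator k := fun k hk => by
    filter_upwards [hk] with x hx
    by_cases hxS : x ∈ S
    · simp [hxS]
    · simp [hxS, hx hxS]
  have key : ∀ k : X → E, MemLp k 2 (μ.restrict S) →
      (∀ᵐ x ∂(μ.restrict T), x ∉ S → k x = 0) → MemLp k 2 (μ.restrict T) := fun k hk hk0 => by
    rw [memLp_congr_ae (e k hk0)]
    exact ((memLp_indicator_iff_restrict hS).2 hk).mono_measure Measure.restrict_le_self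
  refine of_le (fun n => key _ (h.mem_left n) (hf n)) (key _ h.mem_right hg) h.lim fun n => ?_
  have : ∀ᵐ x ∂(μ.restrict T), x ∉ S → f n x - g x = 0 := by
    filter_upwards [hf n, hg] with x h1 h2 hx
    rw [h1 hx, h2 hx, sub_zero]
  rw [eLpNorm_congr_ae (e _ this), ← eLpNorm_indicator_eq_eLpNorm_restrict hS]
  exact eLpNorm_mono_measure _ Measure.restrict_le_self

end L2Tendsto

/-- A sequence which is Cauchy in `L²` converges in `L²`. -/
theorem exists_l2Tendsto_of_cauchy [CompleteSpace E] {μ : Measure X} {f : ℕ → X → E}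
    (hf : ∀ n, MemLp (f n) 2 μ) {b : ℕ → ℕ → ENNReal}
    (hb : ∀ η > 0, ∃ N, ∀ n ≥ N, ∀ m ≥ N, b n m < η)
    (h : ∀ n m, eLpNorm (fun x => f n x - f m x) 2 μ ≤ b n m) : ∃ g, L2Tendsto μ f g := by
  have hc : CauchySeq (fun n => (hf n).toLp (f n)) := by
    rw [EMetric.cauchySeq_iff]
    intro η hη
    obtain ⟨N, hN⟩ := hb η hη
    refine ⟨N, fun m hm n hn => ?_⟩
    rw [Lp.edist_toLp_toLp]
    exact (h m n).trans_lt (hN m hm n hn)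
  obtain ⟨g, hg⟩ := cauchySeq_tendsto_of_complete hc
  refine ⟨g, hf, Lp.memLp g, ?_⟩
  rw [← Lp.toLp_coeFn g (Lp.memLp g)] at hg
  exact (Lp.tendsto_Lp_iff_tendsto_eLpNorm'' _ hf _ (Lp.memLp g)).1 hg

end SquareIntegrableLimits

/-! ### Gradients of smooth functions, cutoffs and multipliers. -/

section Gradients

theorem inner_gradient_eq_fderiv (φ : Plane → ℝ) (x e : Plane) :
    inner ℝ (gradient φ x) e = fderiv ℝ φ x e :=
  InnerProductSpace.toDual_symm_apply

theorem ContDiff.continuous_gradient {φ : Plane → ℝ} (h : ContDiff ℝ ∞ φ) :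
    Continuous (gradient φ) :=
  (LinearIsometryEquiv.continuous _).comp (h.continuous_fderiv (by simp))

theorem gradient_congr_nhds {φ ψ : Plane → ℝ} {x : Plane} (h : φ =ᶠ[𝓝 x] ψ) :
    gradient φ x = gradient ψ x := by
  simp only [gradient, h.fderiv_eq]

theorem gradient_eq_zero_of_notMem_tsupport {φ : Plane → ℝ} {x : Plane} (h : x ∉ tsupport φ) :
    gradient φ x = 0 := by
  rw [gradient_congr_nhds (notMem_tsupport_iff_eventuallyEq.1 h)]
  simp [gradient]

theorem HasCompactSupport.gradient {φ : Plane → ℝ} (h : HasCompactSupport φ) :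
    HasCompactSupport (gradient φ) :=
  HasCompactSupport.intro h fun _ hx => gradient_eq_zero_of_notMem_tsupport hx

theorem gradient_mul_smooth {φ ψ : Plane → ℝ} (hφ : ContDiff ℝ ∞ φ) (hψ : ContDiff ℝ ∞ ψ)
    (x : Plane) :
    gradient (fun y => φ y * ψ y) x = φ x • gradient ψ x + ψ x • gradient φ x := by
  have h1 := hφ.differentiable (by simp) x
  have h2 := hψ.differentiable (by simp) x
  simp only [gradient, fderiv_fun_mul h1 h2, map_add, map_smul]

theorem gradient_add_smooth {φ ψ : Plane → ℝ} (hφ : ContDiff ℝ ∞ φ) (hψ : ContDiff ℝ ∞ ψ)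
    (x : Plane) :
    gradient (fun y => φ y + ψ y) x = gradient φ x + gradient ψ x := by
  have h1 := hφ.differentiable (by simp) x
  have h2 := hψ.differentiable (by simp) x
  simp only [gradient, fderiv_fun_add h1 h2, map_add]

theorem gradient_sub_smooth {φ ψ : Plane → ℝ} (hφ : ContDiff ℝ ∞ φ) (hψ : ContDiff ℝ ∞ ψ)
    (x : Plane) :
    gradient (fun y => φ y - ψ y) x = gradient φ x - gradient ψ x := by
  have h1 := hφ.differentiable (by simp) x
  have h2 := hψ.differentiable (by simp) x
  simp only [gradient, fderiv_fun_sub h1 h2, map_sub]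

/-- Smooth cutoff functions. -/
theorem exists_cutoff {K U : Set Plane} (hK : IsCompact K) (hU : IsOpen U) (hKU : K ⊆ U) :
    ∃ χ : Plane → ℝ, IsTestFun U χ ∧ ∀ᶠ x in 𝓝ˢ K, χ x = 1 := by
  obtain ⟨V, hV, hKV, hVU, hVc⟩ := exists_open_between_and_isCompact_closure hK hU hKU
  obtain ⟨f, hf1, hf0, -⟩ := exists_contMDiffMap_one_nhds_of_subset_interior
    (modelWithCornersSelf ℝ Plane) (n := ⊤) hK.isClosed (t := closure V)
    (hKV.trans (interior_maximal subset_closure hV))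
  have hs : tsupport f ⊆ closure V :=
    closure_minimal (fun x hx => by_contra fun h => hx (hf0 x h)) isClosed_closure
  exact ⟨f, ⟨f.contMDiff.contDiff, hVc.of_isClosed_subset (isClosed_tsupport _) hs, hs.trans hVU⟩,
    hf1⟩

namespace IsTestFun

variable {Ω Ω' : Set Plane} {φ : Plane → ℝ}

theorem mono (h : IsTestFun Ω φ) (hΩ : Ω ⊆ Ω') : IsTestFun Ω' φ :=
  ⟨h.smooth, h.compact, h.supp.trans hΩ⟩

theorem mul_left (h : IsTestFun Ω φ) {χ : Plane → ℝ} (hχ : ContDiff ℝ ∞ χ) :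
    IsTestFun Ω (fun x => χ x * φ x) :=
  ⟨hχ.mul h.smooth, h.compact.mul_left, (closure_mono (by
    intro x hx; simp only [Function.mem_support] at hx ⊢; exact right_ne_zero_of_mul hx)).trans
      h.supp⟩

theorem eq_zero (h : IsTestFun Ω φ) {x : Plane} (hx : x ∉ Ω) : φ x = 0 :=
  image_eq_zero_of_notMem_tsupport fun hx' => hx (h.supp hx')

theorem gradient_eq_zero (h : IsTestFun Ω φ) {x : Plane} (hx : x ∉ Ω) : gradient φ x = 0 :=
  gradient_eq_zero_of_notMem_tsupport fun hx' => hx (h.supp hx')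

theorem memLp (h : IsTestFun Ω φ) (S : Set Plane) : MemLp φ 2 (volume.restrict S) :=
  h.smooth.continuous.memLp_of_hasCompactSupport h.compact

theorem memLp_gradient (h : IsTestFun Ω φ) (S : Set Plane) :
    MemLp (gradient φ) 2 (volume.restrict S) :=
  h.smooth.continuous_gradient.memLp_of_hasCompactSupport h.compact.gradient

theorem continuous_fderiv_apply (h : IsTestFun Ω φ) (e : Plane) :
    Continuous fun x => fderiv ℝ φ x e :=
  (h.smooth.continuous_fderiv (by simp)).clm_apply continuous_const

theorem memLp_fderiv (h : IsTestFun Ω φ) (e : Plane) (S : Set Plane) :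
    MemLp (fun x => fderiv ℝ φ x e) 2 (volume.restrict S) :=
  (h.continuous_fderiv_apply e).memLp_of_hasCompactSupport (h.compact.fderiv_apply (𝕜 := ℝ) e)

end IsTestFun

/-- Smooth functions which are bounded together with their gradient. -/
structure IsMultiplier (χ : Plane → ℝ) : Prop where
  smooth : ContDiff ℝ ∞ χ
  bounded : ∃ C : ℝ, ∀ x, ‖χ x‖ ≤ C ∧ ‖gradient χ x‖ ≤ C

theorem IsTestFun.isMultiplier {Ω : Set Plane} {χ : Plane → ℝ} (h : IsTestFun Ω χ) :
    IsMultiplier χ := by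
  obtain ⟨C, hC⟩ := h.compact.exists_bound_of_continuous h.smooth.continuous
  obtain ⟨C', hC'⟩ := h.compact.gradient.exists_bound_of_continuous h.smooth.continuous_gradient
  exact ⟨h.smooth, max C C', fun x => ⟨(hC x).trans (le_max_left _ _),
    (hC' x).trans (le_max_right _ _)⟩⟩

theorem IsMultiplier.sub {χ χ' : Plane → ℝ} (h : IsMultiplier χ) (h' : IsMultiplier χ') :
    IsMultiplier (fun x => χ x - χ' x) := by
  obtain ⟨C, hC⟩ := h.bounded
  obtain ⟨C', hC'⟩ := h'.bounded
  refine ⟨h.smooth.sub h'.smooth, C + C', fun x => ⟨?_, ?_⟩⟩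
  · exact (norm_sub_le _ _).trans (add_le_add (hC x).1 (hC' x).1)
  · rw [gradient_sub_smooth h.smooth h'.smooth]
    exact (norm_sub_le _ _).trans (add_le_add (hC x).2 (hC' x).2)

theorem isMultiplier_one : IsMultiplier (fun _ => 1) :=
  ⟨contDiff_const, 1, fun x => by simp [gradient]⟩

end Gradients

/-! ### Calculus of weak gradients. -/

section H1Pairs

/-- `u ∈ H¹(Ω)` with weak gradient `G`. -/
structure IsH1Pair (Ω : Set Plane) (u : Plane → ℝ) (G : Plane → Plane) : Prop where
  memLp : MemLp u 2 (volume.restrict Ω)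
  grad : IsWeakGrad Ω u G

variable {Ω Ω' : Set Plane} {u u' : Plane → ℝ} {G G' : Plane → Plane}

theorem MemH1.isH1Pair (h : MemH1 Ω u) : IsH1Pair Ω u (weakGrad Ω u) := by
  refine ⟨h.1, ?_⟩
  rw [weakGrad, dif_pos h.2]
  exact h.2.choose_spec

theorem integrable_mul_of_l2 {X : Type*} [MeasurableSpace X] {μ : Measure X} {f g : X → ℝ}
    (hf : MemLp f 2 μ) (hg : MemLp g 2 μ) : Integrable (fun x => f x * g x) μ :=
  hf.integrable_mul hg

theorem integrable_inner_of_l2 {X E : Type*} [MeasurableSpace X] [NormedAddCommGroup E]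
    [InnerProductSpace ℝ E] {μ : Measure X} {f g : X → E}
    (hf : MemLp f 2 μ) (hg : MemLp g 2 μ) : Integrable (fun x => inner ℝ (f x) (g x)) μ := by
  refine (hf.norm.integrable_mul hg.norm).mono' (hf.1.inner hg.1) ?_
  exact Eventually.of_forall fun x => norm_inner_le_norm _ _

namespace IsH1Pair

theorem memH1 (h : IsH1Pair Ω u G) : MemH1 Ω u := ⟨h.memLp, G, h.grad⟩

theorem memLp_grad (h : IsH1Pair Ω u G) : MemLp G 2 (volume.restrict Ω) := h.grad.1

theorem integral_eq (h : IsH1Pair Ω u G) {φ : Plane → ℝ} (hφ : IsTestFun Ω φ) (e : Plane) :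
    ∫ x in Ω, u x * fderiv ℝ φ x e = -∫ x in Ω, inner ℝ (G x) e * φ x :=
  h.grad.2 φ hφ e

/-- The fundamental lemma of the calculus of variations applies to `⟨G - G', e⟩` for each fixed `e`,
and two basis vectors suffice. Hence the choice made in `weakGrad` is harmless, and any convenient
gradient can be used instead. -/
theorem grad_unique (hΩ : IsOpen Ω) (h : IsH1Pair Ω u G) (h' : IsH1Pair Ω u G') :
    G =ᵐ[volume.restrict Ω] G' := by
  have hl : MemLp (fun x => G x - G' x) 2 (volume.restrict Ω) := h.memLp_grad.sub h'.memLp_grad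
  have key : ∀ e : Plane, ∀ᵐ x ∂(volume.restrict Ω), inner ℝ (G x - G' x) e = 0 := by
    intro e
    have hle : MemLp (fun x => inner ℝ (G x - G' x) e) 2 (volume.restrict Ω) :=
      hl.of_le_mul (c := ‖e‖) (hl.1.inner aestronglyMeasurable_const) (Eventually.of_forall fun x =>
        by rw [mul_comm]; exact norm_inner_le_norm _ _)
    have := hΩ.ae_eq_zero_of_integral_contDiff_smul_eq_zero
      (locallyIntegrableOn_of_locallyIntegrable_restrict (hle.locallyIntegrable (by norm_num)))
      (fun φ h1 h2 h3 => ?_)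
    · rw [ae_restrict_iff' hΩ.measurableSet]
      exact this
    · have hφ : IsTestFun Ω φ := ⟨h1, h2, h3⟩
      rw [← setIntegral_eq_integral_of_forall_compl_eq_zero (s := Ω)
        (fun x hx => by rw [hφ.eq_zero hx, zero_smul])]
      have e1 := (h.integral_eq hφ e).symm.trans (h'.integral_eq hφ e)
      have hin : ∀ {G : Plane → Plane}, MemLp G 2 (volume.restrict Ω) →
          Integrable (fun x => inner ℝ (G x) e * φ x) (volume.restrict Ω) := fun {G} hG =>
        integrable_mul_of_l2 (hG.of_le_mul (c := ‖e‖) (hG.1.inner aestronglyMeasurable_const)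
          (Eventually.of_forall fun x => by rw [mul_comm]; exact norm_inner_le_norm _ _))
          (hφ.memLp Ω)
      have e2 : ∀ x, φ x • inner ℝ (G x - G' x) e
          = inner ℝ (G x) e * φ x - inner ℝ (G' x) e * φ x := fun x => by
        rw [inner_sub_left, smul_eq_mul]; ring
      simp_rw [e2]
      rw [integral_sub (hin h.memLp_grad) (hin h'.memLp_grad)]
      linarith
  filter_upwards [key (EuclideanSpace.single 0 1), key (EuclideanSpace.single 1 1)] with x h0 h1
  have : G x - G' x = 0 := by
    ext i
    fin_cases i
    · simpa [EuclideanSpace.inner_single_right] using h0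
    · simpa [EuclideanSpace.inner_single_right] using h1
  exact sub_eq_zero.1 this

theorem weakGrad_ae (hΩ : IsOpen Ω) (h : IsH1Pair Ω u G) :
    weakGrad Ω u =ᵐ[volume.restrict Ω] G :=
  grad_unique hΩ h.memH1.isH1Pair h

theorem congr (h : IsH1Pair Ω u G) (hu : u =ᵐ[volume.restrict Ω] u')
    (hG : G =ᵐ[volume.restrict Ω] G') : IsH1Pair Ω u' G' := by
  refine ⟨(memLp_congr_ae hu).1 h.memLp, (memLp_congr_ae hG).1 h.memLp_grad, fun φ hφ e => ?_⟩
  have e1 : ∫ x in Ω, u' x * fderiv ℝ φ x e = ∫ x in Ω, u x * fderiv ℝ φ x e :=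
    integral_congr_ae (by filter_upwards [hu] with x hx; rw [hx])
  have e2 : ∫ x in Ω, inner ℝ (G' x) e * φ x = ∫ x in Ω, inner ℝ (G x) e * φ x :=
    integral_congr_ae (by filter_upwards [hG] with x hx; rw [hx])
  rw [e1, e2, h.integral_eq hφ e]

/-- The weak gradient is a closed operator: for a fixed test function both sides of its defining
identity are continuous in `L²`. -/
theorem of_l2Tendsto {v : ℕ → Plane → ℝ} {H : ℕ → Plane → Plane}
    (h : ∀ n, IsH1Pair Ω (v n) (H n)) (hu : L2Tendsto (volume.restrict Ω) v u)
    (hG : L2Tendsto (volume.restrict Ω) H G) : IsH1Pair Ω u G := by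
  refine ⟨hu.mem_right, hG.mem_right, fun φ hφ e => ?_⟩
  have t1 := hu.tendsto_integral_mul (L2Tendsto.const (hφ.memLp_fderiv e Ω))
  have t2 := hG.tendsto_integral_inner (L2Tendsto.const
    (((L2Tendsto.const (hφ.memLp Ω)).smul_field (a := fun _ => e) (C := ‖e‖)
      aestronglyMeasurable_const (by simp)).mem_right))
  simp only [inner_smul_right] at t2
  simp_rw [fun n => (h n).integral_eq hφ e, mul_comm (inner ℝ _ _)] at t1
  simp_rw [mul_comm (inner ℝ _ _)]
  exact tendsto_nhds_unique t1 t2.neg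

theorem zero : IsH1Pair Ω (fun _ => 0) (fun _ => 0) := by
  refine ⟨MemLp.zero, MemLp.zero, fun φ hφ e => by simp⟩

theorem mono (h : IsH1Pair Ω u G) (hΩ : Ω' ⊆ Ω) : IsH1Pair Ω' u G := by
  refine ⟨h.memLp.mono_measure (Measure.restrict_mono hΩ le_rfl),
    h.memLp_grad.mono_measure (Measure.restrict_mono hΩ le_rfl), fun φ hφ e => ?_⟩
  have e1 := h.integral_eq (hφ.mono hΩ) e
  have z1 : ∀ x, x ∉ Ω' → u x * fderiv ℝ φ x e = 0 := fun x hx => by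
    rw [← inner_gradient_eq_fderiv, hφ.gradient_eq_zero hx, inner_zero_left, mul_zero]
  have z2 : ∀ x, x ∉ Ω' → inner ℝ (G x) e * φ x = 0 := fun x hx => by
    rw [hφ.eq_zero hx, mul_zero]
  rw [setIntegral_eq_integral_of_forall_compl_eq_zero fun x hx => z1 x hx,
    setIntegral_eq_integral_of_forall_compl_eq_zero fun x hx => z2 x hx]
  rwa [setIntegral_eq_integral_of_forall_compl_eq_zero fun x hx => z1 x fun h => hx (hΩ h),
    setIntegral_eq_integral_of_forall_compl_eq_zero fun x hx => z2 x fun h => hx (hΩ h)] at e1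

theorem integrable_left (h : MemLp u 2 (volume.restrict Ω)) {φ : Plane → ℝ} (hφ : IsTestFun Ω φ)
    (e : Plane) : Integrable (fun x => u x * fderiv ℝ φ x e) (volume.restrict Ω) :=
  integrable_mul_of_l2 h (hφ.memLp_fderiv e Ω)

theorem memLp_inner {G : Plane → Plane} (h : MemLp G 2 (volume.restrict Ω)) (e : Plane) :
    MemLp (fun x => inner ℝ (G x) e) 2 (volume.restrict Ω) :=
  h.of_le_mul (c := ‖e‖) (h.1.inner aestronglyMeasurable_const)
    (Eventually.of_forall fun x => by rw [mul_comm]; exact norm_inner_le_norm _ _)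

theorem integrable_right (h : MemLp G 2 (volume.restrict Ω)) {φ : Plane → ℝ}
    (hφ : IsTestFun Ω φ) (e : Plane) :
    Integrable (fun x => inner ℝ (G x) e * φ x) (volume.restrict Ω) :=
  integrable_mul_of_l2 (memLp_inner h e) (hφ.memLp Ω)

theorem add (h : IsH1Pair Ω u G) (h' : IsH1Pair Ω u' G') :
    IsH1Pair Ω (fun x => u x + u' x) (fun x => G x + G' x) := by
  refine ⟨h.memLp.add h'.memLp, h.memLp_grad.add h'.memLp_grad, fun φ hφ e => ?_⟩
  simp_rw [inner_add_left, add_mul]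
  rw [integral_add (integrable_left h.memLp hφ e) (integrable_left h'.memLp hφ e),
    integral_add (integrable_right h.memLp_grad hφ e) (integrable_right h'.memLp_grad hφ e),
    h.integral_eq hφ e, h'.integral_eq hφ e, neg_add]

theorem const_smul (c : ℝ) (h : IsH1Pair Ω u G) :
    IsH1Pair Ω (fun x => c * u x) (fun x => c • G x) := by
  refine ⟨h.memLp.const_mul c, h.memLp_grad.const_smul c, fun φ hφ e => ?_⟩
  simp_rw [inner_smul_left, mul_assoc]
  rw [integral_const_mul, h.integral_eq hφ e, RCLike.conj_to_real, integral_const_mul]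
  ring

theorem sub (h : IsH1Pair Ω u G) (h' : IsH1Pair Ω u' G') :
    IsH1Pair Ω (fun x => u x - u' x) (fun x => G x - G' x) := by
  simpa [sub_eq_add_neg] using h.add (h'.const_smul (-1))

/-- If `φ` is a test function so is `χφ`; the classical product rule for `∇(χφ)` inside the identity
for `u` yields the product rule for `χu`. -/
theorem mul_smooth (h : IsH1Pair Ω u G) {χ : Plane → ℝ} (hχ : IsMultiplier χ) :
    IsH1Pair Ω (fun x => χ x * u x) (fun x => χ x • G x + u x • gradient χ x) := by
  obtain ⟨C, hC⟩ := hχ.bounded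
  have m1 : MemLp (fun x => χ x * u x) 2 (volume.restrict Ω) :=
    ((L2Tendsto.const h.memLp).bdd_smul hχ.smooth.continuous.aestronglyMeasurable
      (Eventually.of_forall fun x => (hC x).1)).mem_right
  have m2 : MemLp (fun x => χ x • G x) 2 (volume.restrict Ω) :=
    ((L2Tendsto.const h.memLp_grad).bdd_smul hχ.smooth.continuous.aestronglyMeasurable
      (Eventually.of_forall fun x => (hC x).1)).mem_right
  have m3 : MemLp (fun x => u x • gradient χ x) 2 (volume.restrict Ω) :=
    ((L2Tendsto.const h.memLp).smul_field hχ.smooth.continuous_gradient.aestronglyMeasurable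
      (Eventually.of_forall fun x => (hC x).2)).mem_right
  refine ⟨m1, m2.add m3, fun φ hφ e => ?_⟩
  have hχφ := hφ.mul_left hχ.smooth
  have e1 := h.integral_eq hχφ e
  have e2 : ∀ x, u x * fderiv ℝ (fun y => χ y * φ y) x e
      = χ x * u x * fderiv ℝ φ x e + inner ℝ (u x • gradient χ x) e * φ x := fun x => by
    rw [← inner_gradient_eq_fderiv, gradient_mul_smooth hχ.smooth hφ.smooth, inner_add_left,
      inner_smul_left, inner_smul_left, inner_smul_left, inner_gradient_eq_fderiv, RCLike.conj_to_real,
      RCLike.conj_to_real, RCLike.conj_to_real]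
    ring
  have e3 : ∀ x, inner ℝ (G x) e * (χ x * φ x) = inner ℝ (χ x • G x) e * φ x := fun x => by
    rw [inner_smul_left, RCLike.conj_to_real]; ring
  simp_rw [e2, e3] at e1
  rw [integral_add (integrable_left m1 hφ e) (integrable_right m3 hφ e)] at e1
  simp_rw [inner_add_left, add_mul]
  rw [integral_add (integrable_right m2 hφ e) (integrable_right m3 hφ e)]
  linarith

/-- On the open set `Ω ∖ F` both `G` and `0` are weak gradients of the zero function. -/
theorem grad_eq_zero (hΩ : IsOpen Ω) (h : IsH1Pair Ω u G) {F : Set Plane} (hF : IsClosed F)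
    (h0 : ∀ᵐ x ∂(volume.restrict Ω), x ∉ F → u x = 0) :
    ∀ᵐ x ∂(volume.restrict Ω), x ∉ F → G x = 0 := by
  have ho : IsOpen (Ω \ F) := hΩ.sdiff hF
  have h1 : IsH1Pair (Ω \ F) u G := h.mono sdiff_subset
  rw [ae_restrict_iff' hΩ.measurableSet] at h0 ⊢
  have h2 : u =ᵐ[volume.restrict (Ω \ F)] fun _ => 0 := by
    rw [EventuallyEq, ae_restrict_iff' ho.measurableSet]
    filter_upwards [h0] with x hx hxF using hx hxF.1 hxF.2
  have h3 := grad_unique ho (h1.congr h2 EventuallyEq.rfl) IsH1Pair.zero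
  rw [EventuallyEq, ae_restrict_iff' ho.measurableSet] at h3
  filter_upwards [h3] with x hx h4 h5 using hx ⟨h4, h5⟩

theorem memLp_indicator {E : Type*} [NormedAddCommGroup E] {f : Plane → E}
    (hΩ' : MeasurableSet Ω') (h : MemLp f 2 (volume.restrict Ω')) :
    MemLp (Ω'.indicator f) 2 (volume.restrict Ω) :=
  ((memLp_indicator_iff_restrict hΩ').2 h).mono_measure Measure.restrict_le_self

/-- Extension by zero of functions vanishing near the part of `∂Ω'` inside `Ω`. -/
theorem extend_zero (hΩ' : IsOpen Ω') (hsub : Ω' ⊆ Ω) (h : IsH1Pair Ω' u G)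
    {F : Set Plane} (hF : IsClosed F) (hFΩ : F ∩ Ω ⊆ Ω')
    (h0 : ∀ᵐ x ∂(volume.restrict Ω'), x ∉ F → u x = 0) :
    IsH1Pair Ω (Ω'.indicator u) (Ω'.indicator G) := by
  have hG0 := h.grad_eq_zero hΩ' hF h0
  refine ⟨memLp_indicator hΩ'.measurableSet h.memLp,
    memLp_indicator hΩ'.measurableSet h.memLp_grad, fun φ hφ e => ?_⟩
  -- `φ` need not be supported in `Ω'`, but `φχ` is, and it coincides with `φ` near every point of
  -- `F`. Since `u` and `G` vanish off `F`, replacing `φ` by `φχ` changes neither integral.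
  obtain ⟨χ, hχ, hχ1⟩ := exists_cutoff (K := F ∩ tsupport φ) (hφ.compact.inter_left hF) hΩ'
    fun x hx => hFΩ ⟨hx.1, hφ.supp hx.2⟩
  have hχφ : IsTestFun Ω' (fun x => φ x * χ x) := hχ.mul_left hφ.smooth
  have near : ∀ x ∈ F, (fun y => φ y * χ y) =ᶠ[𝓝 x] φ := by
    intro x hx
    by_cases hxs : x ∈ tsupport φ
    · filter_upwards [eventually_nhdsSet_iff_forall.1 hχ1 x ⟨hx, hxs⟩] with y hy
      rw [hy, mul_one]
    · filter_upwards [notMem_tsupport_iff_eventuallyEq.1 hxs] with y hy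
      rw [hy]; simp
  have i1 : ∫ x in Ω, Ω'.indicator u x * fderiv ℝ φ x e = ∫ x in Ω', u x * fderiv ℝ φ x e := by
    rw [← inter_eq_right.2 hsub, ← setIntegral_indicator hΩ'.measurableSet,
      inter_eq_right.2 hsub]
    congr 1; ext x
    by_cases hx : x ∈ Ω' <;> simp [hx]
  have i2 : ∫ x in Ω, inner ℝ (Ω'.indicator G x) e * φ x = ∫ x in Ω', inner ℝ (G x) e * φ x := by
    rw [← inter_eq_right.2 hsub, ← setIntegral_indicator hΩ'.measurableSet,
      inter_eq_right.2 hsub]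
    congr 1; ext x
    by_cases hx : x ∈ Ω' <;> simp [hx]
  have j1 : ∫ x in Ω', u x * fderiv ℝ φ x e
      = ∫ x in Ω', u x * fderiv ℝ (fun y => φ y * χ y) x e := by
    refine integral_congr_ae ?_
    filter_upwards [h0] with x hx
    by_cases hxF : x ∈ F
    · rw [(near x hxF).fderiv_eq]
    · rw [hx hxF, zero_mul, zero_mul]
  have j2 : ∫ x in Ω', inner ℝ (G x) e * φ x
      = ∫ x in Ω', inner ℝ (G x) e * (φ x * χ x) := by
    refine integral_congr_ae ?_
    filter_upwards [hG0] with x hx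
    by_cases hxF : x ∈ F
    · have := (near x hxF).self_of_nhds
      simp only at this
      rw [this]
    · simp [hx hxF]
  rw [i1, i2, j1, j2, h.integral_eq hχφ e]

/-- The test function is supported in `Ω`, so both integrals extend to the whole plane, where
integration by parts has no boundary term. -/
theorem of_smooth {φ : Plane → ℝ} (hφ : ContDiff ℝ ∞ φ) (h1 : MemLp φ 2 (volume.restrict Ω))
    (h2 : MemLp (gradient φ) 2 (volume.restrict Ω)) : IsH1Pair Ω φ (gradient φ) := by
  refine ⟨h1, h2, fun ψ hψ e => ?_⟩
  simp_rw [inner_gradient_eq_fderiv]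
  have z1 : ∀ x, x ∉ Ω → φ x * fderiv ℝ ψ x e = 0 := fun x hx => by
    rw [← inner_gradient_eq_fderiv, hψ.gradient_eq_zero hx, inner_zero_left, mul_zero]
  have z2 : ∀ x, x ∉ Ω → fderiv ℝ φ x e * ψ x = 0 := fun x hx => by
    rw [hψ.eq_zero hx, mul_zero]
  rw [setIntegral_eq_integral_of_forall_compl_eq_zero z1,
    setIntegral_eq_integral_of_forall_compl_eq_zero z2]
  have c1 : Continuous fun x => fderiv ℝ φ x e :=
    (hφ.continuous_fderiv (by simp)).clm_apply continuous_const
  refine integral_mul_fderiv_eq_neg_fderiv_mul_of_integrable ?_ ?_ ?_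
    (fun x _ => hφ.differentiable (by simp) x) (fun x _ => hψ.smooth.differentiable (by simp) x)
  · exact (c1.mul hψ.smooth.continuous).integrable_of_hasCompactSupport hψ.compact.mul_left
  · exact (hφ.continuous.mul (hψ.continuous_fderiv_apply e)).integrable_of_hasCompactSupport
      (hψ.compact.fderiv_apply (𝕜 := ℝ) e).mul_left
  · exact (hφ.continuous.mul hψ.smooth.continuous).integrable_of_hasCompactSupport
      hψ.compact.mul_left

end IsH1Pair

theorem IsTestFun.isH1Pair {φ : Plane → ℝ} (hφ : IsTestFun Ω φ) :
    IsH1Pair Ω' φ (gradient φ) :=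
  IsH1Pair.of_smooth hφ.smooth (hφ.memLp _) (hφ.memLp_gradient _)

end H1Pairs

/-! ### Density arguments for families of operators on `L²`. -/

section Density

variable {E : Type*} [NormedAddCommGroup E]

/-- A sequence of uniformly bounded additive operators which converges to the identity on
continuous functions with compact support does so on `L²`. -/
theorem l2Tendsto_of_dense [NormedSpace ℝ E] {T : ℕ → (Plane → E) → Plane → E} {C : ENNReal}
    (hC : C ≠ ⊤)
    (hm : ∀ n f, MemLp f 2 volume → MemLp (T n f) 2 volume)
    (hT : ∀ n f, MemLp f 2 volume → eLpNorm (T n f) 2 volume ≤ C * eLpNorm f 2 volume)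
    (hs : ∀ n f g, MemLp f 2 volume → MemLp g 2 volume →
      T n (f - g) =ᵐ[volume] T n f - T n g)
    (hd : ∀ k : Plane → E, Continuous k → HasCompactSupport k →
      L2Tendsto volume (fun n => T n k) k)
    {f : Plane → E} (hf : MemLp f 2 volume) : L2Tendsto volume (fun n => T n f) f := by
  refine ⟨fun n => hm n f hf, hf, ?_⟩
  rw [ENNReal.tendsto_atTop_zero]
  intro η hη
  -- For `k` within `δ` of `f`, the three errors `T(f - k)`, `Tk - k` and `k - f` contribute `Cδ`,
  -- `δ` and `δ`.
  obtain ⟨δ, hδ, hδη⟩ : ∃ δ : ENNReal, 0 < δ ∧ (C + 1) * δ + δ ≤ η := by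
    have ht : Tendsto (fun δ : ENNReal => (C + 1) * δ + δ) (𝓝 0) (𝓝 ((C + 1) * 0 + 0)) :=
      (ENNReal.Tendsto.const_mul tendsto_id (Or.inr (by simp [hC]))).add tendsto_id
    rw [mul_zero, add_zero] at ht
    obtain ⟨δ, h1, h2⟩ := ((ht.mono_left (nhdsWithin_le_nhds (s := Ioi 0))).eventually
      (Iic_mem_nhds hη)).and self_mem_nhdsWithin |>.exists
    exact ⟨δ, h2, h1⟩
  obtain ⟨k, hk1, hk2, hk3, hk4⟩ :=
    hf.exists_hasCompactSupport_eLpNorm_sub_le (by norm_num) hδ.ne'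
  obtain ⟨N, hN⟩ := ENNReal.tendsto_atTop_zero.1 (hd k hk3 hk1).lim δ hδ
  refine ⟨N, fun n hn => ?_⟩
  have mfk := hf.sub hk4
  have e1 : eLpNorm (fun x => T n f x - f x) 2 volume
      = eLpNorm (T n (f - k) + ((fun x => T n k x - k x) + (k - f))) 2 volume := by
    refine eLpNorm_congr_ae ?_
    filter_upwards [hs n f k hf hk4] with x hx
    simp only [Pi.add_apply, hx, Pi.sub_apply]
    abel
  have mk : MemLp (fun x => T n k x - k x) 2 volume := (hm n k hk4).sub hk4
  calc eLpNorm (fun x => T n f x - f x) 2 volume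
      ≤ eLpNorm (T n (f - k)) 2 volume + (eLpNorm (fun x => T n k x - k x) 2 volume
          + eLpNorm (k - f) 2 volume) := by
        rw [e1]
        refine (eLpNorm_add_le (hm n _ mfk).1 (mk.add (hk4.sub hf)).1 (by norm_num)).trans ?_
        gcongr
        exact eLpNorm_add_le mk.1 (hk4.sub hf).1 (by norm_num)
    _ ≤ C * δ + (δ + δ) := by
        rw [eLpNorm_sub_comm k f]
        gcongr
        · exact (hT n _ mfk).trans (by gcongr)
        · exact hN n hn
    _ = (C + 1) * δ + δ := by ring
    _ ≤ η := hδη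

/-- A uniform error `c` supported in `S` has `L²` norm at most `c μ(S)^{1/2}`. -/
theorem l2Tendsto_of_uniform {X : Type*} [MeasurableSpace X] {μ : Measure X} {S : Set X}
    {k : ℕ → X → E} {l : X → E}
    (hm : ∀ n, MemLp (k n) 2 μ) (hl : MemLp l 2 μ) (hS : MeasurableSet S) (hμ : μ S ≠ ⊤)
    (hk0 : ∀ n, ∀ x ∉ S, k n x = 0) (hl0 : ∀ x ∉ S, l x = 0)
    (hu : ∀ η > 0, ∃ N, ∀ n ≥ N, ∀ x, dist (k n x) (l x) ≤ η) : L2Tendsto μ k l := by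
  refine ⟨hm, hl, ENNReal.tendsto_atTop_zero.2 fun η hη => ?_⟩
  have ht : Tendsto (fun c : ℝ => ENNReal.ofReal c * μ S ^ (1 / (2 : ENNReal).toReal)) (𝓝 0)
      (𝓝 (ENNReal.ofReal 0 * μ S ^ (1 / (2 : ENNReal).toReal))) :=
    ENNReal.Tendsto.mul_const ((ENNReal.continuous_ofReal.tendsto 0)) (Or.inr
      (ENNReal.rpow_ne_top_of_nonneg (by positivity) hμ))
  rw [ENNReal.ofReal_zero, zero_mul] at ht
  obtain ⟨c, h1, h2⟩ := ((ht.mono_left (nhdsWithin_le_nhds (s := Ioi 0))).eventually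
      (Iic_mem_nhds hη)).and self_mem_nhdsWithin |>.exists
  obtain ⟨N, hN⟩ := hu c h2
  exact ⟨N, fun n hn => (eLpNorm_sub_le_of_dist_bdd μ (by norm_num) hS (le_of_lt h2) (hN n hn)
    (fun x hx => by_contra fun h => hx (hk0 n x h))
    (fun x hx => by_contra fun h => hx (hl0 x h))).trans h1⟩

end Density

/-! ### Mollification and approximation by test functions. -/

section Mollification

variable {E : Type*} [NormedAddCommGroup E] [NormedSpace ℝ E]

/-- Convolution with a normalized smooth bump function. -/
noncomputable def mollify (ρ : ContDiffBump (0 : Plane)) (f : Plane → E) : Plane → E :=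
  convolution (ρ.normed volume) f (ContinuousLinearMap.lsmul ℝ ℝ) volume

theorem mollify_congr (ρ : ContDiffBump (0 : Plane)) {f g : Plane → E} (h : f =ᵐ[volume] g) :
    mollify ρ f = mollify ρ g :=
  convolution_congr _ EventuallyEq.rfl h

theorem mollify_apply (ρ : ContDiffBump (0 : Plane)) (f : Plane → E) (x : Plane) :
    mollify ρ f x = ∫ t, ρ.normed volume t • f (x - t) := rfl

theorem convolutionExistsAt_mollify [CompleteSpace E] (ρ : ContDiffBump (0 : Plane))
    {f : Plane → E} (hf : LocallyIntegrable f volume) (x : Plane) :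
    ConvolutionExistsAt (ρ.normed volume) f x (ContinuousLinearMap.lsmul ℝ ℝ) volume :=
  ρ.hasCompactSupport_normed.convolutionExists_left _ ρ.continuous_normed hf x

/-- The kernel is a probability density, so monotonicity of `Lᵖ` norms for probability measures
bounds `|ρ * f|²` by `ρ * |f|²` pointwise. Tonelli and translation invariance finish. -/
theorem eLpNorm_mollify_le (ρ : ContDiffBump (0 : Plane)) {f : Plane → E}
    (hf : MemLp f 2 volume) : eLpNorm (mollify ρ f) 2 volume ≤ eLpNorm f 2 volume := by
  wlog hfm : StronglyMeasurable f generalizing f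
  · have := this ((memLp_congr_ae hf.1.ae_eq_mk).1 hf) hf.1.stronglyMeasurable_mk
    rwa [← mollify_congr ρ hf.1.ae_eq_mk, ← eLpNorm_congr_ae hf.1.ae_eq_mk] at this
  set w : Plane → ENNReal := fun t => ENNReal.ofReal (ρ.normed volume t) with hw
  have hwm : Measurable w := (ρ.continuous_normed (μ := volume)).measurable.ennreal_ofReal
  have hw1 : ∫⁻ t, w t = 1 := by
    rw [hw, ← ofReal_integral_eq_lintegral_ofReal ρ.integrable_normed
      (Eventually.of_forall ρ.nonneg_normed), ρ.integral_normed, ENNReal.ofReal_one]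
  have : IsProbabilityMeasure (volume.withDensity w) :=
    ⟨by rw [withDensity_apply _ MeasurableSet.univ, Measure.restrict_univ, hw1]⟩
  have hme : ∀ x, Measurable fun t => ‖f (x - t)‖ₑ := fun x =>
    (hfm.comp_measurable (measurable_const.sub measurable_id)).enorm
  have pt : ∀ x, ‖mollify ρ f x‖ₑ ^ (2 : ℝ) ≤ ∫⁻ t, w t * ‖f (x - t)‖ₑ ^ (2 : ℝ) := by
    intro x
    have a1 : ‖mollify ρ f x‖ₑ ≤ ∫⁻ t, ‖f (x - t)‖ₑ ∂(volume.withDensity w) := by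
      rw [lintegral_withDensity_eq_lintegral_mul _ hwm (hme x)]
      refine (enorm_integral_le_lintegral_enorm _).trans (le_of_eq (lintegral_congr fun t => ?_))
      rw [Pi.mul_apply, ContinuousLinearMap.lsmul_apply, enorm_smul,
        Real.enorm_eq_ofReal (ρ.nonneg_normed t)]
    have a2 := eLpNorm_le_eLpNorm_of_exponent_le (μ := volume.withDensity w) (p := 1) (q := 2)
      (by norm_num) (hfm.comp_measurable (measurable_const.sub measurable_id) :
        StronglyMeasurable fun t => f (x - t)).aestronglyMeasurable
    rw [eLpNorm_one_eq_lintegral_enorm] at a2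
    have a3 := ENNReal.rpow_le_rpow (a1.trans a2) (by norm_num : (0 : ℝ) ≤ 2)
    refine a3.trans (le_of_eq ?_)
    rw [eLpNorm_eq_lintegral_rpow_enorm_toReal (by norm_num) (by norm_num), ← ENNReal.rpow_mul]
    norm_num
    rw [lintegral_withDensity_eq_lintegral_mul _ hwm ((hme x).pow_const 2)]
    rfl
  rw [eLpNorm_eq_lintegral_rpow_enorm_toReal (by norm_num) (by norm_num),
    eLpNorm_eq_lintegral_rpow_enorm_toReal (by norm_num) (by norm_num)]
  refine ENNReal.rpow_le_rpow ?_ (by norm_num)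
  simp only [ENNReal.toReal_ofNat]
  calc ∫⁻ x, ‖mollify ρ f x‖ₑ ^ (2 : ℝ)
      ≤ ∫⁻ x, ∫⁻ t, w t * ‖f (x - t)‖ₑ ^ (2 : ℝ) := lintegral_mono pt
    _ = ∫⁻ t, ∫⁻ x, w t * ‖f (x - t)‖ₑ ^ (2 : ℝ) := by
        refine lintegral_lintegral_swap (Measurable.aemeasurable ?_)
        exact (hwm.comp measurable_snd).mul
          ((hfm.comp_measurable (measurable_fst.sub measurable_snd)).enorm.pow_const _)
    _ = ∫⁻ t, w t * ∫⁻ x, ‖f x‖ₑ ^ (2 : ℝ) := by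
        refine lintegral_congr fun t => ?_
        rw [lintegral_const_mul' _ _ ENNReal.ofReal_ne_top,
          lintegral_sub_right_eq_self (fun x => ‖f x‖ₑ ^ (2 : ℝ)) t]
    _ = ∫⁻ x, ‖f x‖ₑ ^ (2 : ℝ) := by
        rw [lintegral_mul_const _ hwm, hw1, one_mul]

theorem contDiff_mollify [CompleteSpace E] (ρ : ContDiffBump (0 : Plane)) {f : Plane → E}
    (hf : LocallyIntegrable f volume) : ContDiff ℝ ∞ (mollify ρ f) :=
  ρ.hasCompactSupport_normed.contDiff_convolution_left (n := ⊤) _ ρ.contDiff_normed hf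

theorem memLp_mollify [CompleteSpace E] (ρ : ContDiffBump (0 : Plane)) {f : Plane → E}
    (hf : MemLp f 2 volume) : MemLp (mollify ρ f) 2 volume :=
  ⟨(contDiff_mollify ρ (hf.locallyIntegrable (by norm_num))).continuous.aestronglyMeasurable,
    (eLpNorm_mollify_le ρ hf).trans_lt hf.2⟩

theorem support_mollify_subset (ρ : ContDiffBump (0 : Plane)) {f : Plane → E} {K : Set Plane}
    (hf : ∀ᵐ x, x ∉ K → f x = 0) :
    tsupport (mollify ρ f) ⊆ cthickening ρ.rOut K := by
  have e : f =ᵐ[volume] K.indicator f := by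
    filter_upwards [hf] with x hx
    by_cases h : x ∈ K
    · simp [h]
    · simp [h, hx h]
  rw [mollify_congr ρ e]
  refine closure_minimal ?_ isClosed_cthickening
  refine (support_convolution_subset _).trans ?_
  rw [ρ.support_normed_eq]
  rintro _ ⟨a, ha, b, hb, rfl⟩
  refine mem_cthickening_of_dist_le _ b _ _ (support_indicator_subset hb) ?_
  simpa using (mem_ball_zero_iff.1 ha).le

/-- Bump functions with support shrinking to the origin. -/
noncomputable def bumpSeq (n : ℕ) : ContDiffBump (0 : Plane) where
  rIn := 1 / (2 * (n + 1))
  rOut := 1 / (n + 1)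
  rIn_pos := by positivity
  rIn_lt_rOut := by
    rw [div_lt_div_iff_of_pos_left] <;> first | positivity | skip
    have : (0 : ℝ) < n + 1 := by positivity
    linarith

theorem tendsto_rOut_bumpSeq : Tendsto (fun n => (bumpSeq n).rOut) atTop (𝓝 0) :=
  tendsto_one_div_add_atTop_nhds_zero_nat

/-- Mollifiers are contractions of `L²`. For continuous `k` with compact support, convergence is
uniform, and all radii are at most `1`, so the supports stay in one compact thickening. -/
theorem l2Tendsto_mollify [CompleteSpace E] {f : Plane → E} (hf : MemLp f 2 volume) :
    L2Tendsto volume (fun n => mollify (bumpSeq n) f) f := by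
  refine l2Tendsto_of_dense (T := fun n => mollify (bumpSeq n)) (C := 1) (by simp)
    (fun n f hf => memLp_mollify _ hf) (fun n f hf => by simpa using eLpNorm_mollify_le _ hf)
    (fun n f g hf hg => ?_) (fun k hk hks => ?_) hf
  · refine Eventually.of_forall fun x => ?_
    have h1 := convolutionExistsAt_mollify (bumpSeq n) (hf.locallyIntegrable (by norm_num)) x
    have h2 := convolutionExistsAt_mollify (bumpSeq n) (hg.locallyIntegrable (by norm_num)) x
    have := integral_sub h1.integrable h2.integrable
    simp only [mollify_apply, Pi.sub_apply, smul_sub]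
    exact this
  · have hkm : MemLp k 2 volume := hk.memLp_of_hasCompactSupport hks
    have hs0 : ∀ x ∉ tsupport k, k x = 0 := fun x hx => image_eq_zero_of_notMem_tsupport hx
    have hle : ∀ n, (bumpSeq n).rOut ≤ 1 := fun n => by
      change 1 / ((n : ℝ) + 1) ≤ 1
      rw [div_le_one (by positivity)]; linarith [n.cast_nonneg (α := ℝ)]
    have hcpt : IsCompact (cthickening 1 (tsupport k)) := IsCompact.cthickening hks
    refine l2Tendsto_of_uniform (S := cthickening 1 (tsupport k))
      (fun n => memLp_mollify _ hkm) hkm hcpt.measurableSet hcpt.measure_lt_top.ne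
      (fun n x hx => ?_) (fun x hx => hs0 x fun h => hx (self_subset_cthickening _ h)) ?_
    · refine image_eq_zero_of_notMem_tsupport fun h => hx ?_
      exact cthickening_mono (hle n) _
        (support_mollify_subset _ (Eventually.of_forall hs0) h)
    · intro η hη
      obtain ⟨δ, hδ, hkδ⟩ := Metric.uniformContinuous_iff.1
        (hks.uniformContinuous_of_continuous hk) η hη
      obtain ⟨N, hN⟩ := eventually_atTop.1 (tendsto_rOut_bumpSeq.eventually (gt_mem_nhds hδ))
      refine ⟨N, fun n hn x => ?_⟩
      exact (bumpSeq n).dist_normed_convolution_le hk.aestronglyMeasurable fun y hy =>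
        (hkδ ((mem_ball.1 hy).trans (hN n hn))).le

/-- The derivative is put on the kernel, and the weak identity for `u` is applied with the test
function `y ↦ ρ(x - y)`. The sign from differentiating `x - y` cancels the one from integration by
parts. -/
theorem gradient_mollify {u : Plane → ℝ} {G : Plane → Plane} (h : IsH1Pair univ u G)
    (ρ : ContDiffBump (0 : Plane)) (x : Plane) :
    gradient (mollify ρ u) x = mollify ρ G x := by
  have hu : MemLp u 2 volume := by simpa using h.memLp
  have hG : MemLp G 2 volume := by simpa using h.memLp_grad
  have hul := hu.locallyIntegrable (by norm_num)
  have hGl := hG.locallyIntegrable (by norm_num)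
  have hρ : ContDiff ℝ 1 (ρ.normed volume) := ρ.contDiff_normed (n := 1)
  refine ext_inner_right ℝ fun e => ?_
  rw [inner_gradient_eq_fderiv]
  have hd := (ρ.hasCompactSupport_normed (μ := volume)).hasFDerivAt_convolution_left
    (ContinuousLinearMap.lsmul ℝ ℝ) hρ hul x
  have e1 : fderiv ℝ (mollify ρ u) x e
      = ∫ t, fderiv ℝ (ρ.normed volume) t e * u (x - t) := by
    rw [show mollify ρ u = convolution (ρ.normed volume) u (ContinuousLinearMap.lsmul ℝ ℝ) volume
      from rfl, hd.fderiv]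
    have := ((ρ.hasCompactSupport_normed (μ := volume)).fderiv ℝ).convolutionExists_left
      ((ContinuousLinearMap.lsmul ℝ ℝ).precompL Plane : _ →L[ℝ] ℝ →L[ℝ] _)
      (hρ.continuous_fderiv one_ne_zero) hul x
    rw [convolution_def, ContinuousLinearMap.integral_apply this]
    rfl
  have e2 : inner ℝ (mollify ρ G x) e = ∫ t, ρ.normed volume t * inner ℝ (G (x - t)) e := by
    have hint := (convolutionExistsAt_mollify ρ hGl x).integrable
    rw [real_inner_comm, mollify_apply]
    refine (integral_inner hint e).symm.trans ?_
    congr 1; ext t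
    rw [ContinuousLinearMap.lsmul_apply, inner_smul_right, real_inner_comm]
  have hψ : IsTestFun univ (fun y => ρ.normed volume (x - y)) := by
    refine ⟨ρ.contDiff_normed.comp (contDiff_const.sub contDiff_id), ?_, subset_univ _⟩
    exact ρ.hasCompactSupport_normed.comp_homeomorph (Homeomorph.subLeft x)
  have e3 := h.integral_eq hψ e
  simp only [Measure.restrict_univ] at e3
  have e4 : ∀ y, fderiv ℝ (fun y => ρ.normed volume (x - y)) y e
      = -fderiv ℝ (ρ.normed volume) (x - y) e := fun y => by
    have h1 : HasFDerivAt (fun y : Plane => x - y) (-ContinuousLinearMap.id ℝ Plane) y :=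
      (hasFDerivAt_id y).const_sub x
    have := ((hρ.differentiable one_ne_zero (x - y)).hasFDerivAt.comp y h1).fderiv
    rw [show (fun y => ρ.normed volume (x - y)) = ρ.normed volume ∘ fun y => x - y from rfl, this]
    simp
  simp_rw [e4] at e3
  rw [e1, e2, ← integral_sub_left_eq_self _ volume x,
    ← integral_sub_left_eq_self (fun t => ρ.normed volume t * inner ℝ (G (x - t)) e) volume x]
  simp only [sub_sub_cancel]
  simp only [mul_neg, integral_neg, neg_inj] at e3
  simp_rw [mul_comm _ (u _), mul_comm _ (inner ℝ _ _)]
  exact e3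

/-- Approximation of compactly supported `H¹` functions by test functions. -/
theorem exists_testFun_l2Tendsto {u : Plane → ℝ} {G : Plane → Plane} (h : IsH1Pair univ u G)
    {K U : Set Plane} (hK : IsCompact K) (hU : IsOpen U) (hKU : K ⊆ U)
    (h0 : ∀ᵐ x, x ∉ K → u x = 0) :
    ∃ φ : ℕ → Plane → ℝ, (∀ n, IsTestFun U (φ n)) ∧ L2Tendsto volume φ u ∧
      L2Tendsto volume (fun n => gradient (φ n)) G := by
  have hu : MemLp u 2 volume := by simpa using h.memLp
  have hG : MemLp G 2 volume := by simpa using h.memLp_grad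
  -- Mollification spreads the support by `rOut`; discarding the first `N` mollifiers keeps that
  -- below the distance `δ` still inside `U`.
  obtain ⟨δ, hδ, hKδ⟩ := hK.exists_cthickening_subset_open hU hKU
  obtain ⟨N, hN⟩ := eventually_atTop.1 (tendsto_rOut_bumpSeq.eventually (gt_mem_nhds hδ))
  have hsub : ∀ n, tsupport (mollify (bumpSeq (n + N)) u) ⊆ cthickening δ K := fun n =>
    (support_mollify_subset _ h0).trans (cthickening_mono (hN _ (by omega)).le _)
  have shift : ∀ {E : Type} [NormedAddCommGroup E] {f : ℕ → Plane → E} {g : Plane → E},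
      L2Tendsto volume f g → L2Tendsto volume (fun n => f (n + N)) g := fun hh =>
    ⟨fun n => hh.mem_left _, hh.mem_right, hh.lim.comp (tendsto_add_atTop_nat N)⟩
  refine ⟨fun n => mollify (bumpSeq (n + N)) u, fun n => ⟨?_, ?_, (hsub n).trans hKδ⟩,
    shift (l2Tendsto_mollify hu), ?_⟩
  · exact contDiff_mollify _ (hu.locallyIntegrable (by norm_num))
  · exact (IsCompact.cthickening hK).of_isClosed_subset (isClosed_tsupport _) (hsub n)
  · have := shift (l2Tendsto_mollify hG)
    refine this.congr (fun n => Eventually.of_forall fun x => ?_) EventuallyEq.rfl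
    exact (gradient_mollify h _ x).symm

end Mollification

/-! ### Dilations, used later to push supports off a circle. -/

section Dilation

/-- The dilation with centre `x₀` and factor `t`. -/
noncomputable def dilation (x₀ : Plane) (t : ℝ) (x : Plane) : Plane := x₀ + t • (x - x₀)

theorem dilation_inv (x₀ : Plane) {t : ℝ} (ht : t ≠ 0) (x : Plane) :
    dilation x₀ t⁻¹ (dilation x₀ t x) = x := by
  simp [dilation, smul_smul, ht]

theorem continuous_dilation (x₀ : Plane) (t : ℝ) : Continuous (dilation x₀ t) := by
  unfold dilation; fun_prop

theorem norm_dilation_sub (x₀ : Plane) {t : ℝ} (ht : 0 ≤ t) (x : Plane) :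
    dist (dilation x₀ t x) x₀ = t * dist x x₀ := by
  rw [dist_eq_norm, dist_eq_norm, dilation, add_sub_cancel_left, norm_smul, Real.norm_of_nonneg ht]

/-- A dilation with nonzero factor, as a homeomorphism. -/
noncomputable def dilationHomeo (x₀ : Plane) {t : ℝ} (ht : t ≠ 0) : Plane ≃ₜ Plane where
  toFun := dilation x₀ t
  invFun := dilation x₀ t⁻¹
  left_inv := dilation_inv x₀ ht
  right_inv x := by simpa using dilation_inv x₀ (inv_ne_zero ht) x
  continuous_toFun := continuous_dilation _ _
  continuous_invFun := continuous_dilation _ _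

theorem map_dilation (x₀ : Plane) {t : ℝ} (ht : t ≠ 0) :
    Measure.map (dilation x₀ t) volume = ENNReal.ofReal |(t ^ 2)⁻¹| • (volume : Measure Plane) := by
  have e : dilation x₀ t = (fun x => x₀ + x) ∘ (fun x => t • x) ∘ (fun x => x - x₀) := rfl
  have h1 : Measure.map (fun x : Plane => t • x) volume
      = ENNReal.ofReal |(t ^ 2)⁻¹| • (volume : Measure Plane) := by
    have := Measure.map_addHaar_smul (volume : Measure Plane) ht
    rwa [finrank_euclideanSpace_fin] at this
  rw [e, ← Measure.map_map (by fun_prop) (by fun_prop), ← Measure.map_map (by fun_prop)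
    (by fun_prop), map_sub_right_eq_self, h1, Measure.map_smul, map_add_left_eq_self]

variable {E : Type*} [NormedAddCommGroup E]

theorem memLp_comp_dilation (x₀ : Plane) {t : ℝ} (ht : t ≠ 0) {f : Plane → E}
    (hf : MemLp f 2 volume) : MemLp (fun x => f (dilation x₀ t x)) 2 volume := by
  have h := (dilationHomeo x₀ ht).measurableEmbedding.memLp_map_measure_iff (g := f) (p := 2)
    (μ := volume)
  change MemLp f 2 (Measure.map (dilation x₀ t) volume) ↔ _ at h
  rw [map_dilation x₀ ht] at h
  exact h.1 (hf.smul_measure ENNReal.ofReal_ne_top)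

/-- In the plane the change of variables costs a factor `t⁻² ≤ 4` on squared norms, hence `2` on
norms. The bound is uniform in `t ≥ 1/2`, as the density argument requires. -/
theorem eLpNorm_comp_dilation_le (x₀ : Plane) {t : ℝ} (ht : 1 / 2 ≤ t) (f : Plane → E) :
    eLpNorm (fun x => f (dilation x₀ t x)) 2 volume ≤ 2 * eLpNorm f 2 volume := by
  have ht0 : t ≠ 0 := by linarith
  have h := (dilationHomeo x₀ ht0).measurableEmbedding.eLpNorm_map_measure (g := f) (p := 2)
    (μ := volume)
  change eLpNorm f 2 (Measure.map (dilation x₀ t) volume) = _ at h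
  rw [map_dilation x₀ ht0] at h
  change eLpNorm (f ∘ dilation x₀ t) 2 volume ≤ _
  change _ = eLpNorm (f ∘ dilation x₀ t) 2 volume at h
  rw [← h, eLpNorm_smul_measure_of_ne_top (by norm_num), smul_eq_mul]
  gcongr
  have h4 : ENNReal.ofReal |(t ^ 2)⁻¹| ≤ 2 ^ (2 : ℝ) := by
    rw [abs_of_nonneg (by positivity)]
    have : (t ^ 2)⁻¹ ≤ 4 := by
      rw [inv_le_comm₀ (by positivity) (by norm_num)]
      nlinarith
    calc ENNReal.ofReal (t ^ 2)⁻¹ ≤ ENNReal.ofReal 4 := ENNReal.ofReal_le_ofReal this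
      _ = 2 ^ (2 : ℝ) := by norm_num
  calc ENNReal.ofReal |(t ^ 2)⁻¹| ^ (1 / (2 : ENNReal)).toReal
      ≤ (2 ^ (2 : ℝ)) ^ (1 / (2 : ENNReal)).toReal := ENNReal.rpow_le_rpow h4 (by positivity)
    _ = 2 := by rw [← ENNReal.rpow_mul]; norm_num

theorem l2Tendsto_comp_dilation [NormedSpace ℝ E] (x₀ : Plane) {t : ℕ → ℝ}
    (ht : Tendsto t atTop (𝓝 1)) (h2 : ∀ n, 1 / 2 ≤ t n) {f : Plane → E}
    (hf : MemLp f 2 volume) : L2Tendsto volume (fun n x => f (dilation x₀ (t n) x)) f := by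
  have ht0 : ∀ n, t n ≠ 0 := fun n => by linarith [h2 n]
  refine l2Tendsto_of_dense (T := fun n f x => f (dilation x₀ (t n) x)) (C := 2) (by simp)
    (fun n f hf => memLp_comp_dilation x₀ (ht0 n) hf)
    (fun n f hf => eLpNorm_comp_dilation_le x₀ (h2 n) f)
    (fun n f g hf hg => EventuallyEq.rfl) (fun k hk hks => ?_) hf
  have hkm : MemLp k 2 volume := hk.memLp_of_hasCompactSupport hks
  obtain ⟨ρ, hρ0, hρ⟩ : ∃ ρ > 0, tsupport k ⊆ closedBall x₀ ρ := by
    obtain ⟨ρ, hρ⟩ := hks.isBounded.subset_closedBall x₀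
    exact ⟨max ρ 1, by positivity, hρ.trans (closedBall_subset_closedBall (le_max_left _ _))⟩
  have hk0 : ∀ x, ρ < dist x x₀ → k x = 0 := fun x hx =>
    image_eq_zero_of_notMem_tsupport fun h => hx.not_ge (mem_closedBall.1 (hρ h))
  have hd : ∀ n x, 2 * ρ < dist x x₀ → ρ < dist (dilation x₀ (t n) x) x₀ := fun n x hx => by
    rw [norm_dilation_sub x₀ (by linarith [h2 n])]
    nlinarith [h2 n]
  refine l2Tendsto_of_uniform (S := closedBall x₀ (2 * ρ))
    (fun n => memLp_comp_dilation x₀ (ht0 n) hkm) hkm measurableSet_closedBall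
    measure_closedBall_lt_top.ne (fun n x hx => ?_) (fun x hx => ?_) ?_
  · exact hk0 _ (hd n x (not_le.1 hx))
  · rw [mem_closedBall, not_le] at hx
    exact hk0 _ (by linarith)
  · intro η hη
    obtain ⟨δ, hδ, hkδ⟩ := Metric.uniformContinuous_iff.1
      (hks.uniformContinuous_of_continuous hk) η hη
    obtain ⟨N, hN⟩ := eventually_atTop.1 (ht.eventually
      (Metric.ball_mem_nhds 1 (ε := δ / (2 * ρ)) (by positivity)))
    refine ⟨N, fun n hn x => ?_⟩
    by_cases hx : dist x x₀ ≤ 2 * ρ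
    · refine (hkδ ?_).le
      have e : dilation x₀ (t n) x - x = (t n - 1) • (x - x₀) := by
        rw [dilation, sub_smul, one_smul]; abel
      have h1 := hN n hn
      rw [Real.dist_eq, lt_div_iff₀ (by positivity)] at h1
      rw [dist_eq_norm, e, norm_smul, Real.norm_eq_abs, ← dist_eq_norm]
      exact (mul_le_mul_of_nonneg_left hx (abs_nonneg _)).trans_lt h1
    · rw [not_le] at hx
      rw [hk0 _ (hd n x hx), hk0 x (by linarith), dist_self]
      exact hη.le

theorem gradient_comp_dilation (x₀ : Plane) (t : ℝ) {φ : Plane → ℝ} (hφ : ContDiff ℝ ∞ φ)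
    (x : Plane) :
    gradient (fun y => φ (dilation x₀ t y)) x = t • gradient φ (dilation x₀ t x) := by
  have h1 : HasFDerivAt (dilation x₀ t) (t • ContinuousLinearMap.id ℝ Plane) x :=
    (((hasFDerivAt_id x).sub_const x₀).const_smul t).const_add x₀
  have h2 := ((hφ.differentiable (by simp) (dilation x₀ t x)).hasFDerivAt.comp x h1).fderiv
  refine ext_inner_right ℝ fun e => ?_
  rw [inner_gradient_eq_fderiv, inner_smul_left, inner_gradient_eq_fderiv]
  change fderiv ℝ (φ ∘ dilation x₀ t) x e = _
  rw [h2]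
  simp

theorem L2Tendsto.comp_dilation {f : ℕ → Plane → E} {g : Plane → E}
    (h : L2Tendsto volume f g) (x₀ : Plane) {t : ℝ} (ht : 1 / 2 ≤ t) :
    L2Tendsto volume (fun n x => f n (dilation x₀ t x)) (fun x => g (dilation x₀ t x)) := by
  have ht0 : t ≠ 0 := by linarith
  have := ENNReal.Tendsto.const_mul (a := 2) h.lim (Or.inr (by simp))
  rw [mul_zero] at this
  exact L2Tendsto.of_le (fun n => memLp_comp_dilation x₀ ht0 (h.mem_left n))
    (memLp_comp_dilation x₀ ht0 h.mem_right) this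
    fun n => eLpNorm_comp_dilation_le x₀ ht fun x => f n x - g x

/-- The chain rule is classical for test functions and passes to the limit, as composition with a
dilation is bounded on `L²`. The compact support serves to approximate `u` by test functions. -/
theorem IsH1Pair.comp_dilation {u : Plane → ℝ} {G : Plane → Plane} (h : IsH1Pair univ u G)
    {K : Set Plane} (hK : IsCompact K) (h0 : ∀ᵐ x, x ∉ K → u x = 0) (x₀ : Plane) {t : ℝ}
    (ht : 1 / 2 ≤ t) :
    IsH1Pair univ (fun x => u (dilation x₀ t x)) (fun x => t • G (dilation x₀ t x)) := by
  have ht0 : t ≠ 0 := by linarith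
  obtain ⟨φ, hφ, h1, h2⟩ := exists_testFun_l2Tendsto h hK isOpen_univ (subset_univ K) h0
  have hφt : ∀ n, IsTestFun univ (fun x => φ n (dilation x₀ t x)) := fun n =>
    ⟨(hφ n).smooth.comp (by unfold dilation; fun_prop),
      (hφ n).compact.comp_homeomorph (dilationHomeo x₀ ht0), subset_univ _⟩
  refine IsH1Pair.of_l2Tendsto (fun n => (hφt n).isH1Pair) ?_ ?_
  · rw [Measure.restrict_univ]
    exact h1.comp_dilation x₀ ht
  · rw [Measure.restrict_univ]
    refine ((h2.comp_dilation x₀ ht).const_smul t).congr (fun n => Eventually.of_forall fun x => ?_)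
      EventuallyEq.rfl
    exact (gradient_comp_dilation x₀ t (hφ n).smooth x).symm

/-- This is the convergence of the gradients of dilated functions. The extra chain-rule factor
contributes `(t - 1) f∘dilation`, of norm at most `2|t - 1|‖f‖`. -/
theorem l2Tendsto_smul_comp_dilation (x₀ : Plane) {t : ℕ → ℝ}
    (ht : Tendsto t atTop (𝓝 1)) (h2 : ∀ n, 1 / 2 ≤ t n) {f : Plane → Plane}
    (hf : MemLp f 2 volume) :
    L2Tendsto volume (fun n x => t n • f (dilation x₀ (t n) x)) f := by
  have h := l2Tendsto_comp_dilation x₀ ht h2 hf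
  have ht' : Tendsto (fun n => ENNReal.ofReal |t n - 1|) atTop (𝓝 0) := by
    rw [← ENNReal.ofReal_zero]
    refine ENNReal.tendsto_ofReal ?_
    have := (ht.sub_const 1).abs
    simpa using this
  have hz : L2Tendsto volume (fun n x => (t n - 1) • f (dilation x₀ (t n) x)) (fun _ => 0) := by
    refine L2Tendsto.of_le (fun n => (h.mem_left n).const_smul (t n - 1)) MemLp.zero
      (b := fun n => ENNReal.ofReal |t n - 1| * (2 * eLpNorm f 2 volume)) ?_ fun n => ?_
    · have := ENNReal.Tendsto.mul_const (b := 2 * eLpNorm f 2 volume) ht'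
        (Or.inr (ENNReal.mul_ne_top (by simp) hf.2.ne))
      rwa [zero_mul] at this
    · simp only [sub_zero]
      refine (eLpNorm_const_smul_le (c := t n - 1)
        (f := fun x => f (dilation x₀ (t n) x))).trans ?_
      rw [Real.enorm_eq_ofReal_abs]
      gcongr
      exact eLpNorm_comp_dilation_le x₀ (h2 n) f
  refine (h.add hz).congr (fun n => Eventually.of_forall fun x => ?_)
    (Eventually.of_forall fun x => by simp)
  simp [sub_smul]

end Dilation

/-! ### Polar coordinates and the radial divergence theorem on a disc. -/

section Polar

variable (x₀ : Plane) {r : ℝ}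

/-- The plane without its origin is measurably the product of the unit circle and `(0, ∞)` with
density `s^(dim - 1) = s`; the origin is a null set. -/
theorem integral_polar {f : Plane → ℝ} (hf : Integrable f volume) :
    ∫ x, f x = ∫ z : sphere (0 : Plane) 1, ∫ s in Ioi (0 : ℝ), s * f (x₀ + s • (z : Plane))
      ∂volume ∂(volume : Measure Plane).toSphere := by
  have hg : Integrable (fun y => f (x₀ + y)) volume := hf.comp_add_left x₀
  rw [← integral_add_left_eq_self f x₀]
  set g : Plane → ℝ := fun y => f (x₀ + y) with hgdef
  have hmp := (volume : Measure Plane).measurePreserving_homeomorphUnitSphereProd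
  have he : MeasurableEmbedding (homeomorphUnitSphereProd Plane) :=
    Homeomorph.measurableEmbedding _
  set F : sphere (0 : Plane) 1 × Ioi (0 : ℝ) → ℝ := fun p => g ((p.2 : ℝ) • (p.1 : Plane))
    with hF
  have hcomp : ∀ y : ({(0)}ᶜ : Set Plane), F (homeomorphUnitSphereProd Plane y) = g y := by
    intro y
    have hy : ‖(y : Plane)‖ ≠ 0 := norm_ne_zero_iff.2 y.2
    simp [hF, smul_smul, hy]
  have h1 : ∫ y, g y = ∫ y : ({(0)}ᶜ : Set Plane), g y ∂(volume.comap Subtype.val) := by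
    rw [integral_subtype_comap (measurableSet_singleton _).compl, restrict_compl_singleton]
  have h2 : Integrable (fun y : ({(0)}ᶜ : Set Plane) => g y) (volume.comap Subtype.val) := by
    have := (integrableOn_iff_comap_subtypeVal (μ := (volume : Measure Plane)) (f := g)
      (measurableSet_singleton (0 : Plane)).compl).1 hg.integrableOn
    exact this
  have hFi : Integrable F ((volume : Measure Plane).toSphere.prod
      (Measure.volumeIoiPow (Module.finrank ℝ Plane - 1))) := by
    rw [← hmp.integrable_comp_emb he]
    exact h2.congr (Eventually.of_forall fun y => (hcomp y).symm)
  have h3 : ∫ y : ({(0)}ᶜ : Set Plane), g y ∂(volume.comap Subtype.val)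
      = ∫ p, F p ∂((volume : Measure Plane).toSphere.prod
      (Measure.volumeIoiPow (Module.finrank ℝ Plane - 1))) := by
    rw [← hmp.integral_comp he]
    exact integral_congr_ae (Eventually.of_forall fun y => (hcomp y).symm)
  rw [h1, h3, integral_prod _ hFi]
  congr 1; ext z
  rw [Measure.volumeIoiPow, integral_withDensity_eq_integral_toReal_smul (by fun_prop)
    (Eventually.of_forall fun _ => ENNReal.ofReal_lt_top),
    integral_subtype_comap measurableSet_Ioi
      (fun s : ℝ => (ENNReal.ofReal (s ^ (Module.finrank ℝ Plane - 1))).toReal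
        • g (s • (z : Plane)))]
  refine setIntegral_congr_fun measurableSet_Ioi fun s hs => ?_
  simp only [finrank_euclideanSpace_fin, hgdef, smul_eq_mul]
  rw [ENNReal.toReal_ofReal (by have := mem_Ioi.1 hs; positivity)]
  simp

theorem measurable_add_smul_sphere : Measurable fun z : sphere (0 : Plane) 1 => x₀ + r • (z : Plane) := by
  fun_prop

theorem add_smul_mem_sphere (hr : 0 ≤ r) (z : sphere (0 : Plane) 1) :
    x₀ + r • (z : Plane) ∈ sphere x₀ r := by
  have : ‖(z : Plane)‖ = 1 := by simp
  simp [norm_smul, this, abs_of_nonneg hr]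

instance : IsFiniteMeasure (circleMeasure x₀ r) := by
  unfold circleMeasure
  have : IsFiniteMeasure (Measure.map (fun z : sphere (0 : Plane) 1 => x₀ + r • (z : Plane))
      (volume : Measure Plane).toSphere) := Measure.isFiniteMeasure_map _ _
  exact Measure.smul_finite _ ENNReal.ofReal_ne_top

theorem ae_circleMeasure (hr : 0 ≤ r) : ∀ᵐ x ∂(circleMeasure x₀ r), x ∈ sphere x₀ r := by
  unfold circleMeasure
  refine Measure.ae_smul_measure ?_ _
  refine (ae_map_iff (p := fun x => x ∈ sphere x₀ r)
    (measurable_add_smul_sphere x₀).aemeasurable isClosed_sphere.measurableSet).2 ?_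
  exact Eventually.of_forall fun z => add_smul_mem_sphere x₀ hr z

theorem integral_circleMeasure (hr : 0 ≤ r) {f : Plane → ℝ} (hf : Continuous f) :
    ∫ x, f x ∂(circleMeasure x₀ r)
      = r * ∫ z : sphere (0 : Plane) 1, f (x₀ + r • (z : Plane))
        ∂(volume : Measure Plane).toSphere := by
  rw [circleMeasure, integral_smul_measure, integral_map (measurable_add_smul_sphere x₀).aemeasurable
    hf.aestronglyMeasurable, ENNReal.toReal_ofReal hr, smul_eq_mul]

theorem memLp_circleMeasure (hr : 0 ≤ r) {f : Plane → ℝ} (hf : Continuous f) :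
    MemLp f 2 (circleMeasure x₀ r) := by
  obtain ⟨C, hC⟩ := (isCompact_sphere x₀ r).exists_bound_of_continuousOn hf.continuousOn
  refine MemLp.of_bound hf.aestronglyMeasurable C ?_
  filter_upwards [ae_circleMeasure x₀ hr] with x hx using hC x hx

/-- The divergence theorem on a disc for the radial field `F(x) (x - x₀)`. -/
theorem setIntegral_ball_radial_divergence (hr : 0 < r) {F : Plane → ℝ} (hF : ContDiff ℝ 1 F) :
    ∫ x in ball x₀ r, (2 * F x + fderiv ℝ F x (x - x₀)) = r * ∫ x, F x ∂(circleMeasure x₀ r) := by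
  have hcont : Continuous fun x => 2 * F x + fderiv ℝ F x (x - x₀) :=
    (continuous_const.mul hF.continuous).add
      ((hF.continuous_fderiv one_ne_zero).clm_apply (by fun_prop))
  have hint : Integrable ((ball x₀ r).indicator fun x => 2 * F x + fderiv ℝ F x (x - x₀))
      volume := by
    rw [integrable_indicator_iff measurableSet_ball]
    exact (hcont.continuousOn.integrableOn_compact (isCompact_closedBall x₀ r)).mono_set
      ball_subset_closedBall
  rw [← integral_indicator measurableSet_ball, integral_polar x₀ hint,
    integral_circleMeasure x₀ hr.le hF.continuous, ← mul_assoc, ← integral_const_mul]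
  congr 1; ext z
  have hz : ‖(z : Plane)‖ = 1 := by simp
  have hmem : ∀ s : ℝ, 0 < s → (x₀ + s • (z : Plane) ∈ ball x₀ r ↔ s < r) := fun s hs => by
    simp [norm_smul, hz, abs_of_pos hs]
  -- Along a ray, `s` times the divergence of `F(x)(x - x₀)` is exactly `γ'`, so the radial integral
  -- is `γ(r) - γ(0) = r² F`. One factor `r` belongs to `circleMeasure`, the other stands in the
  -- statement.
  set γ : ℝ → ℝ := fun s => s ^ 2 * F (x₀ + s • (z : Plane)) with hγ
  have hder : ∀ s : ℝ, HasDerivAt γ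
      (s * (2 * F (x₀ + s • (z : Plane)) + fderiv ℝ F (x₀ + s • (z : Plane)) (s • (z : Plane)))) s := by
    intro s
    have h1 : HasDerivAt (fun s : ℝ => x₀ + s • (z : Plane)) (z : Plane) s := by
      simpa using ((hasDerivAt_id s).smul_const (z : Plane)).const_add x₀
    have h2 := (hF.differentiable one_ne_zero (x₀ + s • (z : Plane))).hasFDerivAt.comp_hasDerivAt s h1
    refine ((hasDerivAt_pow 2 s).mul h2).congr_deriv ?_
    simp only [Function.comp, map_smul, smul_eq_mul]
    push_cast; ring
  have e1 : ∫ s in Ioi (0 : ℝ), s * (ball x₀ r).indicator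
      (fun x => 2 * F x + fderiv ℝ F x (x - x₀)) (x₀ + s • (z : Plane))
      = ∫ s in Ioo (0 : ℝ) r, s * (2 * F (x₀ + s • (z : Plane))
        + fderiv ℝ F (x₀ + s • (z : Plane)) (s • (z : Plane))) := by
    rw [← integral_indicator measurableSet_Ioi, ← integral_indicator measurableSet_Ioo]
    congr 1; ext s
    by_cases hs : 0 < s
    · by_cases hsr : s < r
      · rw [indicator_of_mem (mem_Ioi.2 hs), indicator_of_mem ((hmem s hs).2 hsr),
          indicator_of_mem (mem_Ioo.2 ⟨hs, hsr⟩), add_sub_cancel_left]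
      · rw [indicator_of_mem (mem_Ioi.2 hs), indicator_of_notMem fun h => hsr ((hmem s hs).1 h),
          indicator_of_notMem fun h => hsr h.2, mul_zero]
    · rw [indicator_of_notMem (s := Ioi (0 : ℝ)) hs, indicator_of_notMem fun h => hs h.1]
  rw [e1, ← integral_Ioc_eq_integral_Ioo, ← intervalIntegral.integral_of_le hr.le,
    intervalIntegral.integral_eq_sub_of_hasDerivAt (fun s _ => hder s)]
  · simp only [hγ]; ring
  · refine Continuous.intervalIntegrable ?_ _ _
    have hc : Continuous fun s : ℝ => x₀ + s • (z : Plane) := by fun_prop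
    exact continuous_id.mul ((continuous_const.mul (hF.continuous.comp hc)).add
      (((hF.continuous_fderiv one_ne_zero).comp hc).clm_apply (by fun_prop)))

end Polar

/-! ### From the radial divergence theorem to the Gauss formula on a disc. -/

section Gauss

variable (x₀ : Plane) {r : ℝ}

theorem integral_fderiv_eq_zero {F : Plane → ℝ} (hF : ContDiff ℝ 1 F) (hc : HasCompactSupport F)
    (e : Plane) : ∫ x, fderiv ℝ F x e = 0 := by
  have hc' : HasCompactSupport fun x => fderiv ℝ F x e := hc.fderiv_apply (𝕜 := ℝ) e
  have h := integral_mul_fderiv_eq_neg_fderiv_mul_of_integrable (μ := (volume : Measure Plane))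
    (f := fun _ => (1 : ℝ)) (g := F) (v := e) (by simp) ?_ ?_ (fun x _ => by fun_prop)
    (fun x _ => hF.differentiable one_ne_zero x)
  · simpa using h
  · simpa using (((hF.continuous_fderiv one_ne_zero).clm_apply
      continuous_const).integrable_of_hasCompactSupport hc')
  · simpa using hF.continuous.integrable_of_hasCompactSupport hc

theorem integrable_radial_divergence {F : Plane → ℝ} (hF : ContDiff ℝ 1 F)
    (hc : HasCompactSupport F) :
    Integrable (fun x => 2 * F x + fderiv ℝ F x (x - x₀)) volume := by
  refine Continuous.integrable_of_hasCompactSupport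
    ((continuous_const.mul hF.continuous).add
      ((hF.continuous_fderiv one_ne_zero).clm_apply (by fun_prop))) ?_
  refine HasCompactSupport.intro hc fun x hx => ?_
  rw [image_eq_zero_of_notMem_tsupport hx, (notMem_tsupport_iff_eventuallyEq.1 hx).fderiv_eq]
  simp

/-- The disc formula is applied on a disc so large that `F` vanishes on its boundary. -/
theorem integral_radial_divergence_eq_zero {F : Plane → ℝ} (hF : ContDiff ℝ 1 F)
    (hc : HasCompactSupport F) : ∫ x, (2 * F x + fderiv ℝ F x (x - x₀)) = 0 := by
  obtain ⟨ρ, hρ0, hρ⟩ : ∃ ρ > 0, tsupport F ⊆ ball x₀ ρ := by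
    obtain ⟨ρ, hρ⟩ := hc.isBounded.subset_ball x₀
    exact ⟨max ρ 1, by positivity, hρ.trans (ball_subset_ball (le_max_left _ _))⟩
  rw [← setIntegral_eq_integral_of_forall_compl_eq_zero (s := ball x₀ ρ) fun x hx => ?_,
    setIntegral_ball_radial_divergence x₀ hρ0 hF]
  · have : ∫ x, F x ∂(circleMeasure x₀ ρ) = 0 := by
      refine integral_eq_zero_of_ae ?_
      filter_upwards [ae_circleMeasure x₀ hρ0.le] with x hx
      refine image_eq_zero_of_notMem_tsupport fun h => ?_
      exact absurd (mem_ball.1 (hρ h)) (by rw [mem_sphere.1 hx]; exact lt_irrefl _)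
    rw [this, mul_zero]
  · have hx' : x ∉ tsupport F := fun h => hx (hρ h)
    rw [image_eq_zero_of_notMem_tsupport hx', (notMem_tsupport_iff_eventuallyEq.1 hx').fderiv_eq]
    simp

/-- A smooth radial cutoff, equal to `1` well inside the ball of radius `r` and to `0` outside. -/
noncomputable def radialCutoff (x₀ : Plane) (r : ℝ) (n : ℕ) (x : Plane) : ℝ :=
  Real.smoothTransition (n * (r ^ 2 - ‖x - x₀‖ ^ 2))

/-- Only the direction of the gradient matters: it is radial, so it annihilates tangential fields
however large the factor `c` is. -/
theorem hasFDerivAt_radialCutoff (n : ℕ) (x : Plane) : ∃ c : ℝ, ∀ e : Plane,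
    fderiv ℝ (radialCutoff x₀ r n) x e = c * inner ℝ (x - x₀) e := by
  have h1 : HasFDerivAt (fun x : Plane => ‖x - x₀‖ ^ 2)
      (2 • (innerSL ℝ (x - x₀)).comp (ContinuousLinearMap.id ℝ Plane)) x :=
    ((hasFDerivAt_id x).sub_const x₀).norm_sq
  have h2 := ((h1.const_sub (r ^ 2)).const_mul (n : ℝ))
  have h3 : HasDerivAt Real.smoothTransition
      (deriv Real.smoothTransition (n * (r ^ 2 - ‖x - x₀‖ ^ 2))) (n * (r ^ 2 - ‖x - x₀‖ ^ 2)) :=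
    ((Real.smoothTransition.contDiff (n := 1)).differentiable one_ne_zero _).hasDerivAt
  have h4 := (h3.comp_hasFDerivAt x h2).fderiv
  refine ⟨deriv Real.smoothTransition (n * (r ^ 2 - ‖x - x₀‖ ^ 2)) * (n * (-2)), fun e => ?_⟩
  change fderiv ℝ (Real.smoothTransition ∘ fun x => n * (r ^ 2 - ‖x - x₀‖ ^ 2)) x e = _
  rw [h4]
  simp [inner_sub_left]
  ring

theorem contDiff_radialCutoff (n : ℕ) : ContDiff ℝ ∞ (radialCutoff x₀ r n) := by
  unfold radialCutoff
  exact Real.smoothTransition.contDiff.comp (contDiff_const.mul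
    (contDiff_const.sub ((contDiff_id.sub contDiff_const).norm_sq ℝ)))

theorem tendsto_radialCutoff (hr : 0 < r) (x : Plane) :
    Tendsto (fun n => radialCutoff x₀ r n x) atTop (𝓝 ((ball x₀ r).indicator 1 x)) := by
  by_cases hx : x ∈ ball x₀ r
  · rw [indicator_of_mem hx]
    rw [mem_ball, dist_eq_norm] at hx
    have hp : 0 < r ^ 2 - ‖x - x₀‖ ^ 2 := by nlinarith [norm_nonneg (x - x₀)]
    have ht : Tendsto (fun n : ℕ => (n : ℝ) * (r ^ 2 - ‖x - x₀‖ ^ 2)) atTop atTop :=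
      tendsto_natCast_atTop_atTop.atTop_mul_const hp
    refine tendsto_const_nhds.congr' ?_
    filter_upwards [ht.eventually_ge_atTop 1] with n hn
    exact (Real.smoothTransition.one_of_one_le hn).symm
  · rw [indicator_of_notMem hx]
    rw [mem_ball, dist_eq_norm, not_lt] at hx
    refine tendsto_const_nhds.congr fun n => ?_
    refine (Real.smoothTransition.zero_of_nonpos ?_).symm
    have : r ^ 2 ≤ ‖x - x₀‖ ^ 2 := by nlinarith [norm_nonneg (x - x₀)]
    exact mul_nonpos_of_nonneg_of_nonpos (Nat.cast_nonneg _) (by linarith)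

/-- With `F = |x - x₀|²P` and `Q = ⟨x - x₀, e⟩P`, the field `F e - Q (x - x₀)` is orthogonal to `x -
x₀`. Multiplying it by a radial cutoff `χ` therefore adds no term with `∇χ` to its divergence `g`,
so `∫ χ g = 0`. As `χ` tends to the indicator of the disc, `∫ g = 0` there, and `F e` may be
replaced by the radial field `Q (x - x₀)`, whose integral is known. -/
theorem setIntegral_ball_fderiv_aux (hr : 0 < r) {P : Plane → ℝ} (hP : ContDiff ℝ ∞ P)
    (hc : HasCompactSupport P) (e : Plane) :
    ∫ x in ball x₀ r, fderiv ℝ (fun y => ‖y - x₀‖ ^ 2 * P y) x e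
      = r * ∫ x, inner ℝ (x - x₀) e * P x ∂(circleMeasure x₀ r) := by
  set F : Plane → ℝ := fun y => ‖y - x₀‖ ^ 2 * P y with hFdef
  set Q : Plane → ℝ := fun y => inner ℝ (y - x₀) e * P y with hQdef
  have hF : ContDiff ℝ ∞ F := ((contDiff_id.sub contDiff_const).norm_sq ℝ).mul hP
  have hQ : ContDiff ℝ ∞ Q := ((contDiff_id.sub contDiff_const).inner ℝ contDiff_const).mul hP
  have hFc : HasCompactSupport F := hc.mul_left
  have hQc : HasCompactSupport Q := hc.mul_left
  have hF1 : ContDiff ℝ 1 F := hF.of_le (by simp)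
  have hQ1 : ContDiff ℝ 1 Q := hQ.of_le (by simp)
  set g : Plane → ℝ := fun x => fderiv ℝ F x e - (2 * Q x + fderiv ℝ Q x (x - x₀)) with hg
  have i1 : Integrable (fun x => fderiv ℝ F x e) volume :=
    ((hF1.continuous_fderiv one_ne_zero).clm_apply
      continuous_const).integrable_of_hasCompactSupport (hFc.fderiv_apply (𝕜 := ℝ) e)
  have i2 := integrable_radial_divergence x₀ hQ1 hQc
  have hgi : Integrable g volume := i1.sub i2
  have key : ∀ n, ∫ x, radialCutoff x₀ r n x * g x = 0 := by
    intro n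
    set χ := radialCutoff x₀ r n with hχ
    have hχs : ContDiff ℝ 1 χ := (contDiff_radialCutoff x₀ n).of_le (by simp)
    have z1 := integral_fderiv_eq_zero (hχs.mul hF1) hFc.mul_left e
    have z2 := integral_radial_divergence_eq_zero x₀ (hχs.mul hQ1) hQc.mul_left
    have j1 : Integrable (fun x => fderiv ℝ (χ * F) x e) volume :=
      (((hχs.mul hF1).continuous_fderiv one_ne_zero).clm_apply
        continuous_const).integrable_of_hasCompactSupport
        (HasCompactSupport.fderiv_apply (𝕜 := ℝ) hFc.mul_left e)
    have j2 : Integrable (fun x => 2 * (χ * Q) x + fderiv ℝ (χ * Q) x (x - x₀)) volume :=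
      integrable_radial_divergence x₀ (hχs.mul hQ1) hQc.mul_left
    have z3 : ∫ x, (fderiv ℝ (χ * F) x e - (2 * (χ * Q) x + fderiv ℝ (χ * Q) x (x - x₀))) = 0 := by
      rw [integral_sub j1 j2]
      exact (congrArg₂ (· - ·) z1 z2).trans (sub_zero _)
    refine Eq.trans (integral_congr_ae (Eventually.of_forall fun x => ?_)) z3
    obtain ⟨c, hcx⟩ := hasFDerivAt_radialCutoff x₀ (r := r) n x
    have d1 := hχs.differentiable one_ne_zero x
    simp only [fderiv_mul d1 (hF1.differentiable one_ne_zero x),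
      fderiv_mul d1 (hQ1.differentiable one_ne_zero x), hg, add_apply,
      smul_apply, smul_eq_mul, Pi.mul_apply]
    rw [hcx, hcx, real_inner_self_eq_norm_sq]
    simp only [hFdef, hQdef]
    ring
  have lim : Tendsto (fun n => ∫ x, radialCutoff x₀ r n x * g x) atTop
      (𝓝 (∫ x, (ball x₀ r).indicator 1 x * g x)) := by
    refine tendsto_integral_of_dominated_convergence (fun x => ‖g x‖)
      (fun n => (contDiff_radialCutoff x₀ n).continuous.aestronglyMeasurable.mul hgi.1) hgi.norm
      (fun n => Eventually.of_forall fun x => ?_)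
      (Eventually.of_forall fun x => (tendsto_radialCutoff x₀ hr x).mul_const _)
    rw [norm_mul]
    refine mul_le_of_le_one_left (norm_nonneg _) ?_
    rw [radialCutoff, Real.norm_of_nonneg (Real.smoothTransition.nonneg _)]
    exact Real.smoothTransition.le_one _
  have h0 : ∫ x, (ball x₀ r).indicator 1 x * g x = 0 := by
    refine tendsto_nhds_unique lim ?_
    simp_rw [key]
    exact tendsto_const_nhds
  have h1 : ∫ x in ball x₀ r, g x = 0 := by
    rw [← h0, ← integral_indicator measurableSet_ball]
    congr 1; ext x
    by_cases hx : x ∈ ball x₀ r <;> simp [hx]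
  rw [hg, integral_sub i1.integrableOn i2.integrableOn,
    setIntegral_ball_radial_divergence x₀ hr hQ1] at h1
  linarith

/-- The divergence theorem on a disc, for constant directions. -/
theorem setIntegral_ball_fderiv (hr : 0 < r) {F : Plane → ℝ} (hF : ContDiff ℝ ∞ F)
    (hc : HasCompactSupport F) (e : Plane) :
    ∫ x in ball x₀ r, fderiv ℝ F x e
      = r⁻¹ * ∫ x, F x * inner ℝ (x - x₀) e ∂(circleMeasure x₀ r) := by
  obtain ⟨θ, hθ, hθ1⟩ := exists_cutoff (isCompact_singleton (x := x₀)) isOpen_ball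
    (singleton_subset_iff.2 (mem_ball_self hr))
  rw [nhdsSet_singleton] at hθ1
  -- The division is harmless since `1 - θ` vanishes near the centre. The remaining part `θF` has
  -- compact support in the disc and contributes to neither side. On the circle `P = F / r²`, which
  -- turns the factor `r` of the auxiliary formula into `r⁻¹`.
  set P : Plane → ℝ := fun x => (1 - θ x) * F x / ‖x - x₀‖ ^ 2 with hPdef
  have hx₀ : ∀ᶠ x in 𝓝 x₀, P x = 0 := by
    filter_upwards [hθ1] with x hx
    simp [hPdef, hx]
  have hP : ContDiff ℝ ∞ P := by
    rw [contDiff_iff_contDiffAt]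
    intro x
    rcases eq_or_ne x x₀ with rfl | hx
    · exact (contDiffAt_const (c := (0 : ℝ))).congr_of_eventuallyEq hx₀
    · refine ContDiffAt.div ((contDiffAt_const.sub hθ.smooth.contDiffAt).mul hF.contDiffAt)
        ((contDiffAt_id.sub contDiffAt_const).norm_sq ℝ) ?_
      simpa [sub_eq_zero] using hx
  have hPc : HasCompactSupport P := by
    refine HasCompactSupport.intro hc fun x hx => ?_
    simp [hPdef, image_eq_zero_of_notMem_tsupport hx]
  have hmul : (fun y => ‖y - x₀‖ ^ 2 * P y) = fun y => (1 - θ y) * F y := by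
    ext y
    rcases eq_or_ne y x₀ with rfl | hy
    · simp [hθ1.self_of_nhds]
    · have : ‖y - x₀‖ ≠ 0 := by simpa [sub_eq_zero] using hy
      simp only [hPdef]; field_simp
  have h1 := setIntegral_ball_fderiv_aux x₀ hr hP hPc e
  rw [hmul] at h1
  have hθF : IsTestFun (ball x₀ r) (fun y => F y * θ y) := hθ.mul_left hF
  have h2 : ∫ x in ball x₀ r, fderiv ℝ (fun y => F y * θ y) x e = 0 := by
    rw [setIntegral_eq_integral_of_forall_compl_eq_zero fun x hx => ?_]
    · exact integral_fderiv_eq_zero (hθF.smooth.of_le (by simp)) hθF.compact e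
    · rw [← inner_gradient_eq_fderiv, hθF.gradient_eq_zero hx, inner_zero_left]
  have hθ' : ContDiff ℝ ∞ fun y => (1 - θ y) * F y := (contDiff_const.sub hθ.smooth).mul hF
  have h3 : ∀ x, fderiv ℝ F x e = fderiv ℝ (fun y => (1 - θ y) * F y) x e
      + fderiv ℝ (fun y => F y * θ y) x e := fun x => by
    rw [← add_apply, ← fderiv_fun_add (hθ'.differentiable (by simp) x)
      (hθF.smooth.differentiable (by simp) x)]
    congr 2; ext y; ring
  have i1 : Integrable (fun x => fderiv ℝ (fun y => (1 - θ y) * F y) x e) volume :=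
    ((hθ'.continuous_fderiv (by simp)).clm_apply
      continuous_const).integrable_of_hasCompactSupport
      (HasCompactSupport.fderiv_apply (𝕜 := ℝ) hc.mul_left e)
  have i2 : Integrable (fun x => fderiv ℝ (fun y => F y * θ y) x e) volume :=
    (hθF.continuous_fderiv_apply e).integrable_of_hasCompactSupport
      (hθF.compact.fderiv_apply (𝕜 := ℝ) e)
  simp_rw [h3]
  rw [integral_add i1.integrableOn i2.integrableOn, h1, h2, add_zero, ← integral_const_mul,
    ← integral_const_mul]
  refine integral_congr_ae ?_
  filter_upwards [ae_circleMeasure x₀ hr.le] with x hx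
  have hθx : θ x = 0 := hθ.eq_zero fun h => by
    rw [mem_ball, mem_sphere.1 hx] at h; exact lt_irrefl _ h
  have hn : ‖x - x₀‖ = r := by rw [← dist_eq_norm]; exact hx
  simp only [hPdef, hθx, hn]
  field_simp
  ring

end Gauss

/-! ### The trace inequality for smooth functions. -/

section TraceInequality

variable (x₀ : Plane) {r : ℝ}

theorem eLpNorm_two_eq_ofReal_sqrt {X E : Type*} [MeasurableSpace X] [NormedAddCommGroup E]
    {μ : Measure X} {f : X → E} (hf : MemLp f 2 μ) :
    eLpNorm f 2 μ = ENNReal.ofReal (Real.sqrt (∫ x, ‖f x‖ ^ 2 ∂μ)) := by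
  rw [hf.eLpNorm_eq_integral_rpow_norm (by norm_num) (by norm_num), Real.sqrt_eq_rpow]
  norm_num

theorem Continuous.memLp_restrict_of_subset {E : Type*} [NormedAddCommGroup E] {f : Plane → E}
    (hf : Continuous f) {S K : Set Plane} (hK : IsCompact K) (hSK : S ⊆ K) :
    MemLp f 2 (volume.restrict S) := by
  obtain ⟨B, hB⟩ := hK.exists_bound_of_continuousOn hf.continuousOn
  have : IsFiniteMeasure ((volume : Measure Plane).restrict K) :=
    ⟨by rw [Measure.restrict_apply_univ]; exact hK.measure_lt_top⟩
  have h : MemLp f 2 (volume.restrict K) := by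
    refine MemLp.of_bound hf.aestronglyMeasurable B ?_
    filter_upwards [ae_restrict_mem hK.measurableSet] with x hx using hB x hx
  exact h.mono_measure (Measure.restrict_mono hSK le_rfl)

/-- The trace inequality for smooth functions, on the inner side of the circle. -/
theorem exists_trace_bound (hr : 0 < r) {U : Set Plane} (hU : IsOpen U) (hrU : sphere x₀ r ⊆ U) :
    ∃ C : ENNReal, C ≠ ⊤ ∧ ∀ φ : Plane → ℝ, ContDiff ℝ ∞ φ →
      eLpNorm φ 2 (circleMeasure x₀ r) ≤ C * (eLpNorm φ 2 (volume.restrict (ball x₀ r ∩ U))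
        + eLpNorm (gradient φ) 2 (volume.restrict (ball x₀ r ∩ U))) := by
  obtain ⟨θ, hθ, hθ1⟩ := exists_cutoff (isCompact_sphere x₀ r) hU hrU
  obtain ⟨M', hM'⟩ := hθ.isMultiplier.bounded
  obtain ⟨M, hM0, hM⟩ : ∃ M ≥ 0, ∀ x, ‖θ x‖ ≤ M ∧ ‖gradient θ x‖ ≤ M :=
    ⟨max M' 0, le_max_right _ _, fun x => ⟨(hM' x).1.trans (le_max_left _ _),
      (hM' x).2.trans (le_max_left _ _)⟩⟩
  -- In the divergence of `θφ²(x - x₀)`, the term `2θφ²` accounts for `2M`. The terms with `∇θ` and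
  -- with `2φ∇φ` account for `Mr` each, the latter through `2ab ≤ a² + b²`.
  set C₀ : ℝ := r⁻¹ * (2 * M + 2 * M * r) with hC₀
  have hC₀0 : 0 ≤ C₀ := by positivity
  refine ⟨ENNReal.ofReal (Real.sqrt C₀), ENNReal.ofReal_ne_top, fun φ hφ => ?_⟩
  set S := ball x₀ r ∩ U with hS
  have hSm : MeasurableSet S := measurableSet_ball.inter hU.measurableSet
  have hSc : S ⊆ closedBall x₀ r := inter_subset_left.trans ball_subset_closedBall
  have m1 : MemLp φ 2 (volume.restrict S) :=
    hφ.continuous.memLp_restrict_of_subset (isCompact_closedBall _ _) hSc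
  have m2 : MemLp (gradient φ) 2 (volume.restrict S) :=
    hφ.continuous_gradient.memLp_restrict_of_subset (isCompact_closedBall _ _) hSc
  have n1 : Integrable (fun x => ‖φ x‖ ^ 2) (volume.restrict S) := m1.integrable_norm_pow (by simp)
  have n2 : Integrable (fun x => ‖gradient φ x‖ ^ 2) (volume.restrict S) :=
    m2.integrable_norm_pow (by simp)
  have hF : ContDiff ℝ ∞ fun x => θ x * φ x ^ 2 := hθ.smooth.mul (hφ.pow 2)
  have hd : ∀ x e, fderiv ℝ (fun x => θ x * φ x ^ 2) x e
      = θ x * (2 * φ x * inner ℝ (gradient φ x) e) + φ x ^ 2 * inner ℝ (gradient θ x) e := by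
    intro x e
    have d1 := hφ.differentiable (by simp) x
    rw [fderiv_fun_mul (hθ.smooth.differentiable (by simp) x) (d1.fun_pow 2), fderiv_fun_pow _ d1]
    simp
  -- Since `θ = 1` on the circle, the boundary term is the squared norm of `φ` there; since `θ` is
  -- supported in `U`, the disc integral only sees `ball x₀ r ∩ U`.
  have key := setIntegral_ball_radial_divergence x₀ hr (hF.of_le (m := 1) (by simp))
  have e1 : ∫ x, θ x * φ x ^ 2 ∂(circleMeasure x₀ r) = ∫ x, ‖φ x‖ ^ 2 ∂(circleMeasure x₀ r) := by
    refine integral_congr_ae ?_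
    filter_upwards [ae_circleMeasure x₀ hr.le] with x hx
    rw [(eventually_nhdsSet_iff_forall.1 hθ1 x hx).self_of_nhds, one_mul, Real.norm_eq_abs, sq_abs]
  have e2 : ∫ x in ball x₀ r, (2 * (θ x * φ x ^ 2)
        + fderiv ℝ (fun x => θ x * φ x ^ 2) x (x - x₀))
      = ∫ x in S, (2 * (θ x * φ x ^ 2) + fderiv ℝ (fun x => θ x * φ x ^ 2) x (x - x₀)) := by
    refine setIntegral_eq_of_subset_of_forall_sdiff_eq_zero measurableSet_ball
      inter_subset_left fun x hx => ?_
    have hxU : x ∉ U := fun h => hx.2 ⟨hx.1, h⟩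
    rw [hd, hθ.eq_zero hxU, hθ.gradient_eq_zero hxU]
    simp
  have e3 : ∫ x in S, (2 * (θ x * φ x ^ 2) + fderiv ℝ (fun x => θ x * φ x ^ 2) x (x - x₀))
      ≤ ∫ x in S, (2 * M + 2 * M * r) * (‖φ x‖ ^ 2 + ‖gradient φ x‖ ^ 2) := by
    have hint : IntegrableOn (fun x => 2 * (θ x * φ x ^ 2)
        + fderiv ℝ (fun x => θ x * φ x ^ 2) x (x - x₀)) S :=
      (integrable_radial_divergence x₀ (hF.of_le (m := 1) (by simp))
        hθ.compact.mul_right).integrableOn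
    refine setIntegral_mono_on hint ((n1.add n2).const_mul _) hSm fun x hx => ?_
    have hxr : ‖x - x₀‖ ≤ r := by rw [← dist_eq_norm]; exact hSc hx
    obtain ⟨hM1, hM2⟩ := hM x
    have a1 : |inner ℝ (gradient φ x) (x - x₀)| ≤ ‖gradient φ x‖ * r :=
      (abs_real_inner_le_norm _ _).trans (by gcongr)
    have a2 : |inner ℝ (gradient θ x) (x - x₀)| ≤ M * r :=
      (abs_real_inner_le_norm _ _).trans (by gcongr)
    have b1 : θ x * φ x ^ 2 ≤ M * ‖φ x‖ ^ 2 := by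
      rw [Real.norm_eq_abs, sq_abs]
      gcongr
      exact (le_abs_self _).trans hM1
    have b2 : φ x ^ 2 * inner ℝ (gradient θ x) (x - x₀) ≤ ‖φ x‖ ^ 2 * (M * r) := by
      rw [Real.norm_eq_abs, sq_abs]
      gcongr
      exact (le_abs_self _).trans a2
    have b3 : θ x * (2 * φ x * inner ℝ (gradient φ x) (x - x₀))
        ≤ M * r * (‖φ x‖ ^ 2 + ‖gradient φ x‖ ^ 2) := by
      refine (le_abs_self _).trans ?_
      rw [abs_mul, abs_mul, abs_mul, abs_two]
      calc |θ x| * (2 * |φ x| * |inner ℝ (gradient φ x) (x - x₀)|)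
          ≤ M * (2 * |φ x| * (‖gradient φ x‖ * r)) := by gcongr; exact hM1
        _ = M * r * (2 * ‖φ x‖ * ‖gradient φ x‖) := by rw [Real.norm_eq_abs]; ring
        _ ≤ M * r * (‖φ x‖ ^ 2 + ‖gradient φ x‖ ^ 2) := by
          gcongr; exact two_mul_le_add_sq _ _
    rw [hd]
    have : 0 ≤ M * ‖gradient φ x‖ ^ 2 := by positivity
    have : 0 ≤ M * r * ‖gradient φ x‖ ^ 2 := by positivity
    nlinarith
  rw [e1, e2] at key
  have e4 : ∫ x, ‖φ x‖ ^ 2 ∂(circleMeasure x₀ r)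
      ≤ C₀ * ((∫ x in S, ‖φ x‖ ^ 2) + ∫ x in S, ‖gradient φ x‖ ^ 2) := by
    rw [integral_const_mul, integral_add n1 n2] at e3
    rw [hC₀, mul_assoc, le_inv_mul_iff₀ hr]
    linarith
  rw [eLpNorm_two_eq_ofReal_sqrt (memLp_circleMeasure x₀ hr.le hφ.continuous),
    eLpNorm_two_eq_ofReal_sqrt m1, eLpNorm_two_eq_ofReal_sqrt m2,
    ← ENNReal.ofReal_add (Real.sqrt_nonneg _) (Real.sqrt_nonneg _),
    ← ENNReal.ofReal_mul (Real.sqrt_nonneg _)]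
  refine ENNReal.ofReal_le_ofReal ((Real.sqrt_le_sqrt e4).trans ?_)
  rw [Real.sqrt_mul hC₀0]
  gcongr
  have p1 : 0 ≤ ∫ x in S, ‖φ x‖ ^ 2 := integral_nonneg fun _ => by positivity
  have p2 : 0 ≤ ∫ x in S, ‖gradient φ x‖ ^ 2 := integral_nonneg fun _ => by positivity
  rw [Real.sqrt_le_left (by positivity)]
  nlinarith [Real.sq_sqrt p1, Real.sq_sqrt p2, Real.sqrt_nonneg (∫ x in S, ‖φ x‖ ^ 2),
    Real.sqrt_nonneg (∫ x in S, ‖gradient φ x‖ ^ 2)]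

end TraceInequality

/-! ### Calculus and locality of traces. -/

section Traces

variable {Ω Ω' O : Set Plane} {x₀ : Plane} {r : ℝ} {u u' g g' : Plane → ℝ} {G G' : Plane → Plane}

/-- Smooth functions which approximate `u` in `H¹(Ω ∩ K)` and `g` in `L²` of the circle. -/
structure IsTraceApprox (Ω K : Set Plane) (x₀ : Plane) (r : ℝ) (u g : Plane → ℝ)
    (G : Plane → Plane) (φ : ℕ → Plane → ℝ) : Prop where
  smooth : ∀ n, ContDiff ℝ ∞ (φ n)
  fn : L2Tendsto (volume.restrict (Ω ∩ K)) φ u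
  grad : L2Tendsto (volume.restrict (Ω ∩ K)) (fun n => gradient (φ n)) G
  bd : L2Tendsto (circleMeasure x₀ r) φ g

/-- The tolerances `1/(n + 1)` turn the definition of the trace into a sequential one, in which any
weak gradient `G` may replace the chosen `weakGrad`. -/
theorem HasTrace.exists_approx (hΩ : IsOpen Ω) (hr : 0 ≤ r) (h : IsH1Pair Ω u G)
    (ht : HasTrace Ω x₀ r u g) {K : Set Plane} (hK : IsCompact K) (hKΩ : K ⊆ Ω ∪ sphere x₀ r) :
    ∃ φ, IsTraceApprox Ω K x₀ r u g G φ := by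
  have hlim : Tendsto (fun n : ℕ => (((n + 1 : ℕ) : ENNReal))⁻¹) atTop (𝓝 0) :=
    (ENNReal.tendsto_inv_nat_nhds_zero).comp (tendsto_add_atTop_nat 1)
  have hpos : ∀ n : ℕ, 0 < (((n + 1 : ℕ) : ENNReal))⁻¹ := fun n =>
    ENNReal.inv_pos.2 (ENNReal.natCast_ne_top _)
  choose φ h1 h2 h3 h4 using fun n : ℕ => ht.2 K hK hKΩ _ (hpos n)
  have hw := h.weakGrad_ae hΩ
  refine ⟨φ, h1, ?_, ?_, ?_⟩
  · exact L2Tendsto.of_le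
      (fun n => (h1 n).continuous.memLp_restrict_of_subset hK inter_subset_right)
      (h.memLp.mono_measure (Measure.restrict_mono inter_subset_left le_rfl)) hlim
      fun n => (h2 n).le
  · refine (L2Tendsto.of_le
      (fun n => (h1 n).continuous_gradient.memLp_restrict_of_subset hK inter_subset_right)
      (h.memH1.isH1Pair.memLp_grad.mono_measure (Measure.restrict_mono inter_subset_left le_rfl))
      hlim fun n => (h3 n).le).congr_right ?_
    exact ae_mono (Measure.restrict_mono inter_subset_left le_rfl) hw
  · exact L2Tendsto.of_le (fun n => memLp_circleMeasure x₀ hr (h1 n).continuous) ht.1 hlim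
      fun n => (h4 n).le

/-- The converse of `HasTrace.exists_approx`. With both, the rules for traces reduce to operations
on approximating sequences. -/
theorem IsH1Pair.hasTrace (h : IsH1Pair Ω u G) (hΩ : IsOpen Ω)
    (hg : MemLp g 2 (circleMeasure x₀ r))
    (ha : ∀ K, IsCompact K → K ⊆ Ω ∪ sphere x₀ r → ∃ φ, IsTraceApprox Ω K x₀ r u g G φ) :
    HasTrace Ω x₀ r u g := by
  refine ⟨hg, fun K hK hKΩ η hη => ?_⟩
  obtain ⟨φ, hφ⟩ := ha K hK hKΩ
  have hG := hφ.grad.congr_right (g' := weakGrad Ω u)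
    (ae_mono (Measure.restrict_mono inter_subset_left le_rfl) (h.weakGrad_ae hΩ).symm)
  obtain ⟨n, h1, h2, h3⟩ := ((hφ.fn.lim.eventually (gt_mem_nhds hη)).and
    ((hG.lim.eventually (gt_mem_nhds hη)).and (hφ.bd.lim.eventually (gt_mem_nhds hη)))).exists
  exact ⟨φ n, hφ.smooth n, h1, h2, h3⟩

theorem HasTrace.congr (hΩ : IsOpen Ω) (hr : 0 ≤ r) (h : IsH1Pair Ω u G)
    (ht : HasTrace Ω x₀ r u g) (hu : u =ᵐ[volume.restrict Ω] u')
    (hg : g =ᵐ[circleMeasure x₀ r] g') : HasTrace Ω x₀ r u' g' := by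
  refine (h.congr hu EventuallyEq.rfl).hasTrace hΩ ((memLp_congr_ae hg).1 ht.1) fun K hK hKΩ => ?_
  obtain ⟨φ, hφ⟩ := ht.exists_approx hΩ hr h hK hKΩ
  exact ⟨φ, hφ.smooth, hφ.fn.congr_right
    (ae_mono (Measure.restrict_mono inter_subset_left le_rfl) hu), hφ.grad, hφ.bd.congr_right hg⟩

theorem HasTrace.mono (hΩ : IsOpen Ω) (hr : 0 ≤ r) (h : IsH1Pair Ω u G)
    (ht : HasTrace Ω x₀ r u g) (hΩ' : IsOpen Ω') (hsub : Ω' ⊆ Ω) : HasTrace Ω' x₀ r u g := by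
  refine (h.mono hsub).hasTrace hΩ' ht.1 fun K hK hKΩ => ?_
  obtain ⟨φ, hφ⟩ := ht.exists_approx hΩ hr h hK (hKΩ.trans (union_subset_union_left _ hsub))
  have hs : Ω' ∩ K ⊆ Ω ∩ K := inter_subset_inter_left _ hsub
  exact ⟨φ, hφ.smooth, hφ.fn.mono_set hs, hφ.grad.mono_set hs, hφ.bd⟩

theorem HasTrace.add (hΩ : IsOpen Ω) (hr : 0 ≤ r) (h : IsH1Pair Ω u G) (h' : IsH1Pair Ω u' G')
    (ht : HasTrace Ω x₀ r u g) (ht' : HasTrace Ω x₀ r u' g') :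
    HasTrace Ω x₀ r (fun x => u x + u' x) (fun x => g x + g' x) := by
  refine (h.add h').hasTrace hΩ (ht.1.add ht'.1) fun K hK hKΩ => ?_
  obtain ⟨φ, hφ⟩ := ht.exists_approx hΩ hr h hK hKΩ
  obtain ⟨φ', hφ'⟩ := ht'.exists_approx hΩ hr h' hK hKΩ
  refine ⟨fun n x => φ n x + φ' n x, fun n => (hφ.smooth n).add (hφ'.smooth n),
    hφ.fn.add hφ'.fn, ?_, hφ.bd.add hφ'.bd⟩
  refine (hφ.grad.add hφ'.grad).congr (fun n => Eventually.of_forall fun x => ?_) EventuallyEq.rfl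
  exact (gradient_add_smooth (hφ.smooth n) (hφ'.smooth n) x).symm

theorem HasTrace.mul_smooth (hΩ : IsOpen Ω) (hr : 0 ≤ r) (h : IsH1Pair Ω u G)
    (ht : HasTrace Ω x₀ r u g) {χ : Plane → ℝ} (hχ : IsMultiplier χ) :
    HasTrace Ω x₀ r (fun x => χ x * u x) (fun x => χ x * g x) := by
  obtain ⟨C, hC⟩ := hχ.bounded
  have c1 : ∀ {μ : Measure Plane}, AEStronglyMeasurable χ μ :=
    hχ.smooth.continuous.aestronglyMeasurable
  have c2 : ∀ {μ : Measure Plane}, AEStronglyMeasurable (gradient χ) μ :=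
    hχ.smooth.continuous_gradient.aestronglyMeasurable
  have b1 : ∀ {μ : Measure Plane}, ∀ᵐ x ∂μ, ‖χ x‖ ≤ C := Eventually.of_forall fun x => (hC x).1
  have b2 : ∀ {μ : Measure Plane}, ∀ᵐ x ∂μ, ‖gradient χ x‖ ≤ C :=
    Eventually.of_forall fun x => (hC x).2
  refine (h.mul_smooth hχ).hasTrace hΩ ((L2Tendsto.const ht.1).bdd_smul c1 b1).mem_right
    fun K hK hKΩ => ?_
  obtain ⟨φ, hφ⟩ := ht.exists_approx hΩ hr h hK hKΩ
  refine ⟨fun n x => χ x * φ n x, fun n => hχ.smooth.mul (hφ.smooth n), hφ.fn.bdd_smul c1 b1, ?_,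
    hφ.bd.bdd_smul c1 b1⟩
  refine ((hφ.grad.bdd_smul c1 b1).add (hφ.fn.smul_field c2 b2)).congr
    (fun n => Eventually.of_forall fun x => ?_) EventuallyEq.rfl
  exact (gradient_mul_smooth hχ.smooth (hφ.smooth n) x).symm

theorem HasTrace.const_mul (hΩ : IsOpen Ω) (hr : 0 ≤ r) (h : IsH1Pair Ω u G)
    (ht : HasTrace Ω x₀ r u g) (c : ℝ) :
    HasTrace Ω x₀ r (fun x => c * u x) (fun x => c * g x) :=
  ht.mul_smooth hΩ hr h (χ := fun _ => c)
    ⟨contDiff_const, max ‖c‖ 0, fun x => ⟨le_max_left _ _, by simp [gradient]⟩⟩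

theorem HasTrace.sub (hΩ : IsOpen Ω) (hr : 0 ≤ r) (h : IsH1Pair Ω u G) (h' : IsH1Pair Ω u' G')
    (ht : HasTrace Ω x₀ r u g) (ht' : HasTrace Ω x₀ r u' g') :
    HasTrace Ω x₀ r (fun x => u x - u' x) (fun x => g x - g' x) := by
  simpa [sub_eq_add_neg] using ht.add hΩ hr h (h'.const_smul (-1)) (ht'.const_mul hΩ hr h' (-1))

theorem hasTrace_of_smooth (hΩ : IsOpen Ω) (hr : 0 ≤ r) {φ : Plane → ℝ} (hφ : ContDiff ℝ ∞ φ)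
    (h : IsH1Pair Ω φ (gradient φ)) : HasTrace Ω x₀ r φ φ := by
  refine h.hasTrace hΩ (memLp_circleMeasure x₀ hr hφ.continuous) fun K _ _ =>
    ⟨fun _ => φ, fun _ => hφ, ?_, ?_, L2Tendsto.const (memLp_circleMeasure x₀ hr hφ.continuous)⟩
  · exact (L2Tendsto.const h.memLp).mono_set inter_subset_left
  · exact (L2Tendsto.const h.memLp_grad).mono_set inter_subset_left

theorem hasTrace_zero (hΩ : IsOpen Ω) (hr : 0 ≤ r) :
    HasTrace Ω x₀ r (fun _ => 0) (fun _ => 0) := by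
  refine hasTrace_of_smooth hΩ hr contDiff_const (IsH1Pair.zero.congr EventuallyEq.rfl ?_)
  exact Eventually.of_forall fun x => by simp [gradient]

/-- Interior approximation by smooth functions. -/
theorem IsH1Pair.exists_interior_approx (hΩ : IsOpen Ω) (h : IsH1Pair Ω u G) {K : Set Plane}
    (hK : IsCompact K) (hKΩ : K ⊆ Ω) :
    ∃ φ : ℕ → Plane → ℝ, (∀ n, IsTestFun Ω (φ n)) ∧ L2Tendsto (volume.restrict K) φ u ∧
      L2Tendsto (volume.restrict K) (fun n => gradient (φ n)) G := by
  -- The function `χu` extends by zero to the plane and can be mollified there; on `K`, `χ = 1` and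
  -- `∇χ = 0`, so nothing is changed.
  obtain ⟨χ, hχ, hχ1⟩ := exists_cutoff hK hΩ hKΩ
  have h1 := h.mul_smooth hχ.isMultiplier
  have hz : ∀ x, x ∉ tsupport χ → χ x * u x = 0 := fun x hx => by
    rw [image_eq_zero_of_notMem_tsupport hx, zero_mul]
  have h2 := h1.extend_zero (Ω := univ) hΩ (subset_univ _) (isClosed_tsupport χ)
    (inter_subset_left.trans hχ.supp) (Eventually.of_forall hz)
  obtain ⟨φ, hφ, l1, l2⟩ := exists_testFun_l2Tendsto h2 hχ.compact hΩ hχ.supp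
    (Eventually.of_forall fun x hx => by
      by_cases hxΩ : x ∈ Ω
      · rw [indicator_of_mem hxΩ, hz x hx]
      · rw [indicator_of_notMem hxΩ])
  refine ⟨φ, hφ, ?_, ?_⟩
  · refine (l1.mono_measure Measure.restrict_le_self).congr_right ?_
    filter_upwards [ae_restrict_mem hK.measurableSet] with x hx
    rw [indicator_of_mem (hKΩ hx), (eventually_nhdsSet_iff_forall.1 hχ1 x hx).self_of_nhds, one_mul]
  · refine (l2.mono_measure Measure.restrict_le_self).congr_right ?_
    filter_upwards [ae_restrict_mem hK.measurableSet] with x hx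
    have hn := eventually_nhdsSet_iff_forall.1 hχ1 x hx
    rw [indicator_of_mem (hKΩ hx), hn.self_of_nhds, one_smul,
      gradient_congr_nhds (φ := χ) (ψ := fun _ => 1) hn]
    simp [gradient]

/-- Traces are local near the circle. -/
theorem HasTrace.of_local (hΩ : IsOpen Ω) (hr : 0 ≤ r) (h : IsH1Pair Ω u G) (hΩ' : IsOpen Ω')
    (hsub : Ω' ⊆ Ω) (ht : HasTrace Ω' x₀ r u g) {V : Set Plane} (hV : IsOpen V)
    (hVs : sphere x₀ r ⊆ V) (hVΩ : Ω ∩ V ⊆ Ω') : HasTrace Ω x₀ r u g := by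
  obtain ⟨χ, hχ, hχ1⟩ := exists_cutoff (isCompact_sphere x₀ r) hV hVs
  obtain ⟨W, hW, hsW, hW1⟩ := eventually_nhdsSet_iff_exists.1 hχ1
  refine h.hasTrace hΩ ht.1 fun K hK hKΩ => ?_
  obtain ⟨a, ha⟩ := ht.exists_approx hΩ' hr (h.mono hsub) (hK.inter_right (isClosed_tsupport χ))
    (fun x hx => (hKΩ hx.1).imp (fun h => hVΩ ⟨h, hχ.supp hx.2⟩) id)
  -- The approximation is `χ a_n + (1 - χ) b_n`, with `a_n` coming from the trace on `Ω'` and `b_n`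
  -- from the interior. As `1 - χ` vanishes on the neighbourhood `W` of the circle, `b_n` is needed
  -- only on `K ∖ W`, a compact subset of `Ω`, and the boundary values are those of `a_n`.
  obtain ⟨b, hb, hb1, hb2⟩ := h.exists_interior_approx hΩ (hK.diff hW) fun x hx =>
    (hKΩ hx.1).resolve_right fun h => hx.2 (hsW h)
  set χ' : Plane → ℝ := fun x => 1 - χ x with hχ'
  have mχ := hχ.isMultiplier
  have mχ' : IsMultiplier χ' := isMultiplier_one.sub mχ
  have z1 : ∀ x, x ∉ tsupport χ → χ x = 0 ∧ gradient χ x = 0 := fun x hx =>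
    ⟨image_eq_zero_of_notMem_tsupport hx, gradient_eq_zero_of_notMem_tsupport hx⟩
  have z2 : ∀ x, x ∈ W → χ' x = 0 ∧ gradient χ' x = 0 := fun x hx => by
    refine ⟨by simp [hχ', hW1 x hx], ?_⟩
    have : χ' =ᶠ[𝓝 x] fun _ => 0 := by
      filter_upwards [hW.mem_nhds hx] with y hy
      simp [hχ', hW1 y hy]
    rw [gradient_congr_nhds this]
    simp [gradient]
  have prod : ∀ {θ : Plane → ℝ} {S : Set Plane} {a : ℕ → Plane → ℝ}, IsMultiplier θ →
      MeasurableSet S → (∀ n, ContDiff ℝ ∞ (a n)) →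
      L2Tendsto (volume.restrict S) a u →
      L2Tendsto (volume.restrict S) (fun n => gradient (a n)) G →
      (∀ x ∈ Ω ∩ K, x ∉ S → θ x = 0 ∧ gradient θ x = 0) →
      L2Tendsto (volume.restrict (Ω ∩ K)) (fun n x => θ x * a n x) (fun x => θ x * u x) ∧
      L2Tendsto (volume.restrict (Ω ∩ K)) (fun n x => gradient (fun y => θ y * a n y) x)
        (fun x => θ x • G x + u x • gradient θ x) := by
    intro θ S a hθ hS ha l1 l2 hz
    obtain ⟨C, hC⟩ := hθ.bounded
    have hz' : ∀ᵐ x ∂(volume.restrict (Ω ∩ K)), x ∉ S → θ x = 0 ∧ gradient θ x = 0 := by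
      filter_upwards [ae_restrict_mem (hΩ.measurableSet.inter hK.measurableSet)] with x hx h
        using hz x hx h
    have m1 := l1.bdd_smul hθ.smooth.continuous.aestronglyMeasurable
      (Eventually.of_forall fun x => (hC x).1)
    have m2 := (l2.bdd_smul hθ.smooth.continuous.aestronglyMeasurable
      (Eventually.of_forall fun x => (hC x).1)).add
      (l1.smul_field hθ.smooth.continuous_gradient.aestronglyMeasurable
      (Eventually.of_forall fun x => (hC x).2))
    refine ⟨m1.of_vanish hS (fun n => ?_) ?_, (m2.of_vanish hS (fun n => ?_) ?_).congr
      (fun n => Eventually.of_forall fun x => (gradient_mul_smooth hθ.smooth (ha n) x).symm)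
      EventuallyEq.rfl⟩ <;>
    · filter_upwards [hz'] with x hx h
      simp [(hx h).1, (hx h).2]
  obtain ⟨p1, p2⟩ := prod mχ (hΩ'.measurableSet.inter (hK.measurableSet.inter
    (isClosed_tsupport χ).measurableSet)) ha.smooth ha.fn ha.grad fun x hx hxS => z1 x fun hxt =>
      hxS ⟨hVΩ ⟨hx.1, hχ.supp hxt⟩, hx.2, hxt⟩
  obtain ⟨q1, q2⟩ := prod mχ' (hK.measurableSet.diff hW.measurableSet) (fun n => (hb n).smooth)
    hb1 hb2 fun x hx hxS => z2 x (by_contra fun hxW => hxS ⟨hx.2, hxW⟩)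
  have s1 : ∀ n, ContDiff ℝ ∞ fun y => χ y * a n y := fun n => hχ.smooth.mul (ha.smooth n)
  have s2 : ∀ n, ContDiff ℝ ∞ fun y => χ' y * b n y := fun n => mχ'.smooth.mul (hb n).smooth
  refine ⟨fun n x => χ x * a n x + χ' x * b n x, fun n => (s1 n).add (s2 n), ?_, ?_, ?_⟩
  · refine (p1.add q1).congr_right (Eventually.of_forall fun x => ?_)
    simp only [hχ']; ring
  · refine (p2.add q2).congr (fun n => Eventually.of_forall fun x =>
      (gradient_add_smooth (s1 n) (s2 n) x).symm) (Eventually.of_forall fun x => ?_)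
    have : gradient χ' x = -gradient χ x := by
      rw [hχ', gradient_sub_smooth contDiff_const hχ.smooth]
      simp [gradient]
    beta_reduce
    rw [this, show χ' x = 1 - χ x from rfl, sub_smul, one_smul, smul_neg]
    abel
  · refine ha.bd.congr (fun n => ?_) EventuallyEq.rfl
    filter_upwards [ae_circleMeasure x₀ hr] with x hx
    rw [(z2 x (hsW hx)).1, hW1 x (hsW hx)]
    ring

/-- By locality the trace may be computed on `Ω ∩ V`, where `u` is the zero function. -/
theorem hasTrace_zero_of_vanish (hΩ : IsOpen Ω) (hr : 0 ≤ r) (h : IsH1Pair Ω u G) {V : Set Plane}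
    (hV : IsOpen V) (hVs : sphere x₀ r ⊆ V) (h0 : ∀ᵐ x ∂(volume.restrict Ω), x ∈ V → u x = 0) :
    HasTrace Ω x₀ r u (fun _ => 0) := by
  refine HasTrace.of_local hΩ hr h (hΩ.inter hV) inter_subset_left ?_ hV hVs subset_rfl
  refine (hasTrace_zero (hΩ.inter hV) hr).congr (hΩ.inter hV) hr IsH1Pair.zero ?_ EventuallyEq.rfl
  have h0' := ae_mono (Measure.restrict_mono (inter_subset_left (s := Ω) (t := V)) le_rfl) h0
  filter_upwards [h0', ae_restrict_mem (hΩ.inter hV).measurableSet] with x hx hm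
  exact (hx hm.2).symm

end Traces

/-! ### Existence of traces on circles inside the domain. -/

section TraceExistence

variable {Ω Ω' O : Set Plane} {x₀ : Plane} {r : ℝ} {u u' g g' : Plane → ℝ} {G G' : Plane → Plane}

/-- An `H¹` function on a neighbourhood of a circle has a trace on the circle, which is the trace
from both sides. -/
theorem IsH1Pair.exists_trace (hO : IsOpen O) (hr : 0 < r) (hrO : sphere x₀ r ⊆ O)
    (h : IsH1Pair O u G) :
    ∃ g, ∀ Ω : Set Plane, IsOpen Ω → Ω ⊆ O → HasTrace Ω x₀ r u g := by
  obtain ⟨K₀, hK₀, hsK₀, hK₀O⟩ := exists_compact_between (isCompact_sphere x₀ r) hO hrO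
  obtain ⟨φ, hφ, l1, l2⟩ := h.exists_interior_approx hO hK₀ hK₀O
  obtain ⟨C, hC, hCb⟩ := exists_trace_bound x₀ hr isOpen_interior hsK₀
  have hbound : ∀ w : Plane → ℝ, ContDiff ℝ ∞ w → eLpNorm w 2 (circleMeasure x₀ r)
      ≤ C * (eLpNorm w 2 (volume.restrict K₀) + eLpNorm (gradient w) 2 (volume.restrict K₀)) := by
    intro w hw
    have hs : ball x₀ r ∩ interior K₀ ⊆ K₀ := inter_subset_right.trans interior_subset
    refine (hCb w hw).trans ?_
    gcongr
  have hdiff : ∀ (w w' : Plane → ℝ), ContDiff ℝ ∞ w → ContDiff ℝ ∞ w' →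
      eLpNorm (fun x => w x - w' x) 2 (circleMeasure x₀ r)
      ≤ C * ((eLpNorm (fun x => w x - u x) 2 (volume.restrict K₀)
          + eLpNorm (fun x => gradient w x - G x) 2 (volume.restrict K₀))
        + (eLpNorm (fun x => w' x - u x) 2 (volume.restrict K₀)
          + eLpNorm (fun x => gradient w' x - G x) 2 (volume.restrict K₀))) := by
    intro w w' hw hw'
    refine (hbound _ (hw.sub hw')).trans ?_
    have mf : ∀ {w : Plane → ℝ}, ContDiff ℝ ∞ w →
        AEStronglyMeasurable (fun x => w x - u x) (volume.restrict K₀) := fun hw =>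
      hw.continuous.aestronglyMeasurable.sub l1.mem_right.1
    have mg : ∀ {w : Plane → ℝ}, ContDiff ℝ ∞ w →
        AEStronglyMeasurable (fun x => gradient w x - G x) (volume.restrict K₀) := fun hw =>
      hw.continuous_gradient.aestronglyMeasurable.sub l2.mem_right.1
    have e1 : eLpNorm (fun x => w x - w' x) 2 (volume.restrict K₀)
        ≤ eLpNorm (fun x => w x - u x) 2 (volume.restrict K₀)
          + eLpNorm (fun x => w' x - u x) 2 (volume.restrict K₀) := by
      refine le_trans (le_of_eq ?_) (eLpNorm_sub_le (mf hw) (mf hw') (by norm_num))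
      congr 1; ext x; simp
    have e2 : eLpNorm (gradient fun x => w x - w' x) 2 (volume.restrict K₀)
        ≤ eLpNorm (fun x => gradient w x - G x) 2 (volume.restrict K₀)
          + eLpNorm (fun x => gradient w' x - G x) 2 (volume.restrict K₀) := by
      refine le_trans (le_of_eq ?_) (eLpNorm_sub_le (mg hw) (mg hw') (by norm_num))
      congr 1; ext1 x; rw [gradient_sub_smooth hw hw']; simp
    refine mul_le_mul' le_rfl ?_
    exact (add_le_add e1 e2).trans_eq (add_add_add_comm _ _ _ _)
  set A : ℕ → ENNReal := fun n => eLpNorm (fun x => φ n x - u x) 2 (volume.restrict K₀)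
    + eLpNorm (fun x => gradient (φ n) x - G x) 2 (volume.restrict K₀) with hA
  have hA0 : Tendsto A atTop (𝓝 0) := by simpa using l1.lim.add l2.lim
  have hcauchy : ∀ η > 0, ∃ N, ∀ n ≥ N, ∀ m ≥ N, C * (A n + A m) < η := by
    intro η hη
    have ht : Tendsto (fun p : ℕ × ℕ => C * (A p.1 + A p.2)) (atTop ×ˢ atTop) (𝓝 0) := by
      have := ENNReal.Tendsto.const_mul (a := C)
        ((hA0.comp tendsto_fst).add (hA0.comp (tendsto_snd (f := (atTop : Filter ℕ)))))
        (Or.inr hC)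
      simpa using this
    rw [prod_atTop_atTop_eq] at ht
    obtain ⟨⟨N, M⟩, hN⟩ := eventually_atTop.1 (ht.eventually (gt_mem_nhds hη))
    exact ⟨max N M, fun n hn m hm => hN (n, m)
      ⟨(le_max_left _ _).trans hn, (le_max_right _ _).trans hm⟩⟩
  -- The trace inequality applied to differences `φ_n - φ_m` makes the boundary values a Cauchy
  -- sequence; its limit is the trace.
  obtain ⟨g, hg⟩ := exists_l2Tendsto_of_cauchy
    (fun n => memLp_circleMeasure x₀ hr.le (hφ n).smooth.continuous) hcauchy
    fun n m => hdiff _ _ (hφ n).smooth (hφ m).smooth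
  refine ⟨g, fun Ω hΩ hΩO => (h.mono hΩO).hasTrace hΩ hg.mem_right fun K hK hKΩ => ?_⟩
  -- Other compact sets need other approximations. Letting `ψ` converge on `K₀` as well forces `ψ_n
  -- - φ_n → 0` on the circle, so `g` serves every `K`, and every `Ω` on either side.
  obtain ⟨ψ, hψ, k1, k2⟩ := h.exists_interior_approx hO (hK.union hK₀) (union_subset
    (hKΩ.trans (union_subset hΩO hrO)) hK₀O)
  have hs : Ω ∩ K ⊆ K ∪ K₀ := inter_subset_right.trans subset_union_left
  refine ⟨ψ, fun n => (hψ n).smooth, k1.mono_set hs, k2.mono_set hs, ?_⟩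
  have k1' := k1.mono_set (S := K₀) subset_union_right
  have k2' := k2.mono_set (S := K₀) subset_union_right
  have mψ := fun n => memLp_circleMeasure x₀ hr.le (hψ n).smooth.continuous
  have hlim : Tendsto (fun n => C * ((eLpNorm (fun x => ψ n x - u x) 2 (volume.restrict K₀)
          + eLpNorm (fun x => gradient (ψ n) x - G x) 2 (volume.restrict K₀)) + A n)) atTop
        (𝓝 0) := by
    have := ENNReal.Tendsto.const_mul (a := C) ((k1'.lim.add k2'.lim).add hA0) (Or.inr hC)
    simpa using this
  have hd : L2Tendsto (circleMeasure x₀ r) (fun n x => ψ n x - φ n x) (fun _ => 0) :=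
    L2Tendsto.of_le (fun n => (mψ n).sub (hg.mem_left n)) MemLp.zero hlim fun n => by
      simpa using hdiff _ _ (hψ n).smooth (hφ n).smooth
  exact (hd.add hg).congr (fun n => Eventually.of_forall fun x => by simp)
    (Eventually.of_forall fun x => by simp)

end TraceExistence

/-! ### Green's formula with traces, and gluing across a circle. -/

section Gluing

variable {Ω Ω' O B : Set Plane} {x₀ : Plane} {r σ : ℝ} {u u' g g' : Plane → ℝ} {G G' : Plane → Plane}

/-- Green's formula for `H¹` functions with a trace, on one side of the circle. -/
theorem HasTrace.green (hO : IsOpen O) (hr : 0 < r) (hB : IsOpen B)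
    (hBc : IsClosed (B ∪ sphere x₀ r))
    (hgauss : ∀ F : Plane → ℝ, ContDiff ℝ ∞ F → HasCompactSupport F → ∀ e,
      ∫ x in B, fderiv ℝ F x e = σ * ∫ x, F x * inner ℝ (x - x₀) e ∂(circleMeasure x₀ r))
    (h : IsH1Pair (O ∩ B) u G) (ht : HasTrace (O ∩ B) x₀ r u g) {φ : Plane → ℝ}
    (hφ : IsTestFun O φ) (e : Plane) :
    (∫ x in O ∩ B, u x * fderiv ℝ φ x e) + ∫ x in O ∩ B, inner ℝ (G x) e * φ x
      = σ * ∫ x, g x * (φ x * inner ℝ (x - x₀) e) ∂(circleMeasure x₀ r) := by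
  have hOB := hO.inter hB
  -- All integrands vanish off `tsupport φ`, and this `K` is a compact set on which the trace
  -- provides approximations `a_n`. The products `a_n φ` are test functions on `O`, so the formula
  -- `hgauss` applies to them before passing to the limit.
  set K := tsupport φ ∩ (B ∪ sphere x₀ r) with hKdef
  have hK : IsCompact K := hφ.compact.inter_right hBc
  have hKO : K ⊆ (O ∩ B) ∪ sphere x₀ r := fun x hx => hx.2.imp (fun h => ⟨hφ.supp hx.1, h⟩) id
  obtain ⟨a, ha⟩ := ht.exists_approx hOB hr.le h hK hKO
  have hset : ∀ f : Plane → ℝ, (∀ x, x ∉ tsupport φ → f x = 0) →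
      ∫ x in O ∩ B, f x = ∫ x in (O ∩ B) ∩ K, f x := fun f hf =>
    setIntegral_eq_of_subset_of_forall_sdiff_eq_zero hOB.measurableSet inter_subset_left
      fun x hx => hf x fun hxs => hx.2 ⟨hx.1, hxs, Or.inl hx.1.2⟩
  have hset' : ∀ f : Plane → ℝ, (∀ x, x ∉ tsupport φ → f x = 0) →
      ∫ x in B, f x = ∫ x in (O ∩ B) ∩ K, f x := fun f hf =>
    setIntegral_eq_of_subset_of_forall_sdiff_eq_zero hB.measurableSet
      (inter_subset_left.trans inter_subset_right)
      fun x hx => hf x fun hxs => hx.2 ⟨⟨hφ.supp hxs, hx.1⟩, hxs, Or.inl hx.1⟩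
  have z1 : ∀ v : Plane → ℝ, ∀ x, x ∉ tsupport φ → v x * fderiv ℝ φ x e = 0 := fun v x hx => by
    rw [← inner_gradient_eq_fderiv, gradient_eq_zero_of_notMem_tsupport hx, inner_zero_left,
      mul_zero]
  have z2 : ∀ v : Plane → ℝ, ∀ x, x ∉ tsupport φ → v x * φ x = 0 := fun v x hx => by
    rw [image_eq_zero_of_notMem_tsupport hx, mul_zero]
  have t1 := ha.fn.tendsto_integral_mul
    (L2Tendsto.const (hφ.memLp_fderiv e ((O ∩ B) ∩ K)))
  have t2 := ha.grad.tendsto_integral_inner (L2Tendsto.const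
    (((L2Tendsto.const (hφ.memLp ((O ∩ B) ∩ K))).smul_field (a := fun _ => e) (C := ‖e‖)
      aestronglyMeasurable_const (by simp)).mem_right))
  simp only [inner_smul_right, mul_comm (φ _)] at t2
  have hcb : Continuous fun x => φ x * inner ℝ (x - x₀) e :=
    hφ.smooth.continuous.mul (by fun_prop)
  have t3 := (ha.bd.tendsto_integral_mul (L2Tendsto.const
    (memLp_circleMeasure x₀ hr.le hcb))).const_mul σ
  rw [hset _ (z1 u), hset _ (z2 _)]
  refine tendsto_nhds_unique (t1.add t2) (t3.congr fun n => ?_)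
  have haφ : IsTestFun O (fun x => a n x * φ x) := hφ.mul_left (ha.smooth n)
  have h1 := hgauss _ haφ.smooth haφ.compact e
  simp_rw [mul_assoc] at h1
  rw [← h1, ← hset' _ (z1 (a n)), ← hset' _ (z2 _)]
  rw [← integral_add]
  · congr 1; ext x
    rw [← inner_gradient_eq_fderiv, gradient_mul_smooth (ha.smooth n) hφ.smooth, inner_add_left,
      inner_smul_left, inner_smul_left, inner_gradient_eq_fderiv, RCLike.conj_to_real,
      RCLike.conj_to_real]
    ring
  · exact (((ha.smooth n).continuous.mul
      (hφ.continuous_fderiv_apply e)).integrable_of_hasCompactSupport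
        (hφ.compact.fderiv_apply (𝕜 := ℝ) e).mul_left).integrableOn
  · exact ((((ha.smooth n).continuous_gradient.inner continuous_const).mul
      hφ.smooth.continuous).integrable_of_hasCompactSupport hφ.compact.mul_left).integrableOn

theorem ae_restrict_diff_closedBall :
    (O \ ball x₀ r : Set Plane) =ᵐ[volume] (O \ closedBall x₀ r : Set Plane) := by
  have h0 : (volume : Measure Plane) (sphere x₀ r) = 0 := Measure.addHaar_sphere _ _ _
  have h1 : ∀ᵐ x : Plane, x ∉ sphere x₀ r := measure_eq_zero_iff_ae_notMem.1 h0
  filter_upwards [h1] with x hx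
  have : (x ∈ O \ ball x₀ r) = (x ∈ O \ closedBall x₀ r) := by
    simp only [mem_sphere, Set.mem_sdiff, mem_ball, mem_closedBall, not_lt, not_le] at hx ⊢
    rw [(Ne.symm hx).le_iff_lt]
  exact this

theorem setIntegral_split_ball {f : Plane → ℝ}
    (hf : IntegrableOn f O) :
    ∫ x in O, f x = (∫ x in O ∩ ball x₀ r, f x) + ∫ x in O \ closedBall x₀ r, f x := by
  rw [← integral_inter_add_sdiff (measurableSet_ball (x := x₀) (ε := r)) hf,
    setIntegral_congr_set ae_restrict_diff_closedBall]

/-- The function equal to `f` inside and to `f'` outside the circle. -/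
noncomputable def glue {E : Type*} [AddZeroClass E] (x₀ : Plane) (r : ℝ) (f f' : Plane → E)
    (x : Plane) : E :=
  (ball x₀ r).indicator f x + (closedBall x₀ r)ᶜ.indicator f' x

theorem glue_of_mem_ball {E : Type*} [AddZeroClass E] {f f' : Plane → E} {x : Plane}
    (hx : x ∈ ball x₀ r) : glue x₀ r f f' x = f x := by
  have : x ∉ (closedBall x₀ r)ᶜ := fun h => h (ball_subset_closedBall hx)
  rw [glue, indicator_of_mem hx, indicator_of_notMem this, add_zero]

theorem glue_of_notMem_closedBall {E : Type*} [AddZeroClass E] {f f' : Plane → E} {x : Plane}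
    (hx : x ∉ closedBall x₀ r) : glue x₀ r f f' x = f' x := by
  have h1 : x ∉ ball x₀ r := fun h => hx (ball_subset_closedBall h)
  have h2 : x ∈ (closedBall x₀ r)ᶜ := hx
  rw [glue, indicator_of_notMem h1, indicator_of_mem h2, zero_add]

theorem glue_ae_inner {E : Type*} [AddZeroClass E] {f f' : Plane → E} (hO : MeasurableSet O) :
    glue x₀ r f f' =ᵐ[volume.restrict (O ∩ ball x₀ r)] f := by
  filter_upwards [ae_restrict_mem (hO.inter measurableSet_ball)] with x hx
    using glue_of_mem_ball hx.2

theorem glue_ae_outer {E : Type*} [AddZeroClass E] {f f' : Plane → E} (hO : MeasurableSet O) :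
    glue x₀ r f f' =ᵐ[volume.restrict (O \ closedBall x₀ r)] f' := by
  filter_upwards [ae_restrict_mem (hO.diff measurableSet_closedBall)] with x hx
    using glue_of_notMem_closedBall hx.2

/-- Gluing of `H¹` functions with the same trace on a circle. -/
theorem IsH1Pair.glue (hO : IsOpen O) (hr : 0 < r)
    (h : IsH1Pair (O ∩ ball x₀ r) u G) (h' : IsH1Pair (O \ closedBall x₀ r) u' G')
    (ht : HasTrace (O ∩ ball x₀ r) x₀ r u g) (ht' : HasTrace (O \ closedBall x₀ r) x₀ r u' g) :
    IsH1Pair O (glue x₀ r u u') (glue x₀ r G G') := by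
  have hm : ∀ {E : Type} [NormedAddCommGroup E] {f f' : Plane → E},
      MemLp f 2 (volume.restrict (O ∩ ball x₀ r)) →
      MemLp f' 2 (volume.restrict (O \ closedBall x₀ r)) →
      MemLp (_root_.glue x₀ r f f') 2 (volume.restrict O) := by
    intro E _ f f' hf hf'
    refine MemLp.add ?_ ?_
    · rw [memLp_indicator_iff_restrict measurableSet_ball, Measure.restrict_restrict
        measurableSet_ball, inter_comm]
      exact hf
    · rw [memLp_indicator_iff_restrict measurableSet_closedBall.compl, Measure.restrict_restrict
        measurableSet_closedBall.compl, inter_comm]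
      exact hf'
  have m1 := hm h.memLp h'.memLp
  have m2 := hm h.memLp_grad h'.memLp_grad
  refine ⟨m1, m2, fun φ hφ e => ?_⟩
  have i1 : ∫ x in O, _root_.glue x₀ r u u' x * fderiv ℝ φ x e
      = (∫ x in O ∩ ball x₀ r, u x * fderiv ℝ φ x e)
        + ∫ x in O \ closedBall x₀ r, u' x * fderiv ℝ φ x e := by
    rw [setIntegral_split_ball (x₀ := x₀) (r := r) (integrable_left m1 hφ e)]
    congr 1
    · refine integral_congr_ae ?_
      filter_upwards [glue_ae_inner (f := u) (f' := u') hO.measurableSet] with x hx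
      rw [hx]
    · refine integral_congr_ae ?_
      filter_upwards [glue_ae_outer (f := u) (f' := u') hO.measurableSet] with x hx
      rw [hx]
  have i2 : ∫ x in O, inner ℝ (_root_.glue x₀ r G G' x) e * φ x
      = (∫ x in O ∩ ball x₀ r, inner ℝ (G x) e * φ x)
        + ∫ x in O \ closedBall x₀ r, inner ℝ (G' x) e * φ x := by
    rw [setIntegral_split_ball (x₀ := x₀) (r := r) (integrable_right m2 hφ e)]
    congr 1
    · refine integral_congr_ae ?_
      filter_upwards [glue_ae_inner (f := G) (f' := G') hO.measurableSet] with x hx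
      rw [hx]
    · refine integral_congr_ae ?_
      filter_upwards [glue_ae_outer (f := G) (f' := G') hO.measurableSet] with x hx
      rw [hx]
  -- Green's formulas on the two sides have the same circle integral, because the traces agree, with
  -- factors `r⁻¹` and `-r⁻¹`. Their sum is the weak-gradient identity on `O`.
  have g1 := ht.green (σ := r⁻¹) hO hr isOpen_ball
    (by rw [ball_union_sphere]; exact isClosed_closedBall)
    (fun F hF hc e => setIntegral_ball_fderiv x₀ hr hF hc e) h hφ e
  -- The Gauss formula outside the disc is the whole-plane integral, which is zero, minus the one on
  -- the disc.
  have g2 := HasTrace.green (B := (closedBall x₀ r)ᶜ) (σ := -r⁻¹) hO hr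
    isClosed_closedBall.isOpen_compl (by
      have : (closedBall x₀ r)ᶜ ∪ sphere x₀ r = (ball x₀ r)ᶜ := by
        ext x
        simp only [mem_union, mem_compl_iff, mem_closedBall, mem_sphere, mem_ball, not_le, not_lt]
        rw [le_iff_lt_or_eq, eq_comm]
      rw [this]; exact isOpen_ball.isClosed_compl)
    (fun F hF hc e => by
      have i1 : Integrable (fun x => fderiv ℝ F x e) volume :=
        ((hF.continuous_fderiv (by simp)).clm_apply
          continuous_const).integrable_of_hasCompactSupport (hc.fderiv_apply (𝕜 := ℝ) e)
      have i2 := setIntegral_split_ball (x₀ := x₀) (r := r) (O := univ) i1.integrableOn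
      rw [setIntegral_univ, univ_inter, ← compl_eq_univ_sdiff, setIntegral_ball_fderiv x₀ hr hF hc,
        integral_fderiv_eq_zero (hF.of_le (by simp)) hc] at i2
      linarith) h' ht' hφ e
  rw [← Set.sdiff_eq] at g2
  rw [i1, i2]
  linarith

end Gluing

/-! ### Density of test functions among functions with zero trace. -/

section ZeroTrace

variable {x₀ : Plane} {ε R : ℝ} {u : Plane → ℝ} {G : Plane → Plane}

theorem isOpen_annulus : IsOpen (annulus x₀ ε R) := isOpen_ball.sdiff isClosed_closedBall

/-- `H¹` functions with zero trace on the inner circle, which vanish near the outer circle, are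
limits of test functions. -/
theorem HasTrace.exists_testFun_approx (hε : 0 < ε) (hεR : ε < R)
    (h : IsH1Pair (annulus x₀ ε R) u G) (ht : HasTrace (annulus x₀ ε R) x₀ ε u fun _ => 0)
    {ρ : ℝ} (hρR : ρ < R)
    (h0 : ∀ᵐ x ∂(volume.restrict (annulus x₀ ε R)), x ∉ closedBall x₀ ρ → u x = 0) :
    ∃ φ : ℕ → Plane → ℝ, (∀ n, IsTestFun (annulus x₀ ε R) (φ n)) ∧
      L2Tendsto (volume.restrict (annulus x₀ ε R)) φ u ∧
      L2Tendsto (volume.restrict (annulus x₀ ε R)) (fun n => gradient (φ n)) G := by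
  have hsub : ball x₀ ε ⊆ ball x₀ R := ball_subset_ball hεR.le
  have hi : ball x₀ R ∩ ball x₀ ε = ball x₀ ε := inter_eq_right.2 hsub
  -- Zero trace on `∂B_ε` allows gluing with `0` in the hole; vanishing near `∂B_R` then allows
  -- extension by `0` to the plane.
  have hg : IsH1Pair (ball x₀ R) (glue x₀ ε (fun _ => 0) u) (glue x₀ ε (fun _ => 0) G) := by
    refine IsH1Pair.glue (g := fun _ => 0) isOpen_ball hε ?_ h ?_ ht
    · rw [hi]; exact IsH1Pair.zero
    · rw [hi]; exact hasTrace_zero isOpen_ball hε.le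
  have hg0 : ∀ᵐ x, x ∉ sphere x₀ ε → x ∈ ball x₀ R → x ∉ closedBall x₀ ρ →
      glue x₀ ε (fun _ => 0) u x = 0 := by
    rw [ae_restrict_iff' isOpen_annulus.measurableSet] at h0
    filter_upwards [h0] with x hx hs hxR hxρ
    by_cases hxb : x ∈ ball x₀ ε
    · exact glue_of_mem_ball hxb
    · have hxc : x ∉ closedBall x₀ ε := fun h => by
        rw [← ball_union_sphere] at h
        exact h.elim hxb hs
      rw [glue_of_notMem_closedBall hxc, hx ⟨hxR, hxc⟩ hxρ]
  have hsphere : ∀ᵐ x : Plane, x ∉ sphere x₀ ε :=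
    measure_eq_zero_iff_ae_notMem.1 (Measure.addHaar_sphere _ _ _)
  have hext := hg.extend_zero (Ω := univ) isOpen_ball (subset_univ _)
    (isClosed_closedBall (x := x₀) (ε := ρ))
    (inter_subset_left.trans (closedBall_subset_ball hρR)) (by
      rw [ae_restrict_iff' measurableSet_ball]
      filter_upwards [hg0, hsphere] with x h1 h2 h3 h4 using h1 h2 h3 h4)
  set w := (ball x₀ R).indicator (glue x₀ ε (fun _ => 0) u) with hw
  set H := (ball x₀ R).indicator (glue x₀ ε (fun _ => (0 : Plane)) G) with hH
  have hw0 : ∀ᵐ x, (x ∈ ball x₀ ε ∨ x ∉ closedBall x₀ ρ) → w x = 0 := by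
    filter_upwards [hg0, hsphere] with x h1 h2 h3
    by_cases hxR : x ∈ ball x₀ R
    · rw [hw, indicator_of_mem hxR]
      rcases h3 with h3 | h3
      · exact glue_of_mem_ball h3
      · exact h1 h2 hxR h3
    · rw [hw, indicator_of_notMem hxR]
  have hwu : w =ᵐ[volume.restrict (annulus x₀ ε R)] u := by
    filter_upwards [ae_restrict_mem isOpen_annulus.measurableSet] with x hx
    rw [hw, indicator_of_mem hx.1, glue_of_notMem_closedBall hx.2]
  have hHG : H =ᵐ[volume.restrict (annulus x₀ ε R)] G := by
    filter_upwards [ae_restrict_mem isOpen_annulus.measurableSet] with x hx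
    rw [hH, indicator_of_mem hx.1, glue_of_notMem_closedBall hx.2]
  have hR : 0 < R := hε.trans hεR
  -- Composing with a dilation of factor `t < 1` moves the support outwards, off the inner circle.
  -- The condition `t > max ρ ε / R` keeps it inside `B_R`, and `t ≥ 1/2` is needed for the uniform
  -- `L²` bounds.
  set t₀ : ℝ := max (1 / 2) ((max ρ ε / R + 1) / 2) with ht₀
  have hq : max ρ ε / R < 1 := by rw [div_lt_one hR]; exact max_lt hρR hεR
  have ht₀1 : t₀ < 1 := max_lt (by norm_num) (by linarith)
  have ht₀q : max ρ ε / R < t₀ := lt_max_of_lt_right (by linarith)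
  set t : ℕ → ℝ := fun n => 1 - (1 - t₀) * (1 / ((n : ℝ) + 1)) with htdef
  have hn1 : ∀ n : ℕ, 0 < 1 / ((n : ℝ) + 1) ∧ 1 / ((n : ℝ) + 1) ≤ 1 := fun n =>
    ⟨by positivity, by rw [div_le_one (by positivity)]; linarith [n.cast_nonneg (α := ℝ)]⟩
  have htt₀ : ∀ n, t₀ ≤ t n := fun n => by simp only [htdef]; nlinarith [hn1 n]
  have ht1 : ∀ n, t n < 1 := fun n => by
    have := mul_pos (sub_pos.2 ht₀1) (hn1 n).1
    simp only [htdef]; linarith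
  have ht2 : ∀ n, 1 / 2 ≤ t n := fun n => (le_max_left _ _).trans (htt₀ n)
  have htlim : Tendsto t atTop (𝓝 1) := by
    have := (tendsto_one_div_add_atTop_nhds_zero_nat (𝕜 := ℝ)).const_mul (1 - t₀)
    simpa [htdef] using this.const_sub 1
  have wm : MemLp w 2 volume := by simpa using hext.memLp
  have Hm : MemLp H 2 volume := by simpa using hext.memLp_grad
  -- The dilated function has compact support in the open annulus, so it can be mollified within it.
  -- For `n = 0` the tolerance is `⊤`, which is harmless.
  have step : ∀ n : ℕ, ∃ φ : Plane → ℝ, IsTestFun (annulus x₀ ε R) φ ∧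
      eLpNorm (fun x => φ x - w (dilation x₀ (t n) x)) 2 volume ≤ ((n : ENNReal))⁻¹ ∧
      eLpNorm (fun x => gradient φ x - t n • H (dilation x₀ (t n) x)) 2 volume
        ≤ ((n : ENNReal))⁻¹ := by
    intro n
    have hpos : 0 < t n := by linarith [ht2 n]
    have hKc : IsCompact (closedBall x₀ (max ρ ε / t n) \ ball x₀ (ε / t n)) :=
      (isCompact_closedBall _ _).diff isOpen_ball
    have hKs : closedBall x₀ (max ρ ε / t n) \ ball x₀ (ε / t n) ⊆ annulus x₀ ε R := by
      intro x hx
      have h1 : dist x x₀ ≤ max ρ ε / t n := hx.1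
      have h2 : ε / t n ≤ dist x x₀ := not_lt.1 hx.2
      refine ⟨mem_ball.2 (h1.trans_lt ?_), fun h3 => ?_⟩
      · rw [div_lt_comm₀ hpos hR]
        exact ht₀q.trans_le (htt₀ n)
      · have h4 : ε < ε / t n := by rw [lt_div_iff₀ hpos]; nlinarith [ht1 n]
        exact absurd (mem_closedBall.1 h3) (not_le.2 (h4.trans_le h2))
    have hdil := hext.comp_dilation (isCompact_closedBall x₀ ρ)
      (by filter_upwards [hw0] with x hx h using hx (Or.inr h)) x₀ (ht2 n)
    have hae : ∀ᵐ x, x ∉ closedBall x₀ (max ρ ε / t n) \ ball x₀ (ε / t n) →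
        w (dilation x₀ (t n) x) = 0 := by
      have h1 : ∀ᵐ y ∂(Measure.map (dilation x₀ (t n)) volume),
          (y ∈ ball x₀ ε ∨ y ∉ closedBall x₀ ρ) → w y = 0 := by
        rw [map_dilation x₀ hpos.ne']
        exact Measure.ae_smul_measure hw0 _
      filter_upwards [ae_of_ae_map (continuous_dilation _ _).aemeasurable h1] with x hx hxK
      refine hx ?_
      rw [mem_ball, mem_closedBall, norm_dilation_sub x₀ hpos.le, not_le]
      by_contra hcon
      rw [not_or, not_lt, not_lt] at hcon
      refine hxK ⟨?_, fun h => ?_⟩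
      · rw [mem_closedBall, le_div_iff₀ hpos, mul_comm]
        exact hcon.2.trans (le_max_left _ _)
      · rw [mem_ball, lt_div_iff₀ hpos, mul_comm] at h
        exact absurd h (not_lt.2 hcon.1)
    obtain ⟨φ, hφ, l1, l2⟩ := exists_testFun_l2Tendsto hdil hKc isOpen_annulus hKs hae
    have hη : (0 : ENNReal) < ((n : ENNReal))⁻¹ := ENNReal.inv_pos.2 (ENNReal.natCast_ne_top _)
    obtain ⟨m, h1, h2⟩ := ((l1.lim.eventually (gt_mem_nhds hη)).and
      (l2.lim.eventually (gt_mem_nhds hη))).exists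
    exact ⟨φ m, hφ m, h1.le, h2.le⟩
  choose φ hφ hφ1 hφ2 using step
  have mφ : ∀ n, MemLp (φ n) 2 volume := fun n => by simpa using (hφ n).memLp univ
  have mφ' : ∀ n, MemLp (gradient (φ n)) 2 volume := fun n => by
    simpa using (hφ n).memLp_gradient univ
  have L1 := l2Tendsto_comp_dilation x₀ htlim ht2 wm
  have L2 := l2Tendsto_smul_comp_dilation x₀ htlim ht2 Hm
  have D1 : L2Tendsto volume (fun n x => φ n x - w (dilation x₀ (t n) x)) (fun _ => 0) :=
    L2Tendsto.of_le (fun n => (mφ n).sub (L1.mem_left n)) MemLp.zero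
      ENNReal.tendsto_inv_nat_nhds_zero fun n => by simpa using hφ1 n
  have D2 : L2Tendsto volume (fun n x => gradient (φ n) x - t n • H (dilation x₀ (t n) x))
      (fun _ => 0) :=
    L2Tendsto.of_le (fun n => (mφ' n).sub (L2.mem_left n)) MemLp.zero
      ENNReal.tendsto_inv_nat_nhds_zero fun n => by simpa using hφ2 n
  refine ⟨φ, hφ, ?_, ?_⟩
  · refine (((D1.add L1).congr (fun n => Eventually.of_forall fun x => ?_)
      (Eventually.of_forall fun x => ?_)).mono_measure Measure.restrict_le_self).congr_right hwu
    · simp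
    · simp
  · refine (((D2.add L2).congr (fun n => Eventually.of_forall fun x => ?_)
      (Eventually.of_forall fun x => ?_)).mono_measure Measure.restrict_le_self).congr_right hHG
    · simp
    · simp

end ZeroTrace

/-! ### The weak residual, Green's boundary term and the distributional equation. -/

section Residual

variable {Ω Ω' O : Set Plane} {x₀ : Plane} {r α : ℝ} {h u u' v w w' ψ ψ' : Plane → ℝ}
  {G G' H H' : Plane → Plane}

/-- The weak form of `-αΔu + u - h` tested with `ψ`, where `G` and `H` are the gradients of `u`
and `ψ`. -/
noncomputable def weakResidual (Ω : Set Plane) (α : ℝ) (h u : Plane → ℝ) (G : Plane → Plane)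
    (ψ : Plane → ℝ) (H : Plane → Plane) : ℝ :=
  α * (∫ x in Ω, inner ℝ (G x) (H x)) + (∫ x in Ω, u x * ψ x) - ∫ x in Ω, h x * ψ x

theorem weakResidual_congr (hu : u =ᵐ[volume.restrict Ω] u') (hG : G =ᵐ[volume.restrict Ω] G')
    (hψ : ψ =ᵐ[volume.restrict Ω] ψ') (hH : H =ᵐ[volume.restrict Ω] H') :
    weakResidual Ω α h u G ψ H = weakResidual Ω α h u' G' ψ' H' := by
  have e1 : ∫ x in Ω, inner ℝ (G x) (H x) = ∫ x in Ω, inner ℝ (G' x) (H' x) :=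
    integral_congr_ae (by filter_upwards [hG, hH] with x h1 h2; rw [h1, h2])
  have e2 : ∫ x in Ω, u x * ψ x = ∫ x in Ω, u' x * ψ' x :=
    integral_congr_ae (by filter_upwards [hu, hψ] with x h1 h2; rw [h1, h2])
  have e3 : ∫ x in Ω, h x * ψ x = ∫ x in Ω, h x * ψ' x :=
    integral_congr_ae (by filter_upwards [hψ] with x h2; rw [h2])
  rw [weakResidual, weakResidual, e1, e2, e3]

theorem weakResidual_eq_zero_of_vanish (hψ : ψ =ᵐ[volume.restrict Ω] fun _ => 0)
    (hH : H =ᵐ[volume.restrict Ω] fun _ => 0) : weakResidual Ω α h u G ψ H = 0 := by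
  rw [weakResidual_congr EventuallyEq.rfl EventuallyEq.rfl hψ hH]
  simp [weakResidual]

theorem weakResidual_split (hh : MemLp h 2 (volume.restrict O)) (hu : IsH1Pair O u G)
    (hψ : IsH1Pair O ψ H) :
    weakResidual O α h u G ψ H = weakResidual (O ∩ ball x₀ r) α h u G ψ H
      + weakResidual (O \ closedBall x₀ r) α h u G ψ H := by
  simp only [weakResidual]
  rw [setIntegral_split_ball (x₀ := x₀) (r := r)
      (integrable_inner_of_l2 hu.memLp_grad hψ.memLp_grad),
    setIntegral_split_ball (x₀ := x₀) (r := r) (integrable_mul_of_l2 hu.memLp hψ.memLp),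
    setIntegral_split_ball (x₀ := x₀) (r := r) (integrable_mul_of_l2 hh hψ.memLp)]
  ring

theorem weakResidual_add (hh : MemLp h 2 (volume.restrict Ω)) (hu : IsH1Pair Ω u G)
    (hψ : IsH1Pair Ω ψ H) (hψ' : IsH1Pair Ω ψ' H') :
    weakResidual Ω α h u G (fun x => ψ x + ψ' x) (fun x => H x + H' x)
      = weakResidual Ω α h u G ψ H + weakResidual Ω α h u G ψ' H' := by
  simp only [weakResidual, inner_add_right, mul_add]
  rw [integral_add (integrable_inner_of_l2 hu.memLp_grad hψ.memLp_grad)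
      (integrable_inner_of_l2 hu.memLp_grad hψ'.memLp_grad),
    integral_add (integrable_mul_of_l2 hu.memLp hψ.memLp)
      (integrable_mul_of_l2 hu.memLp hψ'.memLp),
    integral_add (integrable_mul_of_l2 hh hψ.memLp) (integrable_mul_of_l2 hh hψ'.memLp)]
  ring

theorem weakResidual_const_smul (c : ℝ) :
    weakResidual Ω α h u G (fun x => c * ψ x) (fun x => c • H x) = c * weakResidual Ω α h u G ψ H := by
  simp only [weakResidual, inner_smul_right, mul_left_comm _ c, integral_const_mul]
  ring

theorem weakResidual_sub (hh : MemLp h 2 (volume.restrict Ω)) (hu : IsH1Pair Ω u G)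
    (hψ : IsH1Pair Ω ψ H) (hψ' : IsH1Pair Ω ψ' H') :
    weakResidual Ω α h u G (fun x => ψ x - ψ' x) (fun x => H x - H' x)
      = weakResidual Ω α h u G ψ H - weakResidual Ω α h u G ψ' H' := by
  have := weakResidual_add (α := α) hh hu hψ (hψ'.const_smul (-1))
  rw [weakResidual_const_smul] at this
  simpa [sub_eq_add_neg] using this

theorem tendsto_weakResidual (hh : MemLp h 2 (volume.restrict Ω)) (hu : IsH1Pair Ω u G)
    {φ : ℕ → Plane → ℝ} {Φ : ℕ → Plane → Plane} (h1 : L2Tendsto (volume.restrict Ω) φ ψ)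
    (h2 : L2Tendsto (volume.restrict Ω) Φ H) :
    Tendsto (fun n => weakResidual Ω α h u G (φ n) (Φ n)) atTop (𝓝 (weakResidual Ω α h u G ψ H)) :=
  ((((L2Tendsto.const hu.memLp_grad).tendsto_integral_inner h2).const_mul α).add
    ((L2Tendsto.const hu.memLp).tendsto_integral_mul h1)).sub
    ((L2Tendsto.const hh).tendsto_integral_mul h1)

theorem abs_integral_inner_le {X E : Type*} [MeasurableSpace X] [NormedAddCommGroup E]
    [InnerProductSpace ℝ E] {μ : Measure X} {f g : X → E} (hf : MemLp f 2 μ) (hg : MemLp g 2 μ) :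
    |∫ x, inner ℝ (f x) (g x) ∂μ|
      ≤ Real.sqrt (∫ x, ‖f x‖ ^ 2 ∂μ) * Real.sqrt (∫ x, ‖g x‖ ^ 2 ∂μ) := by
  have key : ∀ {a b : X → E} (ha : MemLp a 2 μ) (hb : MemLp b 2 μ),
      ∫ x, inner ℝ (a x) (b x) ∂μ = inner ℝ (ha.toLp a) (hb.toLp b) := by
    intro a b ha hb
    rw [L2.inner_def]
    refine integral_congr_ae ?_
    filter_upwards [ha.coeFn_toLp, hb.coeFn_toLp] with x h1 h2
    rw [h1, h2]
  have hn : ∀ {a : X → E} (ha : MemLp a 2 μ), ‖ha.toLp a‖ = Real.sqrt (∫ x, ‖a x‖ ^ 2 ∂μ) := by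
    intro a ha
    rw [norm_eq_sqrt_real_inner (ha.toLp a), ← key ha ha]
    simp_rw [real_inner_self_eq_norm_sq]
  rw [key hf hg, ← hn hf, ← hn hg]
  exact abs_real_inner_le_norm _ _

/-- The fundamental lemma of the calculus of variations, which makes the choice in `weakLaplacian`
irrelevant. -/
theorem IsWeakLaplacian.ae_unique (hΩ : IsOpen Ω) (h1 : IsWeakLaplacian Ω u w)
    (h2 : IsWeakLaplacian Ω u w') : w =ᵐ[volume.restrict Ω] w' := by
  have hm : MemLp (fun x => w x - w' x) 2 (volume.restrict Ω) := h1.1.sub h2.1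
  have := hΩ.ae_eq_zero_of_integral_contDiff_smul_eq_zero
    (locallyIntegrableOn_of_locallyIntegrable_restrict (hm.locallyIntegrable (by norm_num)))
    (fun φ d1 d2 d3 => ?_)
  · rw [EventuallyEq, ae_restrict_iff' hΩ.measurableSet]
    filter_upwards [this] with x hx hxΩ using sub_eq_zero.1 (hx hxΩ)
  · have hφ : IsTestFun Ω φ := ⟨d1, d2, d3⟩
    rw [← setIntegral_eq_integral_of_forall_compl_eq_zero (s := Ω)
      (fun x hx => by rw [hφ.eq_zero hx, zero_smul])]
    have e1 := (h1.2 φ hφ).symm.trans (h2.2 φ hφ)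
    simp_rw [smul_eq_mul, mul_sub, mul_comm (φ _)]
    rw [integral_sub (integrable_mul_of_l2 h1.1 (hφ.memLp Ω))
      (integrable_mul_of_l2 h2.1 (hφ.memLp Ω))]
    linarith

theorem IsWeakLaplacian.weakLaplacian_ae (hΩ : IsOpen Ω) (h1 : IsWeakLaplacian Ω u w) :
    weakLaplacian Ω u =ᵐ[volume.restrict Ω] w := by
  have he : ∃ w, IsWeakLaplacian Ω u w := ⟨w, h1⟩
  rw [weakLaplacian, dif_pos he]
  exact he.choose_spec.ae_unique hΩ h1

theorem integral_inner_weakGrad (hΩ : IsOpen Ω) (hu : IsH1Pair Ω u G) (hψ : IsH1Pair Ω ψ H) :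
    ∫ x in Ω, inner ℝ (weakGrad Ω u x) (weakGrad Ω ψ x) = ∫ x in Ω, inner ℝ (G x) (H x) :=
  integral_congr_ae (by
    filter_upwards [hu.weakGrad_ae hΩ, hψ.weakGrad_ae hΩ] with x h1 h2
    rw [h1, h2])

theorem SolvesPDE.weakLaplacian_ae (hα : α ≠ 0) (hs : SolvesPDE Ω α h u) :
    weakLaplacian Ω u =ᵐ[volume.restrict Ω] fun x => α⁻¹ * (u x - h x) := by
  filter_upwards [hs.2] with x hx
  field_simp
  linarith

/-- For solutions of the equation, the boundary term in Green's formula is the weak residual. -/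
theorem SolvesPDE.mul_greenForm (hΩ : IsOpen Ω) (hα : α ≠ 0) (hs : SolvesPDE Ω α h u)
    (hh : MemLp h 2 (volume.restrict Ω)) (hu : IsH1Pair Ω u G) (hψ : IsH1Pair Ω ψ H) :
    α * greenForm Ω u ψ = weakResidual Ω α h u G ψ H := by
  have e : ∫ x in Ω, weakLaplacian Ω u x * ψ x
      = α⁻¹ * ((∫ x in Ω, u x * ψ x) - ∫ x in Ω, h x * ψ x) := by
    rw [← integral_sub (integrable_mul_of_l2 hu.memLp hψ.memLp)
      (integrable_mul_of_l2 hh hψ.memLp), ← integral_const_mul]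
    refine integral_congr_ae ?_
    filter_upwards [hs.weakLaplacian_ae hα] with x hx
    rw [hx]; ring
  rw [greenForm, integral_inner_weakGrad hΩ hu hψ, e, weakResidual]
  field_simp
  ring

theorem SolvesPDE.weakResidual_testFun (hΩ : IsOpen Ω) (hα : α ≠ 0) (hs : SolvesPDE Ω α h u)
    (hh : MemLp h 2 (volume.restrict Ω)) (hu : IsH1Pair Ω u G) {φ : Plane → ℝ}
    (hφ : IsTestFun Ω φ) : weakResidual Ω α h u G φ (gradient φ) = 0 := by
  obtain ⟨w, hw⟩ := hs.1
  have h1 := hw.2 φ hφ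
  have h2 : ∫ x in Ω, inner ℝ (weakGrad Ω u x) (gradient φ x)
      = ∫ x in Ω, inner ℝ (G x) (gradient φ x) :=
    integral_congr_ae (by filter_upwards [hu.weakGrad_ae hΩ] with x h1; rw [h1])
  have h3 : ∫ x in Ω, w x * φ x = α⁻¹ * ((∫ x in Ω, u x * φ x) - ∫ x in Ω, h x * φ x) := by
    rw [← integral_sub (integrable_mul_of_l2 hu.memLp (hφ.memLp Ω))
      (integrable_mul_of_l2 hh (hφ.memLp Ω)), ← integral_const_mul]
    refine integral_congr_ae ?_
    filter_upwards [hs.weakLaplacian_ae hα, hw.weakLaplacian_ae hΩ] with x hx hx'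
    rw [← hx', hx]; ring
  rw [weakResidual, ← h2, h1, h3]
  field_simp
  ring

/-- Vanishing residuals say that `α⁻¹(u - h)`, which is in `L²`, is the weak Laplacian of `u`. -/
theorem solvesPDE_of_weakResidual (hΩ : IsOpen Ω) (hα : α ≠ 0)
    (hh : MemLp h 2 (volume.restrict Ω)) (hu : IsH1Pair Ω u G)
    (hr : ∀ φ, IsTestFun Ω φ → weakResidual Ω α h u G φ (gradient φ) = 0) : SolvesPDE Ω α h u := by
  have hw : IsWeakLaplacian Ω u fun x => α⁻¹ * (u x - h x) := by
    refine ⟨(hu.memLp.sub hh).const_mul _, fun φ hφ => ?_⟩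
    have h1 := hr φ hφ
    have h2 : ∫ x in Ω, inner ℝ (weakGrad Ω u x) (gradient φ x)
        = ∫ x in Ω, inner ℝ (G x) (gradient φ x) :=
      integral_congr_ae (by filter_upwards [hu.weakGrad_ae hΩ] with x h1; rw [h1])
    simp_rw [mul_assoc, sub_mul]
    rw [h2, integral_const_mul, integral_sub (integrable_mul_of_l2 hu.memLp (hφ.memLp Ω))
      (integrable_mul_of_l2 hh (hφ.memLp Ω))]
    rw [weakResidual] at h1
    field_simp
    linarith
  refine ⟨⟨_, hw⟩, ?_⟩
  filter_upwards [hw.weakLaplacian_ae hΩ] with x hx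
  rw [hx]
  field_simp
  ring

end Residual

/-! ### The Hilbert space of zero-trace functions and the variational problem. -/

section ZeroTraceSpace

variable {Ω : Set Plane} {x₀ : Plane} {r α : ℝ} {h u u' g φ : Plane → ℝ} {G G' H : Plane → Plane}

/-- Having trace `g` is a closure condition, so a fixed trace survives `H¹` limits: a smooth
function `η/2`-close to some `v n` is `η`-close to `u`. This is what makes the zero-trace space
closed, with no trace inequality. -/
theorem HasTrace.of_l2Tendsto (hΩ : IsOpen Ω) {v : ℕ → Plane → ℝ} {H : ℕ → Plane → Plane}
    (hv : ∀ n, IsH1Pair Ω (v n) (H n)) (ht : ∀ n, HasTrace Ω x₀ r (v n) g)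
    (hu : L2Tendsto (volume.restrict Ω) v u) (hG : L2Tendsto (volume.restrict Ω) H G) :
    HasTrace Ω x₀ r u g := by
  have hp : IsH1Pair Ω u G := .of_l2Tendsto hv hu hG
  refine ⟨(ht 0).1, fun K hK hKΩ η hη => ?_⟩
  have h2 : 0 < η / 2 := ENNReal.half_pos hη.ne'
  obtain ⟨n, hn1, hn2⟩ := ((hu.lim.eventually_lt_const h2).and
    (hG.lim.eventually_lt_const h2)).exists
  obtain ⟨φ, h0, e1, e2, e3⟩ := (ht n).2 K hK hKΩ (η / 2) h2
  have hle : volume.restrict (Ω ∩ K) ≤ volume.restrict Ω :=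
    Measure.restrict_mono inter_subset_left le_rfl
  have tri : ∀ {E : Type} [NormedAddCommGroup E] {a b c : Plane → E},
      AEStronglyMeasurable a (volume.restrict (Ω ∩ K)) → MemLp b 2 (volume.restrict Ω) →
      MemLp c 2 (volume.restrict Ω) →
      eLpNorm (fun x => a x - b x) 2 (volume.restrict (Ω ∩ K)) < η / 2 →
      eLpNorm (fun x => b x - c x) 2 (volume.restrict Ω) < η / 2 →
      eLpNorm (fun x => a x - c x) 2 (volume.restrict (Ω ∩ K)) < η := by
    intro E _ a b c ha hb hc h1 h2
    have := eLpNorm_add_le (ha.sub (hb.mono_measure hle).1)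
      ((hb.sub hc).mono_measure hle).1 (p := 2) (by norm_num)
    rw [sub_add_sub_cancel] at this
    calc _ ≤ _ := this
      _ < η / 2 + η / 2 := ENNReal.add_lt_add h1 ((eLpNorm_mono_measure _ hle).trans_lt h2)
      _ = η := ENNReal.add_halves η
  refine ⟨φ, h0, tri h0.continuous.aestronglyMeasurable (hv n).memLp hp.memLp e1 hn1,
    tri h0.continuous_gradient.aestronglyMeasurable
      ((memLp_congr_ae ((hv n).weakGrad_ae hΩ)).2 (hv n).memLp_grad)
      ((memLp_congr_ae (hp.weakGrad_ae hΩ)).2 hp.memLp_grad) e2 ?_,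
    e3.trans_le ENNReal.half_le_self⟩
  refine (eLpNorm_congr_ae ?_).trans_lt hn2
  filter_upwards [(hv n).weakGrad_ae hΩ, hp.weakGrad_ae hΩ] with x h1 h2
  rw [h1, h2]

/-- `u` is an `H¹(Ω)` function with gradient `G`, and its trace on the circle vanishes. -/
structure IsZeroTracePair (Ω : Set Plane) (x₀ : Plane) (r : ℝ) (u : Plane → ℝ)
    (G : Plane → Plane) : Prop where
  pair : IsH1Pair Ω u G
  trace : HasTrace Ω x₀ r u (fun _ => 0)

namespace IsZeroTracePair

theorem congr (hΩ : IsOpen Ω) (hr : 0 ≤ r) (h : IsZeroTracePair Ω x₀ r u G)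
    (hu : u =ᵐ[volume.restrict Ω] u') (hG : G =ᵐ[volume.restrict Ω] G') :
    IsZeroTracePair Ω x₀ r u' G' :=
  ⟨h.pair.congr hu hG, h.trace.congr hΩ hr h.pair hu EventuallyEq.rfl⟩

theorem zero (hΩ : IsOpen Ω) (hr : 0 ≤ r) : IsZeroTracePair Ω x₀ r (fun _ => 0) (fun _ => 0) :=
  ⟨.zero, hasTrace_zero hΩ hr⟩

theorem add (hΩ : IsOpen Ω) (hr : 0 ≤ r) (h : IsZeroTracePair Ω x₀ r u G)
    (h' : IsZeroTracePair Ω x₀ r u' G') :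
    IsZeroTracePair Ω x₀ r (fun x => u x + u' x) (fun x => G x + G' x) :=
  ⟨h.pair.add h'.pair, by simpa using h.trace.add hΩ hr h.pair h'.pair h'.trace⟩

theorem const_smul (hΩ : IsOpen Ω) (hr : 0 ≤ r) (c : ℝ) (h : IsZeroTracePair Ω x₀ r u G) :
    IsZeroTracePair Ω x₀ r (fun x => c * u x) (fun x => c • G x) :=
  ⟨h.pair.const_smul c, by simpa using h.trace.const_mul hΩ hr h.pair c⟩

theorem sub (hΩ : IsOpen Ω) (hr : 0 ≤ r) (h : IsZeroTracePair Ω x₀ r u G)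
    (h' : IsZeroTracePair Ω x₀ r u' G') :
    IsZeroTracePair Ω x₀ r (fun x => u x - u' x) (fun x => G x - G' x) :=
  ⟨h.pair.sub h'.pair, by simpa using h.trace.sub hΩ hr h.pair h'.pair h'.trace⟩

/-- The space of functions with zero trace, as a subspace of `L² × L²` through
`(u, ∇u) ↦ (u, c⁻¹ ∇u)`. -/
noncomputable def submodule (hΩ : IsOpen Ω) (x₀ : Plane) (hr : 0 ≤ r) (c : ℝ) :
    Submodule ℝ (WithLp 2 (Lp ℝ 2 (volume.restrict Ω) × Lp Plane 2 (volume.restrict Ω))) where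
  carrier := {p | IsZeroTracePair Ω x₀ r p.fst (c • p.snd : Lp Plane 2 (volume.restrict Ω))}
  add_mem' := by
    intro p q hp hq
    refine (hp.add hΩ hr hq).congr hΩ hr (Lp.coeFn_add _ _).symm ?_
    rw [WithLp.add_snd, smul_add]
    exact (Lp.coeFn_add _ _).symm
  zero_mem' := by
    refine (zero hΩ hr).congr hΩ hr (Lp.coeFn_zero _ _ _).symm ?_
    rw [WithLp.zero_snd, smul_zero]
    exact (Lp.coeFn_zero _ _ _).symm
  smul_mem' := by
    intro a p hp
    refine (hp.const_smul hΩ hr a).congr hΩ hr (Lp.coeFn_smul a p.fst).symm ?_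
    rw [WithLp.smul_snd, smul_comm]
    exact (Lp.coeFn_smul a (c • p.snd)).symm

theorem mem_submodule {hΩ : IsOpen Ω} {hr : 0 ≤ r} {c : ℝ}
    {p : WithLp 2 (Lp ℝ 2 (volume.restrict Ω) × Lp Plane 2 (volume.restrict Ω))} :
    p ∈ submodule hΩ x₀ hr c ↔
      IsZeroTracePair Ω x₀ r p.fst (c • p.snd : Lp Plane 2 (volume.restrict Ω)) := Iff.rfl

theorem isClosed_submodule (hΩ : IsOpen Ω) (x₀ : Plane) (hr : 0 ≤ r) (c : ℝ) :
    IsClosed (submodule hΩ x₀ hr c : Set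
      (WithLp 2 (Lp ℝ 2 (volume.restrict Ω) × Lp Plane 2 (volume.restrict Ω)))) := by
  refine IsSeqClosed.isClosed fun p q hp hq => ?_
  have lim : ∀ {E : Type} [NormedAddCommGroup E] {f : ℕ → Lp E 2 (volume.restrict Ω)}
      {l : Lp E 2 (volume.restrict Ω)}, Tendsto f atTop (𝓝 l) →
      L2Tendsto (volume.restrict Ω) (fun n => f n) l := fun {E} _ {f l} h =>
    ⟨fun n => Lp.memLp _, Lp.memLp _, (Lp.tendsto_Lp_iff_tendsto_eLpNorm' _ _).1 h⟩
  have hq' := ((WithLp.prod_continuous_ofLp 2 _ _).tendsto q).comp hq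
  have l1 := lim ((continuous_fst.tendsto _).comp hq')
  have l2 := lim (((continuous_snd.tendsto _).comp hq').const_smul c)
  exact ⟨.of_l2Tendsto (fun n => (hp n).pair) l1 l2,
    .of_l2Tendsto hΩ (fun n => (hp n).pair) (fun n => (hp n).trace) l1 l2⟩

end IsZeroTracePair

/-- Solvability of the variational problem in the space of functions with zero trace. -/
theorem exists_weakResidual_eq_zero (hΩ : IsOpen Ω) (hr : 0 ≤ r) (hα : 0 < α)
    (hh : MemLp h 2 (volume.restrict Ω)) :
    ∃ u G, IsZeroTracePair Ω x₀ r u G ∧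
      ∀ φ H, IsZeroTracePair Ω x₀ r φ H → weakResidual Ω α h u G φ H = 0 := by
  have hc : 0 < Real.sqrt α := Real.sqrt_pos.2 hα
  set S := IsZeroTracePair.submodule hΩ x₀ hr (Real.sqrt α)⁻¹
  have : CompleteSpace S := (IsZeroTracePair.isClosed_submodule hΩ x₀ hr _).completeSpace_coe
  set f : WithLp 2 (Lp ℝ 2 (volume.restrict Ω) × Lp Plane 2 (volume.restrict Ω)) :=
    WithLp.toLp 2 (hh.toLp h, 0)
  -- In the coordinates `(u, √α ∇u)` the bilinear form is the inner product of `L² × L²`, and `∫hφ`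
  -- is the inner product with `f = (h, 0)`. The solution is therefore the projection of `f`, and
  -- orthogonality of `f - p` to the subspace is the weak equation.
  set p : WithLp 2 (Lp ℝ 2 (volume.restrict Ω) × Lp Plane 2 (volume.restrict Ω)) :=
    S.starProjection f
  have hp : p ∈ S := S.starProjection_apply_mem f
  refine ⟨p.fst, ((Real.sqrt α)⁻¹ • p.snd : Lp Plane 2 (volume.restrict Ω)),
    IsZeroTracePair.mem_submodule.1 hp, fun φ H hφ => ?_⟩
  have m1 := hφ.pair.memLp
  have m2 := hφ.pair.memLp_grad
  set q : WithLp 2 (Lp ℝ 2 (volume.restrict Ω) × Lp Plane 2 (volume.restrict Ω)) :=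
    WithLp.toLp 2 (m1.toLp φ, Real.sqrt α • m2.toLp H)
  have hq : q ∈ S := by
    refine IsZeroTracePair.mem_submodule.2 (hφ.congr hΩ hr m1.coeFn_toLp.symm ?_)
    change H =ᵐ[_] ((Real.sqrt α)⁻¹ • (Real.sqrt α • m2.toLp H) : Lp Plane 2 (volume.restrict Ω))
    rw [smul_smul, inv_mul_cancel₀ hc.ne', one_smul]
    exact m2.coeFn_toLp.symm
  have hin : inner ℝ (f - p) q = 0 := S.starProjection_inner_eq_zero f q hq
  rw [inner_sub_left, WithLp.prod_inner_apply, WithLp.prod_inner_apply] at hin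
  change inner ℝ (hh.toLp h) (m1.toLp φ) + inner ℝ (0 : Lp Plane 2 (volume.restrict Ω)) _
    - (inner ℝ p.fst (m1.toLp φ) + inner ℝ p.snd (Real.sqrt α • m2.toLp H)) = 0 at hin
  -- Written through the gradient `(√α)⁻¹ p.snd`, the second inner product acquires the factor `√α ·
  -- √α = α`.
  have hsnd : p.snd = Real.sqrt α • ((Real.sqrt α)⁻¹ • p.snd) := by
    rw [smul_smul, mul_inv_cancel₀ hc.ne', one_smul]
  rw [inner_zero_left, hsnd, inner_smul_left, inner_smul_right, conj_trivial, ← mul_assoc,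
    Real.mul_self_sqrt hα.le] at hin
  have e1 : inner ℝ (hh.toLp h) (m1.toLp φ) = ∫ x in Ω, h x * φ x := by
    rw [L2.inner_def]
    refine integral_congr_ae ?_
    filter_upwards [hh.coeFn_toLp, m1.coeFn_toLp] with x h1 h2
    rw [h1, h2]; simp [mul_comm]
  have e2 : inner ℝ p.fst (m1.toLp φ) = ∫ x in Ω, p.fst x * φ x := by
    rw [L2.inner_def]
    refine integral_congr_ae ?_
    filter_upwards [m1.coeFn_toLp] with x h2
    rw [h2]; simp [mul_comm]
  have e3 : inner ℝ ((Real.sqrt α)⁻¹ • p.snd) (m2.toLp H)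
      = ∫ x in Ω, inner ℝ (((Real.sqrt α)⁻¹ • p.snd : Lp Plane 2 (volume.restrict Ω)) x) (H x) := by
    rw [L2.inner_def]
    refine integral_congr_ae ?_
    filter_upwards [m2.coeFn_toLp] with x h2
    rw [h2]
  rw [e1, e2, e3] at hin
  rw [weakResidual]
  linarith

/-- Uniqueness for the variational problem. -/
theorem ae_eq_of_weakResidual_eq_zero (hΩ : IsOpen Ω) (hr : 0 ≤ r) (hα : 0 ≤ α)
    (hu : IsZeroTracePair Ω x₀ r u G) (hu' : IsZeroTracePair Ω x₀ r u' G')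
    (h1 : ∀ φ H, IsZeroTracePair Ω x₀ r φ H → weakResidual Ω α h u G φ H = 0)
    (h2 : ∀ φ H, IsZeroTracePair Ω x₀ r φ H → weakResidual Ω α h u' G' φ H = 0) :
    u =ᵐ[volume.restrict Ω] u' := by
  have hd := hu.sub hΩ hr hu'
  -- Both equations are tested with `d = u - u'`; the terms with `h` cancel and `α‖∇d‖² + ‖d‖² = 0`
  -- remains.
  have e := congrArg₂ (· - ·) (h1 _ _ hd) (h2 _ _ hd)
  simp only [weakResidual] at e
  have i1 : ∫ x in Ω, ‖G x - G' x‖ ^ 2 = (∫ x in Ω, inner ℝ (G x) (G x - G' x))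
      - ∫ x in Ω, inner ℝ (G' x) (G x - G' x) := by
    rw [← integral_sub (integrable_inner_of_l2 hu.pair.memLp_grad hd.pair.memLp_grad)
      (integrable_inner_of_l2 hu'.pair.memLp_grad hd.pair.memLp_grad)]
    simp_rw [← inner_sub_left, real_inner_self_eq_norm_sq]
  have i2 : ∫ x in Ω, (u x - u' x) * (u x - u' x) = (∫ x in Ω, u x * (u x - u' x))
      - ∫ x in Ω, u' x * (u x - u' x) := by
    rw [← integral_sub (integrable_mul_of_l2 hu.pair.memLp hd.pair.memLp)
      (integrable_mul_of_l2 hu'.pair.memLp hd.pair.memLp)]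
    simp_rw [← sub_mul]
  have p1 : 0 ≤ α * ∫ x in Ω, ‖G x - G' x‖ ^ 2 :=
    mul_nonneg hα (integral_nonneg fun x => sq_nonneg _)
  have p2 : 0 ≤ ∫ x in Ω, (u x - u' x) * (u x - u' x) :=
    integral_nonneg fun x => mul_self_nonneg _
  rw [i1, mul_sub] at p1
  have p3 : ∫ x in Ω, (u x - u' x) * (u x - u' x) = 0 := by
    refine le_antisymm ?_ p2
    rw [i2]; linarith
  rw [integral_eq_zero_iff_of_nonneg (fun x => mul_self_nonneg _)
    (integrable_mul_of_l2 hd.pair.memLp hd.pair.memLp)] at p3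
  filter_upwards [p3] with x hx
  exact sub_eq_zero.1 (mul_self_eq_zero.1 hx)

end ZeroTraceSpace

/-! ### The perforated problem; gluing a transmission solution. -/

section Perforated

variable {D : Set Plane} {x₀ : Plane} {α ε R : ℝ} {h u v vR φ : Plane → ℝ} {G H : Plane → Plane}

theorem isOpen_outside (hD : IsOpen D) : IsOpen (outside D x₀ ε) := hD.sdiff isClosed_closedBall

theorem outside_subset : outside D x₀ ε ⊆ D := sdiff_subset

theorem outside_inter_ball (hRD : closedBall x₀ R ⊆ D) :
    outside D x₀ ε ∩ ball x₀ R = annulus x₀ ε R := by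
  ext x
  simp only [outside, annulus, mem_inter_iff, Set.mem_sdiff]
  exact ⟨fun hx => ⟨hx.2, hx.1.2⟩, fun hx => ⟨⟨hRD (ball_subset_closedBall hx.1), hx.2⟩, hx.1⟩⟩

theorem outside_diff_closedBall (hεR : ε ≤ R) :
    outside D x₀ ε \ closedBall x₀ R = outside D x₀ R := by
  ext x
  simp only [outside, Set.mem_sdiff]
  exact ⟨fun hx => ⟨hx.1.1, hx.2⟩,
    fun hx => ⟨⟨hx.1, fun h => hx.2 (closedBall_subset_closedBall hεR h)⟩, hx.2⟩⟩

theorem sphere_subset_outside (hεR : ε < R) (hRD : closedBall x₀ R ⊆ D) :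
    sphere x₀ R ⊆ outside D x₀ ε := fun x hx =>
  ⟨hRD (sphere_subset_closedBall hx), fun h => by
    rw [mem_sphere] at hx; rw [mem_closedBall] at h; linarith⟩

theorem annulus_subset_outside (hRD : closedBall x₀ R ⊆ D) :
    annulus x₀ ε R ⊆ outside D x₀ ε := by
  rw [← outside_inter_ball hRD]; exact inter_subset_left

theorem outside_anti (hεR : ε ≤ R) : outside D x₀ R ⊆ outside D x₀ ε := by
  rw [← outside_diff_closedBall hεR]; exact sdiff_subset

theorem IsPerforatedSolution.isZeroTracePair (hu : IsPerforatedSolution D x₀ α ε h u) :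
    IsZeroTracePair (outside D x₀ ε) x₀ ε u (weakGrad (outside D x₀ ε) u) :=
  ⟨hu.mem.1.isH1Pair, hu.mem.2⟩

theorem IsPerforatedSolution.weakResidual_eq_zero (hD : IsOpen D)
    (hu : IsPerforatedSolution D x₀ α ε h u) (hφ : IsZeroTracePair (outside D x₀ ε) x₀ ε φ H) :
    weakResidual (outside D x₀ ε) α h u (weakGrad (outside D x₀ ε) u) φ H = 0 := by
  rw [weakResidual_congr EventuallyEq.rfl EventuallyEq.rfl EventuallyEq.rfl
    (hφ.pair.weakGrad_ae (isOpen_outside hD)).symm, weakResidual,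
    hu.weak φ ⟨hφ.pair.memH1, hφ.trace⟩, sub_self]

theorem isPerforatedSolution_of_weakResidual (hD : IsOpen D)
    (hu : IsZeroTracePair (outside D x₀ ε) x₀ ε u G)
    (h0 : ∀ᵐ x ∂(volume.restrict (ball x₀ ε)), u x = 0)
    (hw : ∀ φ H, IsZeroTracePair (outside D x₀ ε) x₀ ε φ H →
      weakResidual (outside D x₀ ε) α h u G φ H = 0) : IsPerforatedSolution D x₀ α ε h u := by
  refine ⟨⟨hu.pair.memH1, hu.trace⟩, h0, fun φ hφ => ?_⟩
  have := hw φ _ ⟨hφ.1.isH1Pair, hφ.2⟩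
  rw [weakResidual_congr EventuallyEq.rfl (hu.pair.weakGrad_ae (isOpen_outside hD)).symm
    EventuallyEq.rfl EventuallyEq.rfl, weakResidual, sub_eq_zero] at this
  exact this

/-- The variational solution is arbitrary off `outside D x₀ ε`; taking its indicator gives the zero
values in the hole without affecting the weak form. -/
theorem exists_isPerforatedSolution (hD : IsOpen D) (hα : 0 < α) (hε : 0 < ε)
    (hh : MemLp h 2 (volume.restrict D)) : ∃ u, IsPerforatedSolution D x₀ α ε h u := by
  have hΩ : IsOpen (outside D x₀ ε) := isOpen_outside hD
  obtain ⟨u, G, hu, hw⟩ := exists_weakResidual_eq_zero (x₀ := x₀) hΩ hε.le hα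
    (hh.mono_measure (Measure.restrict_mono outside_subset le_rfl))
  have e : u =ᵐ[volume.restrict (outside D x₀ ε)] (outside D x₀ ε).indicator u :=
    (indicator_ae_eq_restrict hΩ.measurableSet).symm
  refine ⟨(outside D x₀ ε).indicator u, isPerforatedSolution_of_weakResidual hD
    (hu.congr hΩ hε.le e EventuallyEq.rfl) ?_ fun φ H hφ => ?_⟩
  · filter_upwards [ae_restrict_mem measurableSet_ball] with x hx
    exact indicator_of_notMem (fun h' => h'.2 (ball_subset_closedBall hx)) _
  · rw [weakResidual_congr e.symm EventuallyEq.rfl EventuallyEq.rfl EventuallyEq.rfl]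
    exact hw φ H hφ

theorem ae_mem_annulus : ∀ᵐ x ∂(volume.restrict (annulus x₀ ε R)), x ∈ annulus x₀ ε R :=
  ae_restrict_mem isOpen_annulus.measurableSet

theorem ae_mem_outside (hD : IsOpen D) :
    ∀ᵐ x ∂(volume.restrict (outside D x₀ ε)), x ∈ outside D x₀ ε :=
  ae_restrict_mem (isOpen_outside hD).measurableSet

/-- Gluing the two parts of a solution of the transmission problem gives a weak solution. -/
theorem IsTransmissionSolution.exists_glue (hD : IsOpen D) (hα : 0 < α) (hε : 0 < ε)
    (hεR : ε < R) (hRD : closedBall x₀ R ⊆ D) (hh : MemLp h 2 (volume.restrict D))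
    (ht : IsTransmissionSolution D x₀ α ε R h v vR) :
    ∃ G, IsZeroTracePair (outside D x₀ ε) x₀ ε (glue x₀ R vR v) G ∧
      ∀ φ H, IsZeroTracePair (outside D x₀ ε) x₀ ε φ H →
        weakResidual (outside D x₀ ε) α h (glue x₀ R vR v) G φ H = 0 := by
  obtain ⟨g, q, -, hqA, hext, hg, hint⟩ := ht
  have hR : 0 < R := hε.trans hεR
  have hΩ : IsOpen (outside D x₀ ε) := isOpen_outside hD
  have hE : IsOpen (outside D x₀ R) := isOpen_outside hD
  have hA : IsOpen (annulus x₀ ε R) := isOpen_annulus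
  have sA : annulus x₀ ε R ⊆ outside D x₀ ε := annulus_subset_outside hRD
  have sE : outside D x₀ R ⊆ outside D x₀ ε := outside_anti hεR.le
  have eA := outside_inter_ball (ε := ε) hRD
  have eE := outside_diff_closedBall (D := D) (x₀ := x₀) hεR.le
  have hhΩ := hh.mono_measure (Measure.restrict_mono (outside_subset (x₀ := x₀) (ε := ε)) le_rfl)
  have hhA := hhΩ.mono_measure (Measure.restrict_mono sA le_rfl)
  have hhE := hhΩ.mono_measure (Measure.restrict_mono sE le_rfl)
  have pA := hint.mem.isH1Pair
  have pE := hext.mem.isH1Pair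
  set w := glue x₀ R vR v
  set G := glue x₀ R (weakGrad (annulus x₀ ε R) vR) (weakGrad (outside D x₀ R) v)
  have pw : IsH1Pair (outside D x₀ ε) w G :=
    IsH1Pair.glue hΩ hR (by rwa [eA]) (by rwa [eE]) (by rw [eA]; exact hint.dirichlet_outer)
      (by rwa [eE])
  have wA : w =ᵐ[volume.restrict (annulus x₀ ε R)] vR := eA ▸ glue_ae_inner hΩ.measurableSet
  have wE : w =ᵐ[volume.restrict (outside D x₀ R)] v := eE ▸ glue_ae_outer hΩ.measurableSet
  have gA : G =ᵐ[volume.restrict (annulus x₀ ε R)] weakGrad (annulus x₀ ε R) vR := by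
    have := glue_ae_inner (x₀ := x₀) (r := R) (f := weakGrad (annulus x₀ ε R) vR)
      (f' := weakGrad (outside D x₀ R) v) hΩ.measurableSet
    rwa [eA] at this
  have gE : G =ᵐ[volume.restrict (outside D x₀ R)] weakGrad (outside D x₀ R) v := by
    have := glue_ae_outer (x₀ := x₀) (r := R) (f := weakGrad (annulus x₀ ε R) vR)
      (f' := weakGrad (outside D x₀ R) v) hΩ.measurableSet
    rwa [eE] at this
  -- Traces are local, and inside `B_R`, a neighbourhood of `∂B_ε`, `w` is `vR`.
  have tw : HasTrace (outside D x₀ ε) x₀ ε w (fun _ => 0) :=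
    HasTrace.of_local hΩ hε.le pw hA sA
      (hint.dirichlet_inner.congr hA hε.le pA wA.symm EventuallyEq.rfl) isOpen_ball
      (fun x hx => by rw [mem_sphere] at hx; rw [mem_ball]; linarith) eA.subset
  refine ⟨G, ⟨pw, tw⟩, fun φ H hφ => ?_⟩
  have split : ∀ {ψ : Plane → ℝ} {Ψ : Plane → Plane}, IsH1Pair (outside D x₀ ε) ψ Ψ →
      weakResidual (outside D x₀ ε) α h w G ψ Ψ
        = weakResidual (annulus x₀ ε R) α h vR (weakGrad (annulus x₀ ε R) vR) ψ Ψ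
          + weakResidual (outside D x₀ R) α h v (weakGrad (outside D x₀ R) v) ψ Ψ := by
    intro ψ Ψ hψ
    rw [weakResidual_split (x₀ := x₀) (r := R) hhΩ pw hψ, eA, eE,
      weakResidual_congr wA gA EventuallyEq.rfl EventuallyEq.rfl,
      weakResidual_congr wE gE EventuallyEq.rfl EventuallyEq.rfl]
  have vanish : ∀ {Ω : Set Plane} {z ψ : Plane → ℝ} {Z Ψ : Plane → Plane}, IsOpen Ω →
      IsH1Pair Ω ψ Ψ → ψ =ᵐ[volume.restrict Ω] (fun _ => 0) →
      weakResidual Ω α h z Z ψ Ψ = 0 := by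
    intro Ω z ψ Z Ψ hΩ hψ h0
    exact weakResidual_eq_zero_of_vanish h0 (hψ.grad_unique hΩ (IsH1Pair.zero.congr h0.symm .rfl))
  -- With `χ₁ = 1` near `B_ε` and `χ₂ = 1` near `B_R`, the decomposition `φ = χ₁φ + (χ₂ - χ₁)φ + (1
  -- - χ₂)φ` isolates `∂B_ε`, `∂B_R` and `∂D`.
  obtain ⟨χ₁, c₁, n₁⟩ := exists_cutoff (isCompact_closedBall x₀ ε) isOpen_ball
    (closedBall_subset_ball hεR)
  obtain ⟨χ₂, c₂, n₂⟩ := exists_cutoff (isCompact_closedBall x₀ R) hD hRD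
  obtain ⟨W₁, oW₁, sW₁, z₁⟩ := eventually_nhdsSet_iff_exists.1 n₁
  obtain ⟨W₂, oW₂, sW₂, z₂⟩ := eventually_nhdsSet_iff_exists.1 n₂
  have p1 := hφ.pair.mul_smooth c₁.isMultiplier
  have p2 := hφ.pair.mul_smooth (c₂.isMultiplier.sub c₁.isMultiplier)
  have p3 := hφ.pair.mul_smooth (isMultiplier_one.sub c₂.isMultiplier)
  have hsum : (fun x => χ₁ x * φ x + ((χ₂ x - χ₁ x) * φ x + (1 - χ₂ x) * φ x)) = φ := by
    funext x; ring
  have ps := p1.add (p2.add p3)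
  rw [hsum] at ps
  have hH := hφ.pair.grad_unique hΩ ps
  rw [weakResidual_congr .rfl .rfl (Eventually.of_forall fun x => (congrFun hsum x).symm) hH,
    weakResidual_add hhΩ pw p1 (p2.add p3), weakResidual_add hhΩ pw p2 p3, split p1, split p2,
    split p3]
  -- Near `∂B_ε` no condition on the normal derivative is known; it is not needed, since `χ₁φ` is an
  -- `H¹` limit of test functions of the annulus.
  have r1A : weakResidual (annulus x₀ ε R) α h vR (weakGrad (annulus x₀ ε R) vR)
      (fun x => χ₁ x * φ x) (fun x => χ₁ x • H x + φ x • gradient χ₁ x) = 0 := by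
    obtain ⟨ρ, hρR, hρ⟩ := exists_lt_subset_ball (isClosed_tsupport χ₁) c₁.supp
    obtain ⟨f, hf, l1, l2⟩ := HasTrace.exists_testFun_approx hε hεR (p1.mono sA)
      (by simpa using ((hφ.trace.mul_smooth hΩ hε.le hφ.pair c₁.isMultiplier).mono hΩ hε.le p1
        hA sA)) hρR
      (Eventually.of_forall fun x hx => by
        rw [image_eq_zero_of_notMem_tsupport fun h => hx (ball_subset_closedBall (hρ h)),
          zero_mul])
    refine tendsto_nhds_unique (tendsto_weakResidual hhA pA l1 l2) ?_
    simp_rw [fun n => hint.pde.weakResidual_testFun hA hα.ne' hhA pA (hf n)]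
    exact tendsto_const_nhds
  have r1E := vanish (z := v) (Z := weakGrad (outside D x₀ R) v) hE (p1.mono sE) (by
    filter_upwards [ae_mem_outside hD] with x hx
    rw [c₁.eq_zero fun h => hx.2 (ball_subset_closedBall h), zero_mul])
  have r3A := vanish (z := vR) (Z := weakGrad (annulus x₀ ε R) vR) hA (p3.mono sA) (by
    filter_upwards [ae_mem_annulus] with x hx
    rw [z₂ x (sW₂ (ball_subset_closedBall hx.1)), sub_self, zero_mul])
  -- `1 - χ₂` vanishes on a ball slightly larger than `B_R`, so the outer Neumann condition applies.
  have r3E : weakResidual (outside D x₀ R) α h v (weakGrad (outside D x₀ R) v)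
      (fun x => (1 - χ₂ x) * φ x)
      (fun x => (1 - χ₂ x) • H x + φ x • gradient (fun x => 1 - χ₂ x) x) = 0 := by
    rw [← hext.pde.mul_greenForm hE hα.ne' hhE pE (p3.mono sE)]
    obtain ⟨δ, hδ, hδW⟩ := (isCompact_closedBall x₀ R).exists_thickening_subset_open oW₂ sW₂
    rw [thickening_closedBall hδ hR.le] at hδW
    rw [hext.neumann_outer _ (p3.mono sE).memH1 ⟨δ + R, by linarith,
      Eventually.of_forall fun x hx => by rw [z₂ x (hδW hx), sub_self, zero_mul]⟩, mul_zero]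
  -- The middle piece has one trace `g'` on `∂B_R` from both sides; the boundary terms are `q g'`
  -- and `-q g'`.
  obtain ⟨g', hg'⟩ := p2.exists_trace hΩ hR (sphere_subset_outside hεR hRD)
  rw [r1A, r1E, r3A, r3E, ← hint.pde.mul_greenForm hA hα.ne' hhA pA (p2.mono sA),
    ← hext.pde.mul_greenForm hE hα.ne' hhE pE (p2.mono sE),
    hqA _ g' (p2.mono sA).memH1 ?_ (hg' _ hA sA),
    hext.neumann_inner _ g' (p2.mono sE).memH1 ?_ (hg' _ hE sE)]
  · ring
  · refine ⟨tsupport χ₂ \ ball x₀ R, c₂.compact.isCompact.diff isOpen_ball, fun x hx => ?_, ?_⟩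
    · by_cases hs : x ∈ sphere x₀ R
      · exact Or.inr hs
      · refine Or.inl ⟨c₂.supp hx.1, fun hc => ?_⟩
        rw [← ball_union_sphere] at hc
        exact hc.elim hx.2 hs
    · filter_upwards [ae_mem_outside hD] with x hx hxK
      have hb : x ∉ ball x₀ R := fun h => hx.2 (ball_subset_closedBall h)
      rw [c₁.eq_zero hb, image_eq_zero_of_notMem_tsupport fun h => hxK ⟨h, hb⟩]
      simp
  · refine ⟨closedBall x₀ R \ W₁, (isCompact_closedBall x₀ R).diff oW₁, fun x hx => ?_, ?_⟩
    · have := hx.1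
      rw [← ball_union_sphere] at this
      exact this.imp (fun h => ⟨h, fun hc => hx.2 (sW₁ hc)⟩) id
    · filter_upwards [ae_mem_annulus] with x hx hxK
      have hb := ball_subset_closedBall hx.1
      have : x ∈ W₁ := by_contra fun h => hxK ⟨hb, h⟩
      rw [z₁ x this, z₂ x (sW₂ hb)]
      simp

/-- The perforated problem and the transmission problem have the same solutions. -/
theorem IsPerforatedSolution.ae_eq_transmission (hD : IsOpen D) (hα : 0 < α) (hε : 0 < ε)
    (hεR : ε < R) (hRD : closedBall x₀ R ⊆ D) (hh : MemLp h 2 (volume.restrict D))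
    (hu : IsPerforatedSolution D x₀ α ε h u) (ht : IsTransmissionSolution D x₀ α ε R h v vR) :
    (∀ᵐ x ∂(volume.restrict (D \ ball x₀ R)), u x = v x) ∧
      (∀ᵐ x ∂(volume.restrict (ball x₀ R \ ball x₀ ε)), u x = vR x) := by
  have hΩ : IsOpen (outside D x₀ ε) := isOpen_outside hD
  obtain ⟨G, hG, hw⟩ := ht.exists_glue hD hα hε hεR hRD hh
  have e := ae_eq_of_weakResidual_eq_zero hΩ hε.le hα.le hu.isZeroTracePair hG
    (fun φ H hφ => hu.weakResidual_eq_zero hD hφ) hw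
  constructor
  -- Circles are null sets, so the half-closed regions of the statement may be replaced by open
  -- ones.
  · rw [Measure.restrict_congr_set ae_restrict_diff_closedBall]
    change ∀ᵐ x ∂(volume.restrict (outside D x₀ R)), u x = v x
    have e1 := ae_mono (Measure.restrict_mono (outside_anti (D := D) (x₀ := x₀) hεR.le) le_rfl) e
    filter_upwards [e1, ae_mem_outside hD] with x hx hxE
    rw [hx, glue_of_notMem_closedBall hxE.2]
  · rw [Measure.restrict_congr_set ae_restrict_diff_closedBall]
    change ∀ᵐ x ∂(volume.restrict (annulus x₀ ε R)), u x = vR x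
    have e1 := ae_mono (Measure.restrict_mono (annulus_subset_outside (ε := ε) hRD) le_rfl) e
    filter_upwards [e1, ae_mem_annulus] with x hx hxA
    rw [hx, glue_of_mem_ball hxA.1]

end Perforated

/-! ### Normal derivatives as functionals on traces. -/

section NormalDerivative

variable {D Ω Ω' A B : Set Plane} {x₀ : Plane} {α ε R : ℝ} {h u ψ ψ' g g' : Plane → ℝ}
  {G H H' : Plane → Plane}

theorem weakResidual_restrict (hΩ : MeasurableSet Ω) (hsub : Ω' ⊆ Ω)
    (hψ : ∀ x, x ∉ Ω' → ψ x = 0) (hH : ∀ x, x ∉ Ω' → H x = 0) :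
    weakResidual Ω α h u G ψ H = weakResidual Ω' α h u G ψ H := by
  simp only [weakResidual]
  rw [setIntegral_eq_of_subset_of_forall_sdiff_eq_zero hΩ hsub fun x hx => by
      rw [hH x hx.2, inner_zero_right],
    setIntegral_eq_of_subset_of_forall_sdiff_eq_zero (f := fun x => u x * ψ x) hΩ hsub
      fun x hx => by rw [hψ x hx.2, mul_zero],
    setIntegral_eq_of_subset_of_forall_sdiff_eq_zero (f := fun x => h x * ψ x) hΩ hsub
      fun x hx => by rw [hψ x hx.2, mul_zero]]

/-- The functions used to define normal derivatives on a circle: `ψ ∈ H¹(Ω)` vanishes near the rest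
of the boundary of `Ω`, and `g` is its trace. -/
structure IsBoundaryTest (Ω : Set Plane) (x₀ : Plane) (R : ℝ) (ψ g : Plane → ℝ) : Prop where
  mem : MemH1 Ω ψ
  supp : ∃ K : Set Plane, IsCompact K ∧ K ⊆ Ω ∪ sphere x₀ R ∧
    ∀ᵐ x ∂(volume.restrict Ω), x ∉ K → ψ x = 0
  trace : HasTrace Ω x₀ R ψ g

namespace IsBoundaryTest

theorem zero (hΩ : IsOpen Ω) (hR : 0 ≤ R) : IsBoundaryTest Ω x₀ R (fun _ => 0) fun _ => 0 :=
  ⟨IsH1Pair.zero.memH1, ⟨∅, isCompact_empty, empty_subset _, by simp⟩, hasTrace_zero hΩ hR⟩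

theorem add (hΩ : IsOpen Ω) (hR : 0 ≤ R) (h : IsBoundaryTest Ω x₀ R ψ g)
    (h' : IsBoundaryTest Ω x₀ R ψ' g') :
    IsBoundaryTest Ω x₀ R (fun x => ψ x + ψ' x) (fun x => g x + g' x) := by
  obtain ⟨K, hK, hKΩ, h0⟩ := h.supp
  obtain ⟨K', hK', hKΩ', h0'⟩ := h'.supp
  refine ⟨(h.mem.isH1Pair.add h'.mem.isH1Pair).memH1,
    ⟨K ∪ K', hK.union hK', union_subset hKΩ hKΩ', ?_⟩,
    h.trace.add hΩ hR h.mem.isH1Pair h'.mem.isH1Pair h'.trace⟩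
  filter_upwards [h0, h0'] with x h1 h2 hx
  rw [h1 fun h => hx (.inl h), h2 fun h => hx (.inr h), add_zero]

theorem const_mul (hΩ : IsOpen Ω) (hR : 0 ≤ R) (c : ℝ) (h : IsBoundaryTest Ω x₀ R ψ g) :
    IsBoundaryTest Ω x₀ R (fun x => c * ψ x) (fun x => c * g x) := by
  obtain ⟨K, hK, hKΩ, h0⟩ := h.supp
  refine ⟨(h.mem.isH1Pair.const_smul c).memH1, ⟨K, hK, hKΩ, ?_⟩,
    h.trace.const_mul hΩ hR h.mem.isH1Pair c⟩
  filter_upwards [h0] with x h1 hx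
  rw [h1 hx, mul_zero]

theorem sub (hΩ : IsOpen Ω) (hR : 0 ≤ R) (h : IsBoundaryTest Ω x₀ R ψ g)
    (h' : IsBoundaryTest Ω x₀ R ψ' g') :
    IsBoundaryTest Ω x₀ R (fun x => ψ x - ψ' x) (fun x => g x - g' x) := by
  simpa [sub_eq_add_neg] using h.add hΩ hR (h'.const_mul hΩ hR (-1))

/-- Gluing test functions from both sides of the circle. -/
theorem glue (hD : IsOpen D) (hε : 0 < ε) (hεR : ε < R) (hRD : closedBall x₀ R ⊆ D)
    (hA : IsBoundaryTest (annulus x₀ ε R) x₀ R ψ g)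
    (hE : IsBoundaryTest (outside D x₀ R) x₀ R ψ' g) :
    IsZeroTracePair (outside D x₀ ε) x₀ ε (glue x₀ R ψ ψ')
      (_root_.glue x₀ R (weakGrad (annulus x₀ ε R) ψ) (weakGrad (outside D x₀ R) ψ')) := by
  have hR : 0 < R := hε.trans hεR
  have hΩ : IsOpen (outside D x₀ ε) := isOpen_outside hD
  have eA := outside_inter_ball (ε := ε) hRD
  have eE := outside_diff_closedBall (D := D) (x₀ := x₀) hεR.le
  have pw : IsH1Pair (outside D x₀ ε) (_root_.glue x₀ R ψ ψ')
      (_root_.glue x₀ R (weakGrad (annulus x₀ ε R) ψ) (weakGrad (outside D x₀ R) ψ')) :=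
    IsH1Pair.glue hΩ hR (by rw [eA]; exact hA.mem.isH1Pair) (by rw [eE]; exact hE.mem.isH1Pair)
      (by rw [eA]; exact hA.trace) (by rw [eE]; exact hE.trace)
  -- The compact set `K` does not meet `∂B_ε`, so the glued function vanishes on the neighbourhood
  -- `ball x₀ R \ K` of that circle.
  obtain ⟨K, hK, hKA, h0⟩ := hA.supp
  refine ⟨pw, hasTrace_zero_of_vanish hΩ hε.le pw (isOpen_ball.sdiff hK.isClosed)
    (V := ball x₀ R \ K) (fun x hx => ?_) ?_⟩
  · rw [mem_sphere] at hx
    refine ⟨by rw [mem_ball]; linarith, fun h => (hKA h).elim (fun h => h.2 ?_) fun h => ?_⟩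
    · rw [mem_closedBall]; linarith
    · rw [mem_sphere] at h; linarith
  · rw [← eA, ae_restrict_iff' (hΩ.inter isOpen_ball).measurableSet] at h0
    rw [ae_restrict_iff' hΩ.measurableSet]
    filter_upwards [h0] with x hx hxΩ hxV
    rw [glue_of_mem_ball hxV.1]
    exact hx ⟨hxΩ, hxV.1⟩ hxV.2

end IsBoundaryTest

open Classical in
/-- The normal derivative on the circle of a function on both sides `A` (inner) and `B` (outer) of
the circle, as a functional on traces, the normal pointing into `B`. -/
noncomputable def normalDerivFunctional (A B : Set Plane) (x₀ : Plane) (R : ℝ) (u g : Plane → ℝ) :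
    ℝ :=
  if H : ∃ ψ, IsBoundaryTest A x₀ R ψ g then greenForm A u H.choose
  else if H : ∃ ψ, IsBoundaryTest B x₀ R ψ g then -greenForm B u H.choose else 0

/-- If Green's boundary terms on both sides cancel, then both normal derivatives are given by the
same functional. -/
theorem hasNormalDeriv_normalDerivFunctional (hA : IsOpen A) (hB : IsOpen B) (hR : 0 ≤ R)
    (hAB : ∀ ψ ψ' g, IsBoundaryTest A x₀ R ψ g → IsBoundaryTest B x₀ R ψ' g →
      greenForm A u ψ + greenForm B u ψ' = 0)
    (subA : ∀ ψ ψ', MemH1 A ψ → MemH1 A ψ' →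
      greenForm A u (fun x => ψ x - ψ' x) = greenForm A u ψ - greenForm A u ψ')
    (subB : ∀ ψ ψ', MemH1 B ψ → MemH1 B ψ' →
      greenForm B u (fun x => ψ x - ψ' x) = greenForm B u ψ - greenForm B u ψ') :
    HasNormalDeriv A x₀ R u (normalDerivFunctional A B x₀ R u) ∧
      HasNormalDeriv B x₀ R u fun g => -normalDerivFunctional A B x₀ R u g := by
  have zA : greenForm A u (fun _ => 0) = 0 := by
    simpa using subA _ _ IsH1Pair.zero.memH1 IsH1Pair.zero.memH1
  have zB : greenForm B u (fun _ => 0) = 0 := by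
    simpa using subB _ _ IsH1Pair.zero.memH1 IsH1Pair.zero.memH1
  -- Two extensions of the same `g` differ by one with zero trace; paired with the zero function on
  -- the other side, cancellation shows that its boundary term vanishes.
  have uA : ∀ ψ ψ' g, IsBoundaryTest A x₀ R ψ g → IsBoundaryTest A x₀ R ψ' g →
      greenForm A u ψ = greenForm A u ψ' := by
    intro ψ ψ' g h h'
    have := hAB _ _ _ (h.sub hA hR h') (by simpa using IsBoundaryTest.zero hB hR)
    rw [zB, subA _ _ h.mem h'.mem] at this
    linarith
  have uB : ∀ ψ ψ' g, IsBoundaryTest B x₀ R ψ g → IsBoundaryTest B x₀ R ψ' g →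
      greenForm B u ψ = greenForm B u ψ' := by
    intro ψ ψ' g h h'
    have := hAB _ _ _ (by simpa using IsBoundaryTest.zero hA hR) (h.sub hB hR h')
    rw [zA, subB _ _ h.mem h'.mem] at this
    linarith
  constructor
  · intro ψ g h1 h2 h3
    have he : ∃ ψ, IsBoundaryTest A x₀ R ψ g := ⟨ψ, h1, h2, h3⟩
    rw [normalDerivFunctional, dif_pos he]
    exact uA _ _ g ⟨h1, h2, h3⟩ he.choose_spec
  · intro ψ g h1 h2 h3
    have he : ∃ ψ, IsBoundaryTest B x₀ R ψ g := ⟨ψ, h1, h2, h3⟩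
    simp only [normalDerivFunctional]
    -- If `g` also extends to the inner side, cancellation gives the opposite sign; otherwise the
    -- functional is defined through the outer side. Thus it need not be known that both sides have
    -- the same traces.
    split_ifs with hc
    · have := hAB _ _ g hc.choose_spec ⟨h1, h2, h3⟩
      linarith
    · rw [neg_neg]
      exact uB _ _ g ⟨h1, h2, h3⟩ he.choose_spec

end NormalDerivative

/-! ### Independence of `H^{1/2}` from the width of the annulus. -/

section HalfSobolev

variable {x₀ : Plane} {ε R : ℝ} {g : Plane → ℝ}

/-- The transfer of extensions of a boundary function from `B_R ∖ B_{R/2}` to `B_R ∖ B_ε`, with a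
bound. -/
theorem exists_isBoundaryTest_of_trace (hε : 0 < ε) (hεR : ε < R) :
    ∃ c : ℝ, 0 ≤ c ∧ ∀ u g : Plane → ℝ, MemH1 (annulus x₀ (R / 2) R) u →
      HasTrace (annulus x₀ (R / 2) R) x₀ R u g →
      ∃ ψ H, IsH1Pair (annulus x₀ ε R) ψ H ∧ IsBoundaryTest (annulus x₀ ε R) x₀ R ψ g ∧
        Real.sqrt (∫ x in annulus x₀ ε R, ‖ψ x‖ ^ 2) ≤ c * h1Norm (annulus x₀ (R / 2) R) u ∧
        Real.sqrt (∫ x in annulus x₀ ε R, ‖H x‖ ^ 2) ≤ c * h1Norm (annulus x₀ (R / 2) R) u := by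
  have hR : 0 < R := hε.trans hεR
  -- Either of `ε` and `R / 2` may be the larger; the annulus `M` from `m` to `R` lies in both
  -- annuli, and the cutoff confines the extension to it.
  set m := max (R / 2) ε
  have hm1 : R / 2 ≤ m := le_max_left _ _
  have hm2 : ε ≤ m := le_max_right _ _
  have hmR : m < R := max_lt (by linarith) hεR
  set A := annulus x₀ ε R
  set B := annulus x₀ (R / 2) R
  set M := annulus x₀ m R
  have hA : IsOpen A := isOpen_annulus
  have hB : IsOpen B := isOpen_annulus
  have hM : IsOpen M := isOpen_annulus
  have sMA : M ⊆ A := sdiff_subset_sdiff_right (closedBall_subset_closedBall hm2)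
  have sMB : M ⊆ B := sdiff_subset_sdiff_right (closedBall_subset_closedBall hm1)
  have hV : IsOpen (closedBall x₀ m)ᶜ := isClosed_closedBall.isOpen_compl
  have hVs : sphere x₀ R ⊆ (closedBall x₀ m)ᶜ := fun x hx h => by
    rw [mem_sphere] at hx; rw [mem_closedBall] at h; linarith
  obtain ⟨χ, hχ, hχ1⟩ := exists_cutoff (isCompact_sphere x₀ R) hV hVs
  obtain ⟨C, hC⟩ := hχ.isMultiplier.bounded
  have hC0 : 0 ≤ C := (norm_nonneg _).trans (hC 0).1
  -- Both `ψ` and its gradient are bounded by `C(|u| + |∇u|)`, and `(a + b)² ≤ 2(a² + b²)`.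
  refine ⟨Real.sqrt (2 * C ^ 2), Real.sqrt_nonneg _, fun u g hu ht => ?_⟩
  have pu := hu.isH1Pair
  have pχ := pu.mul_smooth hχ.isMultiplier
  set ψ := M.indicator fun x => χ x * u x
  set H := M.indicator fun x => χ x • weakGrad B u x + u x • gradient χ x
  have pψ : IsH1Pair A ψ H := by
    refine IsH1Pair.extend_zero hM sMA (pχ.mono sMB) (isClosed_tsupport χ)
      (fun x hx => ⟨hx.2.1, hχ.supp hx.1⟩) (Eventually.of_forall fun x hx => ?_)
    rw [image_eq_zero_of_notMem_tsupport hx, zero_mul]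
  have tψ : HasTrace A x₀ R ψ g := by
    refine HasTrace.of_local hA hR.le pψ hM sMA ?_ hV hVs fun x hx => ⟨hx.1.1, hx.2⟩
    refine ((ht.mul_smooth hB hR.le pu hχ.isMultiplier).mono hB hR.le pχ hM sMB).congr hM hR.le
      (pχ.mono sMB) (indicator_ae_eq_restrict hM.measurableSet).symm ?_
    filter_upwards [ae_circleMeasure x₀ hR.le] with x hx
    rw [hχ1.self_of_nhdsSet x hx, one_mul]
  have i1 := (memLp_two_iff_integrable_sq_norm pu.memLp.1).1 pu.memLp
  have i2 := (memLp_two_iff_integrable_sq_norm pu.memLp_grad.1).1 pu.memLp_grad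
  have bound : ∀ {E : Type} [NormedAddCommGroup E] (f : Plane → E),
      (∀ x ∈ M, ‖f x‖ ≤ C * (‖u x‖ + ‖weakGrad B u x‖)) → (∀ x, x ∉ M → f x = 0) →
      Real.sqrt (∫ x in A, ‖f x‖ ^ 2) ≤ Real.sqrt (2 * C ^ 2) * h1Norm B u := by
    intro E _ f hf hf0
    rw [h1Norm, ← Real.sqrt_mul (by positivity)]
    refine Real.sqrt_le_sqrt ?_
    have i3 : IntegrableOn (fun x => 2 * C ^ 2 * (‖u x‖ ^ 2 + ‖weakGrad B u x‖ ^ 2)) B :=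
      (i1.add i2).const_mul _
    rw [setIntegral_eq_of_subset_of_forall_sdiff_eq_zero hA.measurableSet sMA fun x hx => by
      simp [hf0 x hx.2]]
    calc ∫ x in M, ‖f x‖ ^ 2
        ≤ ∫ x in M, 2 * C ^ 2 * (‖u x‖ ^ 2 + ‖weakGrad B u x‖ ^ 2) := by
          refine integral_mono_of_nonneg (Eventually.of_forall fun x => sq_nonneg _)
            (i3.mono_set sMB) ?_
          filter_upwards [ae_restrict_mem hM.measurableSet] with x hx
          have h1 := pow_le_pow_left₀ (norm_nonneg _) (hf x hx) 2
          have h2 : (‖u x‖ + ‖weakGrad B u x‖) ^ 2 ≤ 2 * (‖u x‖ ^ 2 + ‖weakGrad B u x‖ ^ 2) :=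
            add_sq_le
          rw [mul_pow] at h1
          nlinarith [mul_le_mul_of_nonneg_left h2 (sq_nonneg C)]
      _ ≤ ∫ x in B, 2 * C ^ 2 * (‖u x‖ ^ 2 + ‖weakGrad B u x‖ ^ 2) :=
          setIntegral_mono_set i3 (Eventually.of_forall fun x => by positivity)
            sMB.eventuallyLE
      _ = _ := by
          rw [integral_const_mul, integral_add i1 i2]
          simp_rw [Real.norm_eq_abs, sq_abs]
  refine ⟨ψ, H, pψ, ⟨pψ.memH1, ⟨closedBall x₀ R ∩ tsupport χ,
    (isCompact_closedBall x₀ R).inter_right (isClosed_tsupport χ), fun x hx => ?_, ?_⟩, tψ⟩,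
    bound ψ (fun x hx => ?_) (fun x hx => indicator_of_notMem hx _),
    bound H (fun x hx => ?_) (fun x hx => indicator_of_notMem hx _)⟩
  · have h1 := hx.1
    rw [← ball_union_sphere] at h1
    exact h1.imp (fun h => sMA ⟨h, hχ.supp hx.2⟩) id
  · filter_upwards [ae_mem_annulus] with x hx hxK
    have : x ∉ tsupport χ := fun h => hxK ⟨ball_subset_closedBall hx.1, h⟩
    simp [ψ, image_eq_zero_of_notMem_tsupport this]
  · rw [show ψ x = _ from indicator_of_mem hx _, norm_mul]
    have := (hC x).1
    nlinarith [norm_nonneg (u x), norm_nonneg (weakGrad B u x)]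
  · rw [show H x = _ from indicator_of_mem hx _]
    refine (norm_add_le _ _).trans ?_
    rw [norm_smul, norm_smul]
    have h1 := mul_le_mul_of_nonneg_right (hC x).1 (norm_nonneg (weakGrad B u x))
    have h2 := mul_le_mul_of_nonneg_left (hC x).2 (norm_nonneg (u x))
    linarith

end HalfSobolev

/-! ### From a perforated solution to a transmission solution. -/

section TransmissionExistence

variable {D : Set Plane} {x₀ : Plane} {α ε R : ℝ} {h u : Plane → ℝ}

/-- A normal derivative on the outer circle of an annulus is bounded on `H^{1/2}`. -/
theorem HasNormalDeriv.memHMinusHalf (hα : 0 < α) (hε : 0 < ε) (hεR : ε < R)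
    (hh : MemLp h 2 (volume.restrict (annulus x₀ ε R))) (hu : MemH1 (annulus x₀ ε R) u)
    (hs : SolvesPDE (annulus x₀ ε R) α h u) {q : (Plane → ℝ) → ℝ}
    (hq : HasNormalDeriv (annulus x₀ ε R) x₀ R u q) : MemHMinusHalf x₀ R q := by
  have hR : 0 < R := hε.trans hεR
  have hA : IsOpen (annulus x₀ ε R) := isOpen_annulus
  obtain ⟨c, hc, key⟩ := exists_isBoundaryTest_of_trace (x₀ := x₀) hε hεR
  -- On traces `q` is a residual of any extension, and the residual is linear in its test function;
  -- linearity and boundedness of `q` follow from this formula.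
  have val : ∀ {ψ g : Plane → ℝ} {H : Plane → Plane}, IsH1Pair (annulus x₀ ε R) ψ H →
      IsBoundaryTest (annulus x₀ ε R) x₀ R ψ g →
      α * q g = weakResidual (annulus x₀ ε R) α h u (weakGrad (annulus x₀ ε R) u) ψ H := by
    intro ψ g H hH hψ
    rw [← hq ψ g hψ.mem hψ.supp hψ.trace, hs.mul_greenForm hA hα.ne' hh hu.isH1Pair hH]
  refine ⟨fun g₁ g₂ h₁ h₂ => ?_, fun a g h₁ => ?_, ?_⟩
  · obtain ⟨u₁, m₁, t₁⟩ := h₁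
    obtain ⟨u₂, m₂, t₂⟩ := h₂
    obtain ⟨ψ₁, H₁, p₁, b₁, -⟩ := key u₁ g₁ m₁ t₁
    obtain ⟨ψ₂, H₂, p₂, b₂, -⟩ := key u₂ g₂ m₂ t₂
    have := val (p₁.add p₂) (b₁.add hA hR.le b₂)
    rw [weakResidual_add hh hu.isH1Pair p₁ p₂, ← val p₁ b₁, ← val p₂ b₂, ← mul_add] at this
    exact mul_left_cancel₀ hα.ne' this
  · obtain ⟨u₁, m₁, t₁⟩ := h₁
    obtain ⟨ψ₁, H₁, p₁, b₁, -⟩ := key u₁ g m₁ t₁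
    have := val (p₁.const_smul a) (b₁.const_mul hA hR.le a)
    rw [weakResidual_const_smul, ← val p₁ b₁, mul_left_comm] at this
    exact mul_left_cancel₀ hα.ne' this
  · have pu := hu.isH1Pair
    obtain ⟨a₁, ha₁⟩ : ∃ a, a = Real.sqrt (∫ x in annulus x₀ ε R,
      ‖weakGrad (annulus x₀ ε R) u x‖ ^ 2) := ⟨_, rfl⟩
    obtain ⟨a₂, ha₂⟩ : ∃ a, a = Real.sqrt (∫ x in annulus x₀ ε R, ‖u x‖ ^ 2) := ⟨_, rfl⟩
    obtain ⟨a₃, ha₃⟩ : ∃ a, a = Real.sqrt (∫ x in annulus x₀ ε R, ‖h x‖ ^ 2) := ⟨_, rfl⟩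
    have h₁ : 0 ≤ a₁ := ha₁ ▸ Real.sqrt_nonneg _
    have h₂ : 0 ≤ a₂ := ha₂ ▸ Real.sqrt_nonneg _
    have h₃ : 0 ≤ a₃ := ha₃ ▸ Real.sqrt_nonneg _
    set S := α * a₁ + a₂ + a₃
    have hS : 0 ≤ S := by positivity
    have hC : 0 < α⁻¹ * S * c + 1 := by positivity
    -- The added `1` makes the constant positive, so it can be divided out and the bound for each
    -- single extension compared with the infimum defining `hHalfNorm`.
    refine ⟨α⁻¹ * S * c + 1, fun g ⟨u₀, m₀, t₀⟩ => ?_⟩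
    rw [← div_le_iff₀' hC]
    refine le_csInf ⟨_, u₀, m₀, t₀, rfl⟩ ?_
    rintro _ ⟨u₁, m₁, t₁, rfl⟩
    obtain ⟨ψ, H, p, b, n₁, n₂⟩ := key u₁ g m₁ t₁
    set T := h1Norm (annulus x₀ (R / 2) R) u₁
    have hT : 0 ≤ T := Real.sqrt_nonneg _
    rw [div_le_iff₀' hC]
    have b1 := (abs_integral_inner_le pu.memLp_grad p.memLp_grad).trans
      (mul_le_mul_of_nonneg_left n₂ (Real.sqrt_nonneg _))
    have b2 := (abs_integral_inner_le p.memLp pu.memLp).trans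
      (mul_le_mul_of_nonneg_right n₁ (Real.sqrt_nonneg _))
    have b3 := (abs_integral_inner_le p.memLp hh).trans
      (mul_le_mul_of_nonneg_right n₁ (Real.sqrt_nonneg _))
    have e : q g = α⁻¹ * weakResidual (annulus x₀ ε R) α h u (weakGrad (annulus x₀ ε R) u) ψ H := by
      rw [← val p b, inv_mul_cancel_left₀ hα.ne']
    have b4 : |weakResidual (annulus x₀ ε R) α h u (weakGrad (annulus x₀ ε R) u) ψ H|
        ≤ S * (c * T) := by
      have b1' := mul_le_mul_of_nonneg_left b1 hα.le
      rw [← abs_of_pos hα, ← abs_mul, abs_of_pos hα] at b1'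
      have t1 := abs_add_le (α * ∫ x in annulus x₀ ε R,
        inner ℝ (weakGrad (annulus x₀ ε R) u x) (H x)) (∫ x in annulus x₀ ε R, u x * ψ x)
      have t2 := abs_sub (α * (∫ x in annulus x₀ ε R,
        inner ℝ (weakGrad (annulus x₀ ε R) u x) (H x)) + ∫ x in annulus x₀ ε R, u x * ψ x)
        (∫ x in annulus x₀ ε R, h x * ψ x)
      change |∫ x in annulus x₀ ε R, u x * ψ x| ≤ _ at b2
      change |∫ x in annulus x₀ ε R, h x * ψ x| ≤ _ at b3
      have e2 : S * (c * T) = α * (a₁ * (c * T)) + c * T * a₂ + c * T * a₃ := by ring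
      rw [← ha₁] at b1'
      rw [← ha₂] at b2
      rw [← ha₃] at b3
      rw [weakResidual, e2]
      linarith
    rw [e, abs_mul, abs_of_pos (inv_pos.2 hα)]
    calc α⁻¹ * |weakResidual (annulus x₀ ε R) α h u (weakGrad (annulus x₀ ε R) u) ψ H|
        ≤ α⁻¹ * (S * (c * T)) := by gcongr
      _ ≤ (α⁻¹ * S * c + 1) * T := by linarith

/-- A test function on `Ω` vanishes near `∂B_ε`, hence is admissible in the perforated problem. -/
theorem IsPerforatedSolution.solvesPDE (hD : IsOpen D) (hα : 0 < α) (hε : 0 < ε)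
    (hh : MemLp h 2 (volume.restrict D)) (hu : IsPerforatedSolution D x₀ α ε h u)
    {Ω : Set Plane} (hΩ : IsOpen Ω) (hsub : Ω ⊆ outside D x₀ ε) : SolvesPDE Ω α h u := by
  have hO : IsOpen (outside D x₀ ε) := isOpen_outside hD
  have pu := hu.isZeroTracePair.pair
  refine solvesPDE_of_weakResidual hΩ hα.ne'
    (hh.mono_measure (Measure.restrict_mono (hsub.trans outside_subset) le_rfl)) (pu.mono hsub)
    fun φ hφ => ?_
  rw [← weakResidual_restrict hO.measurableSet hsub (fun x hx => hφ.eq_zero hx)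
    fun x hx => hφ.gradient_eq_zero hx]
  refine hu.weakResidual_eq_zero hD ⟨hφ.isH1Pair, hasTrace_zero_of_vanish hO hε.le hφ.isH1Pair
    (isClosed_tsupport φ).isOpen_compl (fun x hx hxφ => ?_)
    (Eventually.of_forall fun x hx => image_eq_zero_of_notMem_tsupport hx)⟩
  exact (hsub (hφ.supp hxφ)).2 (sphere_subset_closedBall hx)

/-- The Neumann condition on `∂D` is natural: a function on `D ∖ B_R` vanishing near `∂B_R`,
extended by zero to `D ∖ B_ε`, is admissible in the perforated problem. -/
theorem IsPerforatedSolution.neumannZeroOuter (hD : IsOpen D) (hα : 0 < α) (hε : 0 < ε)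
    (hεR : ε < R) (hh : MemLp h 2 (volume.restrict D))
    (hu : IsPerforatedSolution D x₀ α ε h u) : NeumannZeroOuter D x₀ R u := by
  have hO : IsOpen (outside D x₀ ε) := isOpen_outside hD
  have hE : IsOpen (outside D x₀ R) := isOpen_outside hD
  have sE : outside D x₀ R ⊆ outside D x₀ ε := outside_anti hεR.le
  have pu := hu.isZeroTracePair.pair
  rintro ψ hψ ⟨ρ, hρ, h0⟩
  have pe : IsH1Pair (outside D x₀ ε) ((outside D x₀ R).indicator ψ)
      ((outside D x₀ R).indicator (weakGrad (outside D x₀ R) ψ)) := by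
    refine IsH1Pair.extend_zero hE sE hψ.isH1Pair (F := (ball x₀ ρ)ᶜ) isOpen_ball.isClosed_compl
      (fun x hx => ⟨hx.2.1, fun h => hx.1 (closedBall_subset_ball hρ h)⟩) ?_
    filter_upwards [h0] with x hx hxF using hx (not_not.1 hxF)
  have te : HasTrace (outside D x₀ ε) x₀ ε ((outside D x₀ R).indicator ψ) fun _ => 0 := by
    refine hasTrace_zero_of_vanish hO hε.le pe (isOpen_ball (x := x₀) (ε := R)) (fun x hx => ?_)
      (Eventually.of_forall fun x hx => indicator_of_notMem
        (fun h => h.2 (ball_subset_closedBall hx)) _)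
    rw [mem_sphere] at hx; rw [mem_ball]; linarith
  have := hu.weakResidual_eq_zero hD ⟨pe, te⟩
  rw [weakResidual_restrict hO.measurableSet sE (fun x hx => indicator_of_notMem hx _)
    (fun x hx => indicator_of_notMem hx _), weakResidual_congr .rfl .rfl
    (indicator_ae_eq_restrict hE.measurableSet) (indicator_ae_eq_restrict hE.measurableSet),
    ← (hu.solvesPDE hD hα hε hh hE sE).mul_greenForm hE hα.ne' (hh.mono_measure
      (Measure.restrict_mono outside_subset le_rfl)) (pu.mono sE) hψ.isH1Pair] at this
  exact (mul_eq_zero.1 this).resolve_left hα.ne'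

/-- A solution of the perforated problem solves the transmission problem. -/
theorem IsPerforatedSolution.isTransmissionSolution (hD : IsOpen D) (hα : 0 < α) (hε : 0 < ε)
    (hεR : ε < R) (hRD : closedBall x₀ R ⊆ D) (hh : MemLp h 2 (volume.restrict D))
    (hu : IsPerforatedSolution D x₀ α ε h u) : IsTransmissionSolution D x₀ α ε R h u u := by
  have hR : 0 < R := hε.trans hεR
  have hO : IsOpen (outside D x₀ ε) := isOpen_outside hD
  have hE : IsOpen (outside D x₀ R) := isOpen_outside hD
  have hA : IsOpen (annulus x₀ ε R) := isOpen_annulus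
  have sA : annulus x₀ ε R ⊆ outside D x₀ ε := annulus_subset_outside hRD
  have sE : outside D x₀ R ⊆ outside D x₀ ε := outside_anti hεR.le
  have hhO := hh.mono_measure (Measure.restrict_mono (outside_subset (x₀ := x₀) (ε := ε)) le_rfl)
  have hhA := hhO.mono_measure (Measure.restrict_mono sA le_rfl)
  have hhE := hhO.mono_measure (Measure.restrict_mono sE le_rfl)
  have zu := hu.isZeroTracePair
  have pu := zu.pair
  have pdeA := hu.solvesPDE hD hα hε hh hA sA
  have pdeE := hu.solvesPDE hD hα hε hh hE sE
  obtain ⟨g, hg⟩ := pu.exists_trace hO hR (sphere_subset_outside hεR hRD)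
  have sub : ∀ {Ω : Set Plane}, IsOpen Ω → Ω ⊆ outside D x₀ ε → ∀ ψ ψ', MemH1 Ω ψ → MemH1 Ω ψ' →
      greenForm Ω u (fun x => ψ x - ψ' x) = greenForm Ω u ψ - greenForm Ω u ψ' := by
    intro Ω hΩ hsub ψ ψ' hψ hψ'
    have hhΩ := hhO.mono_measure (Measure.restrict_mono hsub le_rfl)
    have pde := hu.solvesPDE hD hα hε hh hΩ hsub
    refine mul_left_cancel₀ hα.ne' ?_
    rw [mul_sub, pde.mul_greenForm hΩ hα.ne' hhΩ (pu.mono hsub) hψ.isH1Pair,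
      pde.mul_greenForm hΩ hα.ne' hhΩ (pu.mono hsub) hψ'.isH1Pair,
      pde.mul_greenForm hΩ hα.ne' hhΩ (pu.mono hsub) (hψ.isH1Pair.sub hψ'.isH1Pair),
      weakResidual_sub hhΩ (pu.mono hsub) hψ.isH1Pair hψ'.isH1Pair]
  -- Functions on the two sides with equal traces glue to an admissible test function. Its residual
  -- is zero and splits into `α` times the two Green boundary terms, which therefore cancel.
  obtain ⟨nA, nE⟩ := hasNormalDeriv_normalDerivFunctional (x₀ := x₀) (u := u) hA hE hR.le
    (fun ψ ψ' g bA bE => by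
      have z := bA.glue hD hε hεR hRD bE
      have := hu.weakResidual_eq_zero hD z
      have i1 := outside_inter_ball (ε := ε) hRD
      have i2 := outside_diff_closedBall (D := D) (x₀ := x₀) hεR.le
      have a1 := fun f f' : Plane → ℝ => glue_ae_inner (x₀ := x₀) (r := R) (f := f) (f' := f')
        hO.measurableSet
      have a2 := fun f f' : Plane → Plane => glue_ae_inner (x₀ := x₀) (r := R) (f := f) (f' := f')
        hO.measurableSet
      have a3 := fun f f' : Plane → ℝ => glue_ae_outer (x₀ := x₀) (r := R) (f := f) (f' := f')
        hO.measurableSet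
      have a4 := fun f f' : Plane → Plane => glue_ae_outer (x₀ := x₀) (r := R) (f := f) (f' := f')
        hO.measurableSet
      rw [i1] at a1 a2
      rw [i2] at a3 a4
      rw [weakResidual_split (x₀ := x₀) (r := R) hhO pu z.pair, i1, i2,
        weakResidual_congr .rfl .rfl (a1 _ _) (a2 _ _),
        weakResidual_congr .rfl .rfl (a3 _ _) (a4 _ _),
        ← pdeA.mul_greenForm hA hα.ne' hhA (pu.mono sA) bA.mem.isH1Pair,
        ← pdeE.mul_greenForm hE hα.ne' hhE (pu.mono sE) bE.mem.isH1Pair, ← mul_add] at this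
      exact (mul_eq_zero.1 this).resolve_left hα.ne')
    (sub hA sA) (sub hE sE)
  exact ⟨g, _, nA.memHMinusHalf hα hε hεR hhA (pu.mono sA).memH1 pdeA, nA,
    ⟨(pu.mono sE).memH1, pdeE, nE, hu.neumannZeroOuter hD hα hε hεR hh⟩, hg _ hE sE,
    ⟨(pu.mono sA).memH1, pdeA, zu.trace.mono hO hε.le pu hA sA, hg _ hA sA⟩⟩

end TransmissionExistence

/-- Uniqueness is contained in the last clause: each problem has a solution, and every solution of
one agrees with every solution of the other. -/
theorem mainTheorem7 (D : Set Plane) (hD : IsOpen D) (x₀ : Plane) (α ε R : ℝ)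
    (hα : 0 < α) (hε : 0 < ε) (hεR : ε < R) (hRD : closedBall x₀ R ⊆ D)
    (h : Plane → ℝ) (hh : MemLp h 2 (volume.restrict D)) :
    (∃ vt : Plane → ℝ, IsPerforatedSolution D x₀ α ε h vt) ∧
    (∃ v vR : Plane → ℝ, IsTransmissionSolution D x₀ α ε R h v vR) ∧
    ∀ vt v vR : Plane → ℝ, IsPerforatedSolution D x₀ α ε h vt →
      IsTransmissionSolution D x₀ α ε R h v vR →
        (∀ᵐ x ∂(volume.restrict (D \ ball x₀ R)), vt x = v x) ∧
        (∀ᵐ x ∂(volume.restrict (ball x₀ R \ ball x₀ ε)), vt x = vR x) := by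
  obtain ⟨vt, hvt⟩ := exists_isPerforatedSolution (x₀ := x₀) hD hα hε hh
  exact ⟨⟨vt, hvt⟩, ⟨vt, vt, hvt.isTransmissionSolution hD hα hε hεR hRD hh⟩,
    fun vt v vR hvt ht => hvt.ae_eq_transmission hD hα hε hεR hRD hh ht⟩
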